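/- **Setting.** Let $\mathcal A$ be a closed planar annulus with outer boundary component $E_1$ and inner boundary component $E_2$, with a finite cellular decomposition $\mathcal T$ all of whose $2$-cells are triangles or quadrilaterals, and whose $1$-skeleton is a simple graph, with conductances $c(x,y)=c(y,x)>0$ on the edges. Let $k>0$, and let $g$ be the solution of the discrete Dirichlet problem: $g=k$ on the vertices of $E_1$, $g=0$ on the vertices of $E_2$, and $\sum_{y\sim x}c(x,y)(g(x)-g(y))=0$ at every other vertex $x$. Assume that adjacent vertices have different $g$-values unless they lie on the same boundary component, and that every vertex of $E_i$ has a neighbour outside $E_i$ ($i=1,2$). Extend $g$ affinely over edges; the level curves of the extension meet each $2$-cell in straight segments between boundary points of equal $g$-value. A slit is a path of edges from $E_1$ to $E_2$ along which $g$ is strictly decreasing. Fix one, and let $\mathcal Q_{\rm slit}$ be the quadrilateral obtained by cutting $\mathcal A$ open along it, with sides $Q(E_1)$, $Q(E_2)$ coming from $E_1$, $E_2$, and two copies $\partial\mathcal Q_{\rm base}$, $\partial\mathcal Q_{\rm top}$ of the slit, at which the level curves of $g$, traversed counterclockwise, start and end respectively. **The conjugate function $g^*$ on $\mathcal Q_{\rm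 slit}$.** A node is a vertex, or a point at which an edge on which $g$ is not constant meets a level curve of $g$ through some vertex. For a node $u$ let $\partial_n^-g(u)$ be the sum of $c(x,y)(g(x)-g(y))$ over all edges $(x,y)$, $g(x)>g(y)$, of $\mathcal Q_{\rm slit}$ not in $\partial\mathcal Q_{\rm base}$ that contain $u$ as a point other than the lower endpoint $y$; this is the normal derivative of $g$ at $u$ with respect to the part of $\mathcal Q_{\rm slit}$ below the level curve of $u$, including the edges of $\partial\mathcal Q_{\rm top}$, when edges are subdivided at $u$ with the conductance $c(x,y)(g(x)-g(y))/(g(u)-g(y))$ on the lower segment. For $u\in Q(E_2)$ let $\partial_n^+g(u)$ be the analogous sum of $c(x,y)(g(y)-g(x))$ over the edges having $u$ as the lower endpoint $y$. Put $g^*=0$ at the nodes of $\partial\mathcal Q_{\rm base}$. At any other node $v$ let $g^*(v)=\sum_u\partial_n^-g(u)$ if $v\notin Q(E_2)$ and $g^*(v)=\sum_u|\partial_n^+g(u)|$ if $v\in Q(E_2)$, where $u$ runs over the nodes on the level curve of $g$ through $v$, from its starting point on $\partial\mathcal Q_{\rm base}$ up to and including $v$. The level curves of $g$ through the vertices cut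 the $2$-cells into triangles and quadrilaterals; $g^*$ is extended affinely over the segments of edges between consecutive nodes and over the triangles, and bilinearly over the quadrilaterals. **Proposition.** A level curve of $g^*$ is a non-empty set $\{z\in\mathcal Q_{\rm slit}: g^*(z)=t\}$, $t\in\mathbb R$. Each level curve of $g^*$ has no endpoint in the interior of $\mathcal Q_{\rm slit}$ (nor anywhere else outside of $Q(E_1)\cup Q(E_2)$), is simple, and joins $Q(E_1)$ to $Q(E_2)$: it is a homeomorphic image of $[0,1]$ with one end in $Q(E_1)$, the other in $Q(E_2)$, and all other points outside of $Q(E_1)\cup Q(E_2)$. Furthermore, any two distinct level curves of $g^*$ are disjoint. -/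

import Mathlib

/-- A cellular decomposition of a closed planar annulus, all of whose two-cells are triangles or
quadrilaterals, given as an oriented map on the sphere from which two faces are removed.

`D` is the set of darts (edges with a direction). The dart `d` starts at the vertex `org d`, its
reverse is `rev d`, and `next d` is the dart that follows `d` on the counterclockwise oriented
boundary of the face on the left of `d`. Thus the faces are the cycles of `next`, and the darts
that start at a vertex form a cycle of `rev * next⁻¹`. The map lies on the sphere by Euler's
formula. The face of `outerDart` is the unbounded one, the face of `holeDart` is the bounded
component of the complement of the annulus. -/
structure AnnulusMap (D V : Type*) [Fintype D] [Fintype V] where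
  next : Equiv.Perm D
  rev : Equiv.Perm D
  org : D → V
  rev_rev : ∀ d, rev (rev d) = d
  org_surjective : Function.Surjective org
  org_eq_iff : ∀ d d', org d = org d' ↔ (rev * next⁻¹).SameCycle d d'
  /-- no loops -/
  org_rev_ne : ∀ d, org (rev d) ≠ org d
  /-- no multiple edges -/
  simple : ∀ d d', org d = org d' → org (rev d) = org (rev d') → d = d'
  connected : ∀ d d', Relation.ReflTransGen (fun x y => y = next x ∨ y = rev x) d d'
  /-- Euler's formula `#V - #D / 2 + #F = 2` of the sphere -/
  euler : 2 * (Fintype.card V + Nat.card (Quotient (Equiv.Perm.SameCycle.setoid next)))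
    = Fintype.card D + 4
  /-- the boundary of every face is a simple closed path -/
  face_simple : ∀ d d', next.SameCycle d d' → org d = org d' → d = d'
  outerDart : D
  holeDart : D
  boundary_disjoint : ∀ d d', next.SameCycle outerDart d → next.SameCycle holeDart d' →
    org d ≠ org d'
  /-- the remaining faces are triangles or quadrilaterals -/
  face_card : ∀ d, ¬ next.SameCycle outerDart d → ¬ next.SameCycle holeDart d →
    Nat.card {d' // next.SameCycle d d'} = 3 ∨ Nat.card {d' // next.SameCycle d d'} = 4

namespace AnnulusMap

variable {D V : Type*} [Fintype D] [Fintype V]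

theorem org_next (M : AnnulusMap D V) (d : D) : M.org (M.next d) = M.org (M.rev d) := by
  rw [M.org_eq_iff]
  exact ⟨1, by simp⟩

/-- The vertices of the outer boundary component `E₁`. -/
def E₁ (M : AnnulusMap D V) : Set V := {v | ∃ d, M.next.SameCycle M.outerDart d ∧ M.org d = v}

/-- The vertices of the inner boundary component `E₂`. -/
def E₂ (M : AnnulusMap D V) : Set V := {v | ∃ d, M.next.SameCycle M.holeDart d ∧ M.org d = v}

/-- The dart `d` has a two-cell of the annulus on its left. -/
def Inner (M : AnnulusMap D V) (d : D) : Prop :=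
  ¬ M.next.SameCycle M.outerDart d ∧ ¬ M.next.SameCycle M.holeDart d

/-- Darts together with a two-cell of the annulus on their left, that is, the sides of the
two-cells of the annulus. -/
abbrev Side (M : AnnulusMap D V) : Type _ := {d : D // M.Inner d}

/-- Conductances: positive, and symmetric. -/
def IsConductance (M : AnnulusMap D V) (c : D → ℝ) : Prop :=
  (∀ d, 0 < c d) ∧ ∀ d, c (M.rev d) = c d

open Classical in
/-- `Δ g (v) = ∑_{w ∼ v} c(v,w) (g(v) - g(w))`. -/
noncomputable def laplacian (M : AnnulusMap D V) (c : D → ℝ) (g : V → ℝ) (v : V) : ℝ :=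
  ∑ d : D, if M.org d = v then c d * (g v - g (M.org (M.rev d))) else 0

/-- `g` solves the discrete Dirichlet boundary value problem with value `k` on `E₁` and value `0`
on `E₂`. -/
structure IsDirichletSolution (M : AnnulusMap D V) (c : D → ℝ) (k : ℝ) (g : V → ℝ) : Prop where
  on_E₁ : ∀ v ∈ M.E₁, g v = k
  on_E₂ : ∀ v ∈ M.E₂, g v = 0
  harmonic : ∀ v, v ∉ M.E₁ → v ∉ M.E₂ → M.laplacian c g v = 0

/-- A slit: a combinatorial path from `E₁` to `E₂` along which `g` decreases (so it is simple). -/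
structure IsSlit (M : AnnulusMap D V) (g : V → ℝ) {n : ℕ} (s : Fin (n + 1) → D) : Prop where
  start : M.org (s 0) ∈ M.E₁
  finish : M.org (M.rev (s (Fin.last n))) ∈ M.E₂
  path : ∀ i : Fin n, M.org (M.rev (s i.castSucc)) = M.org (s i.succ)
  decreasing : ∀ i, g (M.org (M.rev (s i))) < g (M.org (s i))

/-! ### The two-cells and the quadrilateral obtained by cutting along the slit

The corners of the two-cell on the left of `d` are indexed by the darts of its boundary (the corner
`d` sits at the vertex `org d`), and its points have coordinates with respect to these corners, so
that the two-cells are pairwise disjoint subsets of `D → ℝ`. -/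

variable [DecidableEq D]

/-- The point of the side `d` that divides it in the ratio `r : 1 - r`. -/
noncomputable def sidePt (M : AnnulusMap D V) (d : D) (r : unitInterval) : D → ℝ :=
  (1 - (r : ℝ)) • Pi.single d 1 + (r : ℝ) • Pi.single (M.next d) 1

/-- The value at `sidePt d r` of the affine extension of `g` over the edges. -/
def sideLevel (M : AnnulusMap D V) (g : V → ℝ) (d : D) (r : unitInterval) : ℝ :=
  (1 - (r : ℝ)) * g (M.org d) + (r : ℝ) * g (M.org (M.rev d))

/-- A point on a straight segment that joins two points of the boundary of a two-cell at which `g`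
has the same value. These segments are the pieces in which the level curves of `g` meet the
two-cell. -/
structure ChordPoint (M : AnnulusMap D V) (g : V → ℝ) where
  e : M.Side
  e' : M.Side
  same_cell : M.next.SameCycle e.1 e'.1
  r : unitInterval
  r' : unitInterval
  same_level : M.sideLevel g e.1 r = M.sideLevel g e'.1 r'
  s : unitInterval

/-- Coordinates of a chord point. -/
noncomputable def ChordPoint.coord {M : AnnulusMap D V} {g : V → ℝ} (p : M.ChordPoint g) : D → ℝ :=
  (1 - (p.s : ℝ)) • M.sidePt p.e.1 p.r + (p.s : ℝ) • M.sidePt p.e'.1 p.r'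

/-- The disjoint union of the closed two-cells. Each of them is the union of the segments on which
`g` is constant: for a triangle this is the whole simplex spanned by the corners, for a
quadrilateral a ruled disc in the simplex spanned by the four corners. -/
def Cells (M : AnnulusMap D V) (g : V → ℝ) : Set (D → ℝ) :=
  Set.range (fun p : M.ChordPoint g => p.coord)

/-- Two adjacent two-cells are glued along their common edge, unless the edge is in the slit (`S` is
the set of darts of the slit, directed from `E₁` to `E₂`). -/
def Glue (M : AnnulusMap D V) (g : V → ℝ) (S : Set D) (x y : M.Cells g) : Prop :=
  ∃ d : D, M.Inner d ∧ M.Inner (M.rev d) ∧ d ∉ S ∧ M.rev d ∉ S ∧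
    ∃ r : unitInterval, x.1 = M.sidePt d r ∧ y.1 = M.sidePt (M.rev d) (unitInterval.symm r)

/-- The quadrilateral `Q_slit`: the annulus cut open along the slit. -/
abbrev QSlit (M : AnnulusMap D V) (g : V → ℝ) (S : Set D) : Type _ := Quot (M.Glue g S)

/-- The point of `Q_slit` given by a chord point. -/
noncomputable def ChordPoint.toQ {M : AnnulusMap D V} {g : V → ℝ} (S : Set D)
    (p : M.ChordPoint g) : M.QSlit g S :=
  Quot.mk _ ⟨p.coord, p, rfl⟩

/-- The point of `Q_slit` on the side `e` in the ratio `r : 1 - r`. -/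
noncomputable def pt (M : AnnulusMap D V) (g : V → ℝ) (S : Set D) (e : M.Side) (r : unitInterval) :
    M.QSlit g S :=
  ChordPoint.toQ S ⟨e, e, Equiv.Perm.SameCycle.refl _ _, r, r, rfl, 0⟩

theorem exists_chordPoint (M : AnnulusMap D V) (g : V → ℝ) (S : Set D) (z : M.QSlit g S) :
    ∃ p : M.ChordPoint g, p.toQ S = z := by
  obtain ⟨⟨_, p, rfl⟩, rfl⟩ := Quot.exists_rep z
  exact ⟨p, rfl⟩

/-- The linear function of the coordinates that has the value `g (org d)` at the corner `d`. -/
noncomputable def linearExt (M : AnnulusMap D V) (g : V → ℝ) (x : D → ℝ) : ℝ :=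
  ∑ d, x d * g (M.org d)

theorem linearExt_sidePt (M : AnnulusMap D V) (g : V → ℝ) (d : D) (r : unitInterval) :
    M.linearExt g (M.sidePt d r) = M.sideLevel g d r := by
  simp [linearExt, sidePt, sideLevel, add_mul, Finset.sum_add_distrib, Pi.single_apply, org_next]

/-- The extension of `g` to `Q_slit`. -/
noncomputable def gExt (M : AnnulusMap D V) (g : V → ℝ) (S : Set D) : M.QSlit g S → ℝ :=
  Quot.lift (fun x => M.linearExt g x.1) (by
    rintro ⟨x, hx⟩ ⟨y, hy⟩ ⟨d, -, -, -, -, r, h, h'⟩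
    simp only at h h'
    simp only [h, h', linearExt_sidePt, sideLevel, M.rev_rev, unitInterval.coe_symm_eq]
    ring)

/-- The copy of the slit from which the level curves of `g`, run through counterclockwise,
start: its sides are the reverses of the (descending) darts of the slit. -/
def base (M : AnnulusMap D V) (g : V → ℝ) (S : Set D) : Set (M.QSlit g S) :=
  {z | ∃ e : M.Side, M.rev e.1 ∈ S ∧ ∃ r, z = M.pt g S e r}

/-- The copy of the slit at which the level curves of `g`, run through counterclockwise, end. -/
def top (M : AnnulusMap D V) (g : V → ℝ) (S : Set D) : Set (M.QSlit g S) :=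
  {z | ∃ e : M.Side, e.1 ∈ S ∧ ∃ r, z = M.pt g S e r}

/-- The boundary side of `Q_slit` that corresponds to `E₁`. -/
def QE₁ (M : AnnulusMap D V) (g : V → ℝ) (S : Set D) : Set (M.QSlit g S) :=
  {z | ∃ e : M.Side, M.next.SameCycle M.outerDart (M.rev e.1) ∧ ∃ r, z = M.pt g S e r}

/-- The boundary side of `Q_slit` that corresponds to `E₂`. -/
def QE₂ (M : AnnulusMap D V) (g : V → ℝ) (S : Set D) : Set (M.QSlit g S) :=
  {z | ∃ e : M.Side, M.next.SameCycle M.holeDart (M.rev e.1) ∧ ∃ r, z = M.pt g S e r}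

/-! ### The conjugate function -/

/-- The positions on the side `e` of its nodes: its two end points and, if `g` is not constant
on it, its intersections with the level curves of `g` through the vertices (type I vertices). -/
def nodeParams (M : AnnulusMap D V) (g : V → ℝ) (e : M.Side) : Set unitInterval :=
  {r | r = 0 ∨ r = 1 ∨
    (g (M.org e.1) ≠ g (M.org (M.rev e.1)) ∧ ∃ v, M.sideLevel g e.1 r = g v)}

/-- The vertices and the type I vertices of `Q_slit`. -/
def IsNode (M : AnnulusMap D V) (g : V → ℝ) (S : Set D) (u : M.QSlit g S) : Prop :=
  ∃ e : M.Side, ∃ r ∈ M.nodeParams g e, u = M.pt g S e r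

/-- The conductance of the segment of the edge of `d` between two of its points at which `g` has
the values `a` and `b`: `c(d) (g(org d) - g(end d)) / (a - b)`. -/
noncomputable def segConductance (M : AnnulusMap D V) (c : D → ℝ) (g : V → ℝ) (d : D)
    (a b : ℝ) : ℝ :=
  c d * (g (M.org d) - g (M.org (M.rev d))) / (a - b)

/-- The normal derivative of `g` at the node `u` with respect to the part of `Q_slit` below the
level curve of `u`: the sum of `c̃(u,w) (g(u) - g(w))` over the edges that go down from `u`, with `w`
the lower end of the edge. (A further subdivision of the edge below `u` changes neither this
product, nor the sum.) Every edge is represented by the side of its descending dart; hence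
the edges of `top` are included and those of `base` are not. -/
noncomputable def normalDerivBelow (M : AnnulusMap D V) (c : D → ℝ) (g : V → ℝ) (S : Set D)
    (u : M.QSlit g S) : ℝ :=
  ∑ᶠ (e : M.Side) (_ : g (M.org (M.rev e.1)) < g (M.org e.1) ∧ ∃ r : unitInterval, r < 1 ∧ u = M.pt g S e r),
    M.segConductance c g e.1 (M.gExt g S u) (g (M.org (M.rev e.1))) *
      (M.gExt g S u - g (M.org (M.rev e.1)))

/-- The normal derivative of `g` at the node `u` with respect to the part of `Q_slit` above the
level curve of `u`; again the edges of `top` are included and those of `base` are not. -/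
noncomputable def normalDerivAbove (M : AnnulusMap D V) (c : D → ℝ) (g : V → ℝ) (S : Set D)
    (u : M.QSlit g S) : ℝ :=
  ∑ᶠ (e : M.Side) (_ : g (M.org (M.rev e.1)) < g (M.org e.1) ∧ ∃ r : unitInterval, 0 < r ∧ u = M.pt g S e r),
    M.segConductance c g e.1 (g (M.org e.1)) (M.gExt g S u) *
      (M.gExt g S u - g (M.org e.1))

/-- The nodes on the level curve `L(v)` of `g` from its starting point `π(v)` on `base` up
to and including `v`. -/
def nodesUpTo (M : AnnulusMap D V) (g : V → ℝ) (S : Set D) (v : M.QSlit g S) :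
    Set (M.QSlit g S) :=
  {u | M.IsNode g S u ∧ M.gExt g S u = M.gExt g S v ∧
    (u = v ∨ ∃ p ∈ M.base g S, M.gExt g S p = M.gExt g S v ∧
      u ∈ connectedComponentIn ({w | M.gExt g S w = M.gExt g S v} \ {v}) p)}

open Classical in
/-- The value of the conjugate function at a node: zero on `base`, and otherwise the sum of the
normal derivatives of `g` along its level curve from `base` to the node. -/
noncomputable def nodeValue (M : AnnulusMap D V) (c : D → ℝ) (g : V → ℝ) (S : Set D)
    (v : M.QSlit g S) : ℝ :=
  if v ∈ M.base g S then 0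
  else if v ∈ M.QE₂ g S then ∑ᶠ u ∈ M.nodesUpTo g S v, |M.normalDerivAbove c g S u|
  else ∑ᶠ u ∈ M.nodesUpTo g S v, M.normalDerivBelow c g S u

open Classical in
/-- The value of the conjugate function on a side: affine between consecutive nodes. -/
noncomputable def sideValue (M : AnnulusMap D V) (c : D → ℝ) (g : V → ℝ) (S : Set D)
    (e : M.Side) (r : unitInterval) : ℝ :=
  let a : unitInterval := sSup {ρ | ρ ∈ M.nodeParams g e ∧ ρ ≤ r}
  let b : unitInterval := sInf {ρ | ρ ∈ M.nodeParams g e ∧ r ≤ ρ}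
  if a = b then M.nodeValue c g S (M.pt g S e a)
  else (((b : ℝ) - r) * M.nodeValue c g S (M.pt g S e a) +
    ((r : ℝ) - a) * M.nodeValue c g S (M.pt g S e b)) / ((b : ℝ) - a)

/-- The conjugate function `g*` on `Q_slit`. The level curves of `g` through the vertices cut the
two-cells into triangles and quadrilaterals with two opposite sides on level curves; the affine,
respectively bilinear, extension over such a piece is affine on every segment on which `g`
is constant. (The value does not depend on the representation as a chord point.) -/
noncomputable def gStar (M : AnnulusMap D V) (c : D → ℝ) (g : V → ℝ) (S : Set D)
    (z : M.QSlit g S) : ℝ :=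
  let p := (M.exists_chordPoint g S z).choose
  (1 - (p.s : ℝ)) * M.sideValue c g S p.e p.r + (p.s : ℝ) * M.sideValue c g S p.e' p.r'

end AnnulusMap

/-- `C` is a level curve of `f`: the non-empty set of all points where `f` has some fixed value. -/
def IsLevelCurve {X : Type*} (f : X → ℝ) (C : Set X) : Prop :=
  C.Nonempty ∧ ∃ t : ℝ, C = {z | f z = t}

/-- `C` is a simple curve which joins `A` to `B`: a homeomorphic image of `[0,1]` with its first
point in `A` and its last point in `B`, all other points being outside of `A` and `B`. -/
def IsSimpleCurveJoining {X : Type*} [TopologicalSpace X] (C A B : Set X) : Prop :=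
  ∃ γ : unitInterval → X, Topology.IsEmbedding γ ∧ Set.range γ = C ∧ γ 0 ∈ A ∧ γ 1 ∈ B ∧
    ∀ t : unitInterval, 0 < t → t < 1 → γ t ∉ A ∪ B

/-- The curve `C` passes through its point `z` without ending there: near `z` it is an open arc. -/
def IsNotEndpoint {X : Type*} [TopologicalSpace X] (C : Set X) (z : X) : Prop :=
  ∃ U : Set X, IsOpen U ∧ z ∈ U ∧ Nonempty (↥(C ∩ U) ≃ₜ ℝ)

/-! ### Cycles of permutations -/

/-! The pair (`gExt`, `gStar`) maps `QSlit` homeomorphically onto the rectangle [0, k] × [0, T],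
where T is the total flux of `g`. The level curves of `gStar` are then the preimages of the segments
[0, k] × {t}, and everything claimed about them is evident in the rectangle. As `QSlit` is compact,
only continuity, injectivity and the image are at stake. They amount to this: every level curve of
`g` is a simple arc from the base copy of the slit to the top copy, along which `gStar` increases
strictly from 0 to T.

The shape of the level curves of `g` comes from a discrete Poincaré–Hopf argument (`index_eq`). The
maximum principle bounds from below the number of sign changes of `g` about each vertex, and a
similar bound holds for each cell. By Euler's formula the sum of these bounds is attained, so each
of them is an equality. Hence there are no saddles: a level curve crosses a cell at most once
(`exits_unique`, `enters_unique`), and sides on which `g` is constant lie on the boundary of the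
annulus. The darts leaving a superlevel set are therefore permuted by passing counterclockwise to
the next one. A harmonic conjugate on the cells (`exists_conjugate`), obtained by duality from the
exactness of closed cochains on the sphere, increases along this permutation except at the slit. So
no orbit avoids the slit; as the slit crosses each level once, there is a single orbit
(`exists_chain`).

The values of `gStar` at the nodes are defined through connected components of level curves, so they
cannot be evaluated before those curves are understood. An auxiliary function with the required
monotonicity (`exists_isSideFunction`) is therefore built from the conjugate on the cells and a
potential on the corners. It orders the points of each level curve and identifies the value of
`gStar` at a node as a partial sum of positive edge fluxes (`nodeValue_eq`). Such partial sums grow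
strictly along the segments of level curves, so `gStar` itself is a side function
(`isSideFunction_sideValue`), and what was proved for the auxiliary function applies to it. -/

@[simp]
theorem Equiv.Perm.sameCycle_self {D : Type*} (σ : Equiv.Perm D) (x : D) : σ.SameCycle x x :=
  Equiv.Perm.SameCycle.refl _ _

theorem Equiv.Perm.SameCycle.exists_exit {D : Type*} [Finite D] {σ : Equiv.Perm D} {x y : D}
    (h : σ.SameCycle x y) (P : D → Prop) (hx : P x) (hy : ¬ P y) :
    ∃ z, σ.SameCycle x z ∧ P z ∧ ¬ P (σ z) := by
  by_contra! hcon
  have key : ∀ n : ℕ, P ((σ ^ n) x) := by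
    intro n
    induction n with
    | zero => simpa using hx
    | succ n ih =>
      rw [pow_succ', Equiv.Perm.mul_apply]
      exact hcon _ ⟨n, by simp⟩ ih
  obtain ⟨n, hn⟩ := h.exists_nat_pow_eq
  exact hy (hn ▸ key n)

open Classical in
/-- A property that changes along a cycle changes at least twice. -/
theorem Equiv.Perm.SameCycle.two_le_sum {D : Type*} [Finite D] {σ : Equiv.Perm D} {x y : D}
    (h : σ.SameCycle x y) (P : D → Prop) (hx : P x) (hy : ¬ P y) (s : Finset D)
    (hs : ∀ z, σ.SameCycle x z → z ∈ s) :
    (2 : ℤ) ≤ ∑ d ∈ s, if (P d ↔ P (σ d)) then 0 else 1 := by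
  obtain ⟨z, hz, hPz, hPz'⟩ := h.exists_exit P hx hy
  obtain ⟨w, hw, hPw, hPw'⟩ := h.symm.exists_exit (fun d => ¬ P d) hy (by simpa using hx)
  have hne : z ≠ w := by rintro rfl; exact hPw hPz
  calc (2 : ℤ) = ∑ d ∈ {z, w}, if (P d ↔ P (σ d)) then 0 else 1 := by
        rw [Finset.sum_pair hne]
        simp_all
    _ ≤ _ := by
        refine Finset.sum_le_sum_of_subset_of_nonneg ?_ (fun _ _ _ => by split_ifs <;> simp)
        intro d hd
        simp only [Finset.mem_insert, Finset.mem_singleton] at hd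
        rcases hd with rfl | rfl
        · exact hs _ hz
        · exact hs _ (h.trans hw)

/-! ### Linear equations -/

/-- The finite-dimensional Fredholm alternative: a vector outside the range is separated from it by
a functional, and every functional on `D → ℝ` is a dot product. All potentials below are obtained in
this way or by a dimension count. -/
theorem LinearMap.mem_range_of_forall_dual {E D : Type*} [Fintype D] [AddCommGroup E] [Module ℝ E]
    (L : E →ₗ[ℝ] (D → ℝ)) (x : D → ℝ)
    (h : ∀ y : D → ℝ, (∀ e, ∑ d, y d * L e d = 0) → ∑ d, y d * x d = 0) :
    x ∈ LinearMap.range L := by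
  classical
  by_contra hx
  obtain ⟨f, hf, hfL⟩ := Submodule.exists_le_ker_of_notMem hx
  have hf' : ∀ v : D → ℝ, f v = ∑ d, f (Pi.single d 1) * v d := by
    intro v
    rw [LinearMap.pi_apply_eq_sum_univ f v]
    refine Finset.sum_congr rfl fun d _ => ?_
    rw [smul_eq_mul, mul_comm]
    congr 2
    ext j
    simp [Pi.single_apply, eq_comm]
  apply hf
  rw [hf']
  apply h
  intro e
  rw [← hf']
  exact hfL ⟨e, rfl⟩

/-- A function is a coboundary of a permutation if it is orthogonal to the invariant functions. -/
theorem Equiv.Perm.exists_potential {D : Type*} [Fintype D] (σ : Equiv.Perm D) (κ : D → ℝ)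
    (h : ∀ y : D → ℝ, (∀ d, y (σ d) = y d) → ∑ d, y d * κ d = 0) :
    ∃ q : D → ℝ, ∀ d, q (σ d) - q d = κ d := by
  classical
  let L : (D → ℝ) →ₗ[ℝ] (D → ℝ) := LinearMap.funLeft ℝ ℝ σ - LinearMap.id
  have : κ ∈ LinearMap.range L := by
    apply LinearMap.mem_range_of_forall_dual
    intro y hy
    apply h
    intro d
    -- Testing with the indicator of `σ d` shows that a vector orthogonal to the coboundaries is
    -- invariant under `σ`.
    have h1 := hy (Pi.single (σ d) 1)
    simp [L, mul_sub, Finset.sum_sub_distrib, Pi.single_apply, LinearMap.funLeft_apply] at h1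
    linarith
  obtain ⟨q, hq⟩ := this
  exact ⟨q, fun d => by rw [← hq]; simp [L, LinearMap.funLeft_apply]⟩

/-! ### Exactness on the sphere, and potentials on the cells of the annulus -/

namespace AnnulusMap

variable {D V : Type*} [Fintype D] [Fintype V]

theorem forall_eq_of_next_rev (M : AnnulusMap D V) {X : Type*} (f : D → X)
    (h₁ : ∀ d, f (M.next d) = f d) (h₂ : ∀ d, f (M.rev d) = f d) (d d' : D) : f d' = f d := by
  induction M.connected d d' with
  | refl => rfl
  | tail _ h ih =>
    rcases h with rfl | rfl
    · rw [h₁, ih]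
    · rw [h₂, ih]

theorem sum_rev (M : AnnulusMap D V) (f : D → ℝ) : ∑ d, f (M.rev d) = ∑ d, f d :=
  Equiv.sum_comp M.rev f

/-- The faces of the map. -/
abbrev Face (M : AnnulusMap D V) : Type _ := Quotient (Equiv.Perm.SameCycle.setoid M.next)

/-- The face on the left of a dart. -/
def face (M : AnnulusMap D V) (d : D) : M.Face := Quotient.mk _ d

theorem face_eq_iff (M : AnnulusMap D V) (d d' : D) :
    M.face d = M.face d' ↔ M.next.SameCycle d d' := Quotient.eq

theorem face_next (M : AnnulusMap D V) (d : D) : M.face (M.next d) = M.face d := by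
  rw [face_eq_iff]; exact Equiv.Perm.sameCycle_apply_left.2 (Equiv.Perm.SameCycle.refl _ _)

/-- The one-cochains. -/
def antisym (M : AnnulusMap D V) : Submodule ℝ (D → ℝ) where
  carrier := {y | ∀ d, y (M.rev d) = - y d}
  add_mem' := by
    intro a b ha hb d
    rw [Pi.add_apply, Pi.add_apply, ha, hb]; ring
  zero_mem' := by intro d; simp
  smul_mem' := by
    intro r a ha d
    rw [Pi.smul_apply, Pi.smul_apply, ha, smul_neg]

/-- An arbitrary numbering of the darts orients every edge, and a cochain is determined by its
values on the positively oriented darts. The absence of loops excludes darts equal to their reverse.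
-/
theorem two_mul_finrank_antisym_le (M : AnnulusMap D V) :
    2 * Module.finrank ℝ M.antisym ≤ Fintype.card D := by
  classical
  let i : D ≃ Fin (Fintype.card D) := Fintype.equivFin D
  let O : Finset D := Finset.univ.filter fun d => i d < i (M.rev d)
  let O' : Finset D := Finset.univ.filter fun d => i (M.rev d) < i d
  have hcard : O'.card = O.card := by
    refine Finset.card_bij (fun d _ => M.rev d) ?_ ?_ ?_
    · intro d hd
      simpa [O, O', M.rev_rev] using hd
    · intro a _ b _ h
      exact M.rev.injective h
    · intro d hd
      exact ⟨M.rev d, by simpa [O, O', M.rev_rev] using hd, M.rev_rev d⟩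
  have hdisj : Disjoint O O' := by
    rw [Finset.disjoint_left]
    intro d h h'
    simp only [O, O', Finset.mem_filter, Finset.mem_univ, true_and] at h h'
    exact lt_asymm h h'
  have h2 : O.card + O'.card ≤ Fintype.card D := by
    rw [← Finset.card_union_of_disjoint hdisj]
    exact Finset.card_le_univ _
  let R : M.antisym →ₗ[ℝ] (O → ℝ) := (LinearMap.funLeft ℝ ℝ (Subtype.val : O → D)).comp
    M.antisym.subtype
  have hR : Function.Injective R := by
    rw [← LinearMap.ker_eq_bot, LinearMap.ker_eq_bot']
    rintro ⟨y, hy⟩ h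
    have h' : ∀ d, i d < i (M.rev d) → y d = 0 := fun d hd => by
      have := congrFun h ⟨d, by simp [O, hd]⟩
      simpa [R, LinearMap.funLeft_apply] using this
    ext d
    simp only [ZeroMemClass.coe_zero, Pi.zero_apply]
    rcases lt_trichotomy (i d) (i (M.rev d)) with hd | hd | hd
    · exact h' d hd
    · have := M.org_rev_ne d
      rw [← i.injective hd] at this
      exact absurd rfl this
    · have h3 := h' (M.rev d) (by rwa [M.rev_rev])
      have h4 := hy d
      linarith
  have := LinearMap.finrank_le_finrank_of_injective hR
  simp only [Module.finrank_fintype_fun_eq_card, Fintype.card_coe] at this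
  omega

/-- Rank–nullity with a kernel that consists of constants. It serves both for the coboundary of
vertex functions and for the Laplacian on the faces. -/
theorem finrank_le_finrank_range_add_one {X W : Type*} [Fintype X] [AddCommGroup W]
    [Module ℝ W] (L : (X → ℝ) →ₗ[ℝ] W) (h : ∀ f, L f = 0 → ∀ x y, f x = f y) :
    Fintype.card X ≤ Module.finrank ℝ (LinearMap.range L) + 1 := by
  have h1 := LinearMap.finrank_range_add_finrank_ker L
  have h2 : LinearMap.ker L ≤ Submodule.span ℝ {fun _ => 1} := by
    intro f hf
    rw [Submodule.mem_span_singleton]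
    by_cases hX : Nonempty X
    · obtain ⟨x⟩ := hX
      refine ⟨f x, ?_⟩
      ext y
      simpa using h f hf x y
    · rw [not_nonempty_iff] at hX
      exact ⟨0, Subsingleton.elim _ _⟩
  have h3 := (Submodule.finrank_mono h2).trans (finrank_span_le_card (R := ℝ) {fun _ : X => (1:ℝ)})
  simp only [Set.toFinset_singleton, Finset.card_singleton] at h3
  rw [Module.finrank_fintype_fun_eq_card] at h1
  omega

open Classical in
/-- On the sphere every closed one-cochain is exact. -/
theorem exists_potential_of_closed (M : AnnulusMap D V) (y : D → ℝ)
    (hy : ∀ d, y (M.rev d) = - y d)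
    (hc : ∀ F : M.Face, ∑ d with M.face d = F, y d = 0) :
    ∃ f : V → ℝ, ∀ d, y d = f (M.org (M.rev d)) - f (M.org d) := by
  let d₀ : (V → ℝ) →ₗ[ℝ] (D → ℝ) :=
    LinearMap.funLeft ℝ ℝ (fun d => M.org (M.rev d)) - LinearMap.funLeft ℝ ℝ M.org
  have hd₀ : ∀ f d, d₀ f d = f (M.org (M.rev d)) - f (M.org d) := fun f d => by
    simp [d₀, LinearMap.funLeft_apply]
  let d₁ : (D → ℝ) →ₗ[ℝ] (M.Face → ℝ) :=
    { toFun := fun z F => ∑ d with M.face d = F, z d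
      map_add' := fun a b => by ext F; simp [Finset.sum_add_distrib]
      map_smul' := fun r a => by ext F; simp [Finset.mul_sum] }
  let e₁ : M.antisym →ₗ[ℝ] (M.Face → ℝ) := d₁.comp M.antisym.subtype
  let δ : (M.Face → ℝ) →ₗ[ℝ] (D → ℝ) :=
    LinearMap.funLeft ℝ ℝ M.face - LinearMap.funLeft ℝ ℝ (fun d => M.face (M.rev d))
  have hδ : ∀ h d, δ h d = h (M.face d) - h (M.face (M.rev d)) := fun h d => by
    simp [δ, LinearMap.funLeft_apply]
  have r0 : Fintype.card V ≤ Module.finrank ℝ (LinearMap.range d₀) + 1 := by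
    apply finrank_le_finrank_range_add_one
    intro f hf
    have h2 : ∀ d, f (M.org (M.rev d)) = f (M.org d) := fun d => by
      have := congrFun hf d
      rw [hd₀] at this
      simpa [sub_eq_zero] using this
    intro v w
    obtain ⟨a, rfl⟩ := M.org_surjective v
    obtain ⟨b, rfl⟩ := M.org_surjective w
    exact M.forall_eq_of_next_rev (fun d => f (M.org d)) (fun d => by
      simp only [M.org_next, h2]) h2 b a
  -- `d₁.comp δ` is the Laplacian of the dual graph. A face function in its kernel has Dirichlet
  -- energy zero, hence is constant by connectedness; this bounds the rank of `d₁` from below.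
  have r1 : Fintype.card M.Face ≤ Module.finrank ℝ (LinearMap.range (d₁.comp δ)) + 1 := by
    apply finrank_le_finrank_range_add_one
    intro h hh
    have h1 : ∑ d, h (M.face d) * (h (M.face d) - h (M.face (M.rev d))) = 0 := by
      rw [← Finset.sum_fiberwise (s := Finset.univ) (g := M.face)]
      refine Finset.sum_eq_zero fun F _ => ?_
      have := congrFun hh F
      simp only [LinearMap.comp_apply, d₁, LinearMap.coe_mk, AddHom.coe_mk, hδ,
        Pi.zero_apply] at this
      rw [Finset.sum_congr rfl (g := fun d => h F * (h (M.face d) - h (M.face (M.rev d)))),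
        ← Finset.mul_sum, this, mul_zero]
      intro d hd
      rw [(Finset.mem_filter.mp hd).2]
    have h1' := (M.sum_rev fun d => h (M.face d) * (h (M.face d) - h (M.face (M.rev d)))).trans h1
    have h3 : ∑ d, (h (M.face d) - h (M.face (M.rev d))) ^ 2 = 0 := by
      rw [← add_zero (0 : ℝ)]
      nth_rewrite 1 [← h1]
      rw [← h1', ← Finset.sum_add_distrib]
      refine Finset.sum_congr rfl fun d _ => ?_
      rw [M.rev_rev]; ring
    rw [Finset.sum_eq_zero_iff_of_nonneg fun _ _ => sq_nonneg _] at h3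
    intro v w
    obtain ⟨a, rfl⟩ := Quotient.exists_rep v
    obtain ⟨b, rfl⟩ := Quotient.exists_rep w
    refine M.forall_eq_of_next_rev (fun d => h (M.face d)) (fun d => by
      simp only [M.face_next]) (fun d => ?_) b a
    have := h3 d (Finset.mem_univ _)
    simp only [pow_eq_zero_iff two_ne_zero] at this
    linarith
  have r1' : Module.finrank ℝ (LinearMap.range (d₁.comp δ)) ≤
      Module.finrank ℝ (LinearMap.range e₁) := by
    apply Submodule.finrank_mono
    rintro _ ⟨h, rfl⟩
    refine ⟨⟨δ h, fun d => ?_⟩, rfl⟩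
    rw [hδ, hδ, M.rev_rev]; ring
  have r2 := LinearMap.finrank_range_add_finrank_ker e₁
  have r3 := M.two_mul_finrank_antisym_le
  let K := (LinearMap.ker e₁).map M.antisym.subtype
  have rK : Module.finrank ℝ K = Module.finrank ℝ (LinearMap.ker e₁) :=
    (Submodule.equivMapOfInjective _ M.antisym.injective_subtype _).finrank_eq.symm
  have hle : LinearMap.range d₀ ≤ K := by
    rintro _ ⟨f, rfl⟩
    refine ⟨⟨d₀ f, fun d => by rw [hd₀, hd₀, M.rev_rev]; ring⟩, ?_, rfl⟩
    ext F
    simp only [e₁, LinearMap.comp_apply, d₁, LinearMap.coe_mk, AddHom.coe_mk, hd₀,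
        Pi.zero_apply, Submodule.subtype_apply, ← M.org_next]
    rw [Finset.sum_sub_distrib, sub_eq_zero]
    refine Finset.sum_bij (fun d _ => M.next d) ?_ ?_ ?_ ?_
    · intro d hd; simpa [M.face_next] using hd
    · intro a _ b _ h; exact M.next.injective h
    · intro d hd
      refine ⟨M.next.symm d, ?_, by simp⟩
      have := M.face_next (M.next.symm d)
      rw [Equiv.apply_symm_apply] at this
      simpa [← this] using hd
    · intros; rfl
  have heul := M.euler
  rw [Nat.card_eq_fintype_card] at heul
  -- The closed cochains have dimension at most #D/2 - (#F - 1), which is #V - 1 by Euler's formula,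
  -- and the exact ones at least #V - 1.
  have hfin : Module.finrank ℝ K ≤ Module.finrank ℝ (LinearMap.range d₀) := by
    change 2 * (Fintype.card V + Fintype.card M.Face) = _ at heul
    omega
  have hmem : y ∈ K := ⟨⟨y, hy⟩, by ext F; exact hc F, rfl⟩
  rw [← Submodule.eq_of_le_of_finrank_le hle hfin] at hmem
  obtain ⟨f, hf⟩ := hmem
  exact ⟨f, fun d => by rw [← hf, hd₀]⟩

/-- A one-cochain that is closed in the dual sense has a potential on the two-cells of the annulus,
provided that its period is zero. -/
theorem exists_face_potential (M : AnnulusMap D V) (φ : D → ℝ) (hφ : ∀ d, φ (M.rev d) = - φ d)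
    (h : ∀ f : V → ℝ, (∀ v ∈ M.E₁, ∀ w ∈ M.E₁, f v = f w) → (∀ v ∈ M.E₂, ∀ w ∈ M.E₂, f v = f w) →
      ∑ d, φ d * f (M.org d) = 0) :
    ∃ h : D → ℝ, (∀ d, h (M.next d) = h d) ∧
      ∀ d, M.Inner d → M.Inner (M.rev d) → h (M.rev d) - h d = φ d := by
  classical
  -- Nothing is required across edges that border a removed face, so the second component is free
  -- there. Vectors orthogonal to the range consequently vanish on the darts of these edges.
  let L : (M.Face → ℝ) × (D → ℝ) →ₗ[ℝ] (D → ℝ) :=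
    { toFun := fun p d => p.1 (M.face (M.rev d)) - p.1 (M.face d) +
        if M.Inner d ∧ M.Inner (M.rev d) then 0 else p.2 d
      map_add' := fun a b => by
        ext d
        simp only [Prod.fst_add, Prod.snd_add, Pi.add_apply]
        split_ifs <;> ring
      map_smul' := fun r a => by
        ext d
        simp only [Prod.smul_fst, Prod.smul_snd, Pi.smul_apply, smul_eq_mul, RingHom.id_apply]
        split_ifs <;> ring }
  have hL : φ ∈ LinearMap.range L := by
    apply LinearMap.mem_range_of_forall_dual
    intro y hy
    have hb : ∀ d, ¬ (M.Inner d ∧ M.Inner (M.rev d)) → y d = 0 := by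
      intro d hd
      have := hy (0, Pi.single d 1)
      rw [Finset.sum_eq_single d] at this
      · simpa [L, hd] using this
      · intro b _ hbd
        simp [L, hbd]
      · simp
    -- Orthogonality to the face functions says that the antisymmetrization of `y` is closed. Its
    -- potential `f` is constant along the two removed faces, where `y` vanishes, and so it is an
    -- admissible test function in `h`.
    obtain ⟨f, hf⟩ := M.exists_potential_of_closed (fun d => y d - y (M.rev d))
      (fun d => by simp only [M.rev_rev]; ring) (fun F => by
        have := hy (Pi.single F 1, 0)
        simp only [L, LinearMap.coe_mk, AddHom.coe_mk, Pi.zero_apply, ite_self, add_zero,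
          mul_sub, Finset.sum_sub_distrib] at this
        rw [Finset.sum_sub_distrib, Finset.sum_filter, Finset.sum_filter]
        simp only [Pi.single_apply, mul_ite, mul_one, mul_zero] at this
        rw [← M.sum_rev fun d => if M.face d = F then y (M.rev d) else 0]
        simp only [M.rev_rev]
        linarith)
    have hE : ∀ d, ¬ M.Inner d → f (M.org (M.next d)) = f (M.org d) := by
      intro d hd
      have h1 := hf d
      rw [hb d (by tauto), hb (M.rev d) (by rw [M.rev_rev]; tauto)] at h1
      rw [M.org_next]
      linarith
    have hE' : ∀ d₀ d, M.next.SameCycle d₀ d → (∀ d, M.next.SameCycle d₀ d → ¬ M.Inner d) →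
        f (M.org d) = f (M.org d₀) := by
      intro d₀ d hd hI
      by_contra hne
      obtain ⟨z, hz, hz1, hz2⟩ := hd.exists_exit (fun d => f (M.org d) = f (M.org d₀)) rfl hne
      exact hz2 ((hE z (hI z hz)).trans hz1)
    have key := h f (by
      rintro _ ⟨d, hd, rfl⟩ _ ⟨d', hd', rfl⟩
      rw [hE' _ d hd fun x hx => fun hi => hi.1 hx, hE' _ d' hd' fun x hx => fun hi => hi.1 hx])
      (by
      rintro _ ⟨d, hd, rfl⟩ _ ⟨d', hd', rfl⟩
      rw [hE' _ d hd fun x hx => fun hi => hi.2 hx, hE' _ d' hd' fun x hx => fun hi => hi.2 hx])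
    have e1 : ∑ d, φ d * f (M.org (M.rev d)) = 0 := by
      rw [← M.sum_rev]
      simp only [M.rev_rev, hφ, neg_mul, Finset.sum_neg_distrib, key, neg_zero]
    have e2 : ∑ d, y (M.rev d) * φ d = - ∑ d, y d * φ d := by
      rw [← M.sum_rev]
      simp [M.rev_rev, hφ]
    have e3 : ∑ d, (y d - y (M.rev d)) * φ d = 0 := by
      rw [Finset.sum_congr rfl (g := fun d => φ d * f (M.org (M.rev d)) - φ d * f (M.org d)),
        Finset.sum_sub_distrib, e1, key, sub_zero]
      intro d _
      rw [show y d - y (M.rev d) = _ from hf d]; ring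
    simp only [sub_mul, Finset.sum_sub_distrib, e2] at e3
    linarith
  obtain ⟨⟨h, b⟩, hh⟩ := hL
  refine ⟨fun d => h (M.face d), fun d => congrArg h (M.face_next d), fun d h1 h2 => ?_⟩
  rw [← hh]
  simp [L, h1, h2]

end AnnulusMap

/-! ### Darts, cells and the maximum principle -/

namespace AnnulusMap

variable {D V : Type*} [Fintype D] [Fintype V]

/-- The hypotheses on the annulus, the conductances and the Dirichlet solution. -/
structure IsRegular (M : AnnulusMap D V) (c : D → ℝ) (k : ℝ) (g : V → ℝ) : Prop where
  cond : M.IsConductance c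
  k_pos : 0 < k
  dirichlet : M.IsDirichletSolution c k g
  flat : ∀ d, g (M.org d) = g (M.org (M.rev d)) →
    (M.org d ∈ M.E₁ ∧ M.org (M.rev d) ∈ M.E₁) ∨ (M.org d ∈ M.E₂ ∧ M.org (M.rev d) ∈ M.E₂)
  nbr₁ : ∀ v ∈ M.E₁, ∃ d, M.org d = v ∧ M.org (M.rev d) ∉ M.E₁
  nbr₂ : ∀ v ∈ M.E₂, ∃ d, M.org d = v ∧ M.org (M.rev d) ∉ M.E₂

/-- `g` increases along the dart. -/
def Asc (M : AnnulusMap D V) (g : V → ℝ) (d : D) : Prop := g (M.org d) < g (M.org (M.rev d))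

/-- `g` decreases along the dart. -/
def Desc (M : AnnulusMap D V) (g : V → ℝ) (d : D) : Prop := g (M.org (M.rev d)) < g (M.org d)

/-- The flux of `g` along a dart. -/
def flux (M : AnnulusMap D V) (c : D → ℝ) (g : V → ℝ) (d : D) : ℝ :=
  c d * (g (M.org d) - g (M.org (M.rev d)))

section Basic

variable (M : AnnulusMap D V) (g : V → ℝ)

theorem asc_rev (d : D) : M.Asc g (M.rev d) ↔ M.Desc g d := by simp [Asc, Desc, M.rev_rev]

theorem desc_rev (d : D) : M.Desc g (M.rev d) ↔ M.Asc g d := by simp [Asc, Desc, M.rev_rev]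

variable {M g}

theorem Asc.not_desc {d : D} (h : M.Asc g d) : ¬ M.Desc g d := lt_asymm h

theorem Desc.not_asc {d : D} (h : M.Desc g d) : ¬ M.Asc g d := lt_asymm h

variable (M g)

theorem asc_or_desc_or_flat (d : D) :
    M.Asc g d ∨ M.Desc g d ∨ g (M.org d) = g (M.org (M.rev d)) := by
  rcases lt_trichotomy (g (M.org d)) (g (M.org (M.rev d))) with h | h | h
  exacts [Or.inl h, Or.inr (Or.inr h), Or.inr (Or.inl h)]

/-- Rotation about the origin of a dart. -/
def rot : Equiv.Perm D := M.rev * M.next⁻¹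

theorem rot_apply (d : D) : M.rot d = M.rev (M.next.symm d) := rfl

theorem rot_next (d : D) : M.rot (M.next d) = M.rev d := by simp [rot_apply]

theorem org_rot (d : D) : M.org (M.rot d) = M.org d :=
  ((M.org_eq_iff _ _).2 (Equiv.Perm.sameCycle_apply_left.2 (Equiv.Perm.SameCycle.refl _ _)))

theorem org_eq_iff_rot (d d' : D) : M.org d = M.org d' ↔ M.rot.SameCycle d d' := M.org_eq_iff d d'

theorem org_eq_end_symm (d : D) : M.org d = M.org (M.rev (M.next.symm d)) := (M.org_rot d).symm

theorem inner_next {d : D} : M.Inner (M.next d) ↔ M.Inner d := by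
  simp [Inner]

theorem inner_symm {d : D} : M.Inner (M.next.symm d) ↔ M.Inner d := by
  rw [← inner_next, Equiv.apply_symm_apply]

theorem Inner.of_sameCycle {M : AnnulusMap D V} {d d' : D} (h : M.next.SameCycle d d')
    (hd : M.Inner d) : M.Inner d' :=
  ⟨fun h' => hd.1 (h'.trans h.symm), fun h' => hd.2 (h'.trans h.symm)⟩

theorem disjoint_boundary {v : V} (h₁ : v ∈ M.E₁) (h₂ : v ∈ M.E₂) : False := by
  obtain ⟨d, hd, rfl⟩ := h₁
  obtain ⟨d', hd', h⟩ := h₂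
  exact M.boundary_disjoint d d' hd hd' h.symm

theorem mem_boundary_of_not_inner {d : D} (h : ¬ M.Inner d) :
    (M.org d ∈ M.E₁ ∧ M.org (M.rev d) ∈ M.E₁) ∨ (M.org d ∈ M.E₂ ∧ M.org (M.rev d) ∈ M.E₂) := by
  simp only [Inner, not_and_or, not_not] at h
  rw [← M.org_next]
  rcases h with h | h
  · exact Or.inl ⟨⟨d, h, rfl⟩, ⟨M.next d, by simpa using h, rfl⟩⟩
  · exact Or.inr ⟨⟨d, h, rfl⟩, ⟨M.next d, by simpa using h, rfl⟩⟩

theorem eq_of_not_inner {d d' : D} (h : ¬ M.Inner d) (h' : ¬ M.Inner d')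
    (ho : M.org d = M.org d') : d = d' := by
  simp only [Inner, not_and_or, not_not] at h h'
  rcases h with h | h <;> rcases h' with h' | h'
  · exact M.face_simple _ _ (h.symm.trans h') ho
  · exact (M.boundary_disjoint _ _ h h' ho).elim
  · exact (M.boundary_disjoint _ _ h' h ho.symm).elim
  · exact M.face_simple _ _ (h.symm.trans h') ho

theorem exists_not_inner₁ {v : V} (h : v ∈ M.E₁) : ∃ d, ¬ M.Inner d ∧ M.org d = v := by
  obtain ⟨d, hd, rfl⟩ := h
  exact ⟨d, fun h => h.1 hd, rfl⟩

theorem exists_not_inner₂ {v : V} (h : v ∈ M.E₂) : ∃ d, ¬ M.Inner d ∧ M.org d = v := by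
  obtain ⟨d, hd, rfl⟩ := h
  exact ⟨d, fun h => h.2 hd, rfl⟩

/-- The sides of a two-cell. -/
theorem Inner.cycle {M : AnnulusMap D V} {d : D} (h : M.Inner d) :
    (∀ d', M.next.SameCycle d d' → d' = d ∨ d' = M.next d ∨ d' = M.next (M.next d) ∨
      d' = M.next (M.next (M.next d))) ∧
    M.next d ≠ d ∧ M.next (M.next d) ≠ d ∧
    (M.next (M.next (M.next d)) = d ∨
      (M.next (M.next (M.next d)) ≠ d ∧ M.next (M.next (M.next (M.next d))) = d)) := by
  have hper : d ∈ Function.periodicPts M.next :=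
    Function.Injective.mem_periodicPts M.next.injective d
  set m := Function.minimalPeriod M.next d with hm
  have hm0 : 0 < m := Function.minimalPeriod_pos_of_mem_periodicPts hper
  have hcard : Nat.card {d' // M.next.SameCycle d d'} = m := by
    rw [← Nat.card_fin m]
    symm
    apply Nat.card_eq_of_bijective (fun i : Fin m => (⟨M.next^[i] d, i, by
      rw [zpow_natCast, Equiv.Perm.iterate_eq_pow]⟩ : {d' // M.next.SameCycle d d'}))
    constructor
    · intro i j hij
      exact Fin.ext (Function.iterate_injOn_Iio_minimalPeriod i.2 j.2 (congrArg Subtype.val hij))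
    · rintro ⟨d', hd'⟩
      obtain ⟨n, hn⟩ := hd'.exists_nat_pow_eq
      refine ⟨⟨n % m, Nat.mod_lt _ hm0⟩, Subtype.ext ?_⟩
      change M.next^[n % m] d = d'
      rw [hm, Function.iterate_mod_minimalPeriod_eq, ← hn, Equiv.Perm.iterate_eq_pow]
  have hne : ∀ j, 0 < j → j < m → M.next^[j] d ≠ d := fun j hj hjm hp =>
    absurd (Function.IsPeriodicPt.minimalPeriod_le hj hp) (not_le.2 hjm)
  have heq : M.next^[m] d = d := Function.iterate_minimalPeriod
  have h34 := M.face_card d h.1 h.2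
  rw [hcard] at h34
  refine ⟨fun d' hd' => ?_, hne 1 one_pos (by omega), hne 2 two_pos (by omega), ?_⟩
  · obtain ⟨n, hn⟩ := hd'.exists_nat_pow_eq
    rw [← Equiv.Perm.iterate_eq_pow, ← Function.iterate_mod_minimalPeriod_eq, ← hm] at hn
    have hlt := Nat.mod_lt n hm0
    have : n % m < 4 := by omega
    interval_cases n % m
    · exact Or.inl hn.symm
    · exact Or.inr (Or.inl hn.symm)
    · exact Or.inr (Or.inr (Or.inl hn.symm))
    · exact Or.inr (Or.inr (Or.inr hn.symm))
  · rcases h34 with h3 | h4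
    · left
      rw [h3] at heq
      exact heq
    · right
      refine ⟨hne 3 (by norm_num) (by omega), ?_⟩
      rw [h4] at heq
      exact heq

variable (c : D → ℝ)

open Classical in
theorem laplacian_eq (v : V) : M.laplacian c g v = ∑ d with M.org d = v, M.flux c g d := by
  rw [laplacian, Finset.sum_filter]
  refine Finset.sum_congr rfl fun d _ => ?_
  split_ifs with h
  · rw [flux, h]
  · rfl

end Basic

namespace IsRegular

variable {M : AnnulusMap D V} {c : D → ℝ} {k : ℝ} {g : V → ℝ} (R : M.IsRegular c k g)
include R

theorem flux_rev (d : D) : M.flux c g (M.rev d) = - M.flux c g d := by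
  rw [flux, flux, M.rev_rev, R.cond.2]; ring

theorem flux_pos {d : D} (h : M.Desc g d) : 0 < M.flux c g d :=
  mul_pos (R.cond.1 d) (sub_pos.2 h)

theorem flux_neg {d : D} (h : M.Asc g d) : M.flux c g d < 0 :=
  mul_neg_of_pos_of_neg (R.cond.1 d) (sub_neg.2 h)

theorem asc_or_desc {d : D} (h₁ : M.org d ∉ M.E₁) (h₂ : M.org d ∉ M.E₂) :
    M.Asc g d ∨ M.Desc g d := by
  rcases M.asc_or_desc_or_flat g d with h | h | h
  · exact Or.inl h
  · exact Or.inr h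
  · rcases R.flat d h with h | h
    exacts [absurd h.1 h₁, absurd h.1 h₂]

/-- The fluxes out of an interior vertex add up to zero, and none of them vanishes, because edges
with equal values at their ends have both ends on the boundary. So both signs occur. -/
theorem exists_asc_desc {v : V} (h₁ : v ∉ M.E₁) (h₂ : v ∉ M.E₂) :
    (∃ d, M.org d = v ∧ M.Asc g d) ∧ ∃ d, M.org d = v ∧ M.Desc g d := by
  classical
  have hsum := R.dirichlet.harmonic v h₁ h₂
  rw [laplacian_eq] at hsum
  obtain ⟨d₀, rfl⟩ := M.org_surjective v
  have hd₀ : M.flux c g d₀ ≠ 0 := by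
    rcases R.asc_or_desc h₁ h₂ with h | h
    · exact (R.flux_neg h).ne
    · exact (R.flux_pos h).ne'
  constructor
  · obtain ⟨d, hd, hneg⟩ := Finset.exists_pos_of_sum_zero_of_exists_nonzero
      (s := Finset.univ.filter fun d => M.org d = M.org d₀) (fun d => - M.flux c g d)
      (by rw [Finset.sum_neg_distrib, hsum, neg_zero]) ⟨d₀, by simp, by simpa using hd₀⟩
    rw [Finset.mem_filter] at hd
    refine ⟨d, hd.2, ?_⟩
    rcases R.asc_or_desc (hd.2 ▸ h₁) (hd.2 ▸ h₂) with h | h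
    · exact h
    · have := R.flux_pos h
      linarith
  · obtain ⟨d, hd, hneg⟩ := Finset.exists_pos_of_sum_zero_of_exists_nonzero
      (s := Finset.univ.filter fun d => M.org d = M.org d₀) (fun d => M.flux c g d)
      hsum ⟨d₀, by simp, hd₀⟩
    rw [Finset.mem_filter] at hd
    refine ⟨d, hd.2, ?_⟩
    rcases R.asc_or_desc (hd.2 ▸ h₁) (hd.2 ▸ h₂) with h | h
    · have := R.flux_neg h
      linarith
    · exact h

theorem le_k (v : V) : g v ≤ k := by
  have : Nonempty V := ⟨v⟩
  obtain ⟨w, hw⟩ := Finite.exists_max g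
  refine (hw v).trans ?_
  by_cases h₁ : w ∈ M.E₁
  · exact (R.dirichlet.on_E₁ w h₁).le
  by_cases h₂ : w ∈ M.E₂
  · exact (R.dirichlet.on_E₂ w h₂).le.trans R.k_pos.le
  obtain ⟨⟨d, rfl, hd⟩, -⟩ := R.exists_asc_desc h₁ h₂
  exact absurd (hw _) (not_le.2 hd)

theorem nonneg (v : V) : 0 ≤ g v := by
  have : Nonempty V := ⟨v⟩
  obtain ⟨w, hw⟩ := Finite.exists_min g
  refine le_trans ?_ (hw v)
  by_cases h₁ : w ∈ M.E₁
  · exact R.k_pos.le.trans (R.dirichlet.on_E₁ w h₁).ge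
  by_cases h₂ : w ∈ M.E₂
  · exact (R.dirichlet.on_E₂ w h₂).ge
  obtain ⟨-, ⟨d, rfl, hd⟩⟩ := R.exists_asc_desc h₁ h₂
  exact absurd (hw _) (not_le.2 hd)

theorem lt_k {v : V} (h₁ : v ∉ M.E₁) : g v < k := by
  by_cases h₂ : v ∈ M.E₂
  · exact (R.dirichlet.on_E₂ v h₂).trans_lt R.k_pos
  obtain ⟨⟨d, rfl, hd⟩, -⟩ := R.exists_asc_desc h₁ h₂
  exact lt_of_lt_of_le hd (R.le_k _)

theorem pos {v : V} (h₂ : v ∉ M.E₂) : 0 < g v := by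
  by_cases h₁ : v ∈ M.E₁
  · rw [R.dirichlet.on_E₁ v h₁]; exact R.k_pos
  obtain ⟨-, ⟨d, rfl, hd⟩⟩ := R.exists_asc_desc h₁ h₂
  exact lt_of_le_of_lt (R.nonneg _) hd

/-- The strict maximum principle: off the boundary some edge goes further up and another further
down. From here on, the boundary components are recognized by their levels alone. -/
theorem mem_E₁_iff {v : V} : v ∈ M.E₁ ↔ g v = k :=
  ⟨R.dirichlet.on_E₁ v, fun h => by_contra fun h' => (R.lt_k h').ne h⟩

theorem mem_E₂_iff {v : V} : v ∈ M.E₂ ↔ g v = 0 :=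
  ⟨R.dirichlet.on_E₂ v, fun h => by_contra fun h' => (R.pos h').ne' h⟩

theorem flat_of_not_inner {d : D} (h : ¬ M.Inner d) : g (M.org d) = g (M.org (M.rev d)) := by
  rcases M.mem_boundary_of_not_inner h with ⟨h, h'⟩ | ⟨h, h'⟩
  · rw [R.mem_E₁_iff.1 h, R.mem_E₁_iff.1 h']
  · rw [R.mem_E₂_iff.1 h, R.mem_E₂_iff.1 h']

theorem inner_of_desc {d : D} (h : M.Desc g d) : M.Inner d :=
  by_contra fun h' => h.ne' (R.flat_of_not_inner h')

theorem inner_of_asc {d : D} (h : M.Asc g d) : M.Inner d :=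
  by_contra fun h' => h.ne (R.flat_of_not_inner h')

theorem inner_rev_of_desc {d : D} (h : M.Desc g d) : M.Inner (M.rev d) :=
  R.inner_of_asc ((M.asc_rev g d).2 h)

theorem not_asc_of_mem_E₁ {d : D} (h : M.org d ∈ M.E₁) : ¬ M.Asc g d := by
  intro h'
  have := R.le_k (M.org (M.rev d))
  rw [Asc, R.mem_E₁_iff.1 h] at h'
  linarith

theorem not_desc_of_mem_E₂ {d : D} (h : M.org d ∈ M.E₂) : ¬ M.Desc g d := by
  intro h'
  have := R.nonneg (M.org (M.rev d))
  rw [Desc, R.mem_E₂_iff.1 h] at h'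
  linarith

theorem exists_desc_of_mem_E₁ {v : V} (h : v ∈ M.E₁) : ∃ d, M.org d = v ∧ M.Desc g d := by
  obtain ⟨d, rfl, hd⟩ := R.nbr₁ v h
  exact ⟨d, rfl, by rw [Desc, R.mem_E₁_iff.1 h]; exact R.lt_k hd⟩

theorem exists_asc_of_mem_E₂ {v : V} (h : v ∈ M.E₂) : ∃ d, M.org d = v ∧ M.Asc g d := by
  obtain ⟨d, rfl, hd⟩ := R.nbr₂ v h
  exact ⟨d, rfl, by rw [Asc, R.mem_E₂_iff.1 h]; exact R.pos hd⟩

end IsRegular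

/-! ### The index of the corners -/

section Index

open Classical in
/-- The contribution of a corner to the number of sign changes about its vertex. -/
noncomputable def cornerWeight (M : AnnulusMap D V) (g : V → ℝ) (d : D) : ℤ :=
  (if (M.Asc g d ↔ M.Asc g (M.rot d)) then 0 else 1) +
    (if (M.Desc g d ↔ M.Desc g (M.rot d)) then 0 else 1)

open Classical in
/-- The indicator function of the boundary darts. -/
noncomputable def boundaryWeight (M : AnnulusMap D V) (d : D) : ℤ := if M.Inner d then 0 else 1

theorem cornerWeight_nonneg (M : AnnulusMap D V) (g : V → ℝ) (d : D) :
    0 ≤ M.cornerWeight g d := by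
  unfold cornerWeight; split_ifs <;> simp

theorem cornerWeight_le (M : AnnulusMap D V) (g : V → ℝ) (d : D) :
    M.cornerWeight g d ≤ 2 := by
  unfold cornerWeight; split_ifs <;> simp

theorem boundaryWeight_nonneg (M : AnnulusMap D V) (d : D) : 0 ≤ M.boundaryWeight d := by
  unfold boundaryWeight; split_ifs <;> simp

open Classical in
-- At the corner between `d` and `next d`, the two darts seen from the vertex are `rev d` and `next
-- d`. A reversal of direction along the cell is thus no change about the vertex, and vice versa.
-- The two counts add up to 2, except when `g` is constant on both sides: then both are 0.
theorem cornerWeight_next_le (M : AnnulusMap D V) (g : V → ℝ) (d : D) :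
    (if (M.Asc g d ↔ M.Asc g (M.next d)) then 0 else 1) +
    (if (M.Desc g d ↔ M.Desc g (M.next d)) then 0 else 1) ≤ 2 - M.cornerWeight g (M.next d) := by
  unfold cornerWeight
  rw [M.rot_next, asc_rev, desc_rev]
  have h₁ : M.Asc g d → ¬ M.Desc g d := Asc.not_desc
  have h₂ : M.Asc g (M.next d) → ¬ M.Desc g (M.next d) := Asc.not_desc
  by_cases a : M.Asc g d <;> by_cases b : M.Desc g d <;> by_cases a' : M.Asc g (M.next d) <;>
    by_cases b' : M.Desc g (M.next d) <;> simp_all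

namespace IsRegular

variable {M : AnnulusMap D V} {c : D → ℝ} {k : ℝ} {g : V → ℝ} (R : M.IsRegular c k g)
include R

omit R in
open Classical in
theorem boundaryWeight_sum {v : V} (hv : v ∈ M.E₁ ∨ v ∈ M.E₂) :
    1 ≤ ∑ d with M.org d = v, M.boundaryWeight d := by
  obtain ⟨d, hd, rfl⟩ : ∃ d, ¬ M.Inner d ∧ M.org d = v :=
    hv.elim M.exists_not_inner₁ M.exists_not_inner₂
  calc (1 : ℤ) = M.boundaryWeight d := by simp [boundaryWeight, hd]
    _ ≤ _ := Finset.single_le_sum (f := M.boundaryWeight)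
      (fun _ _ => M.boundaryWeight_nonneg _) (by simp)

open Classical in
-- About an interior vertex there are ascending and descending darts, so each of the two indicators
-- changes at least twice. About a boundary vertex only one of them is sure to change; the boundary
-- dart makes up for the missing 2.
theorem vertex_sum_ge (v : V) :
    4 ≤ ∑ d with M.org d = v, (M.cornerWeight g d + 2 * M.boundaryWeight d) := by
  have key : ∀ P : D → Prop, (∃ d, M.org d = v ∧ P d) → (∃ d, M.org d = v ∧ ¬ P d) →
      (2 : ℤ) ≤ ∑ d with M.org d = v, if (P d ↔ P (M.rot d)) then 0 else 1 := by
    rintro P ⟨x, rfl, hPx⟩ ⟨y, hy, hPy⟩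
    exact ((M.org_eq_iff_rot x y).1 hy.symm).two_le_sum P hPx hPy _
      fun z hz => by simp [((M.org_eq_iff_rot x z).2 hz).symm]
  have hb : 0 ≤ ∑ d with M.org d = v, M.boundaryWeight d :=
    Finset.sum_nonneg fun _ _ => M.boundaryWeight_nonneg _
  have hA : (0 : ℤ) ≤ ∑ d with M.org d = v,
      if (M.Asc g d ↔ M.Asc g (M.rot d)) then 0 else 1 :=
    Finset.sum_nonneg fun _ _ => by split_ifs <;> simp
  have hD : (0 : ℤ) ≤ ∑ d with M.org d = v,
      if (M.Desc g d ↔ M.Desc g (M.rot d)) then 0 else 1 :=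
    Finset.sum_nonneg fun _ _ => by split_ifs <;> simp
  simp only [cornerWeight, Finset.sum_add_distrib, ← Finset.mul_sum]
  by_cases h₁ : v ∈ M.E₁
  · have h2 := boundaryWeight_sum (Or.inl h₁)
    obtain ⟨d, hd, hdv⟩ := M.exists_not_inner₁ h₁
    have := key (M.Desc g) (R.exists_desc_of_mem_E₁ h₁)
      ⟨d, hdv, fun h => hd (R.inner_of_desc h)⟩
    linarith
  by_cases h₂ : v ∈ M.E₂
  · have h2 := boundaryWeight_sum (Or.inr h₂)
    obtain ⟨d, hd, hdv⟩ := M.exists_not_inner₂ h₂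
    have := key (M.Asc g) (R.exists_asc_of_mem_E₂ h₂)
      ⟨d, hdv, fun h => hd (R.inner_of_asc h)⟩
    linarith
  obtain ⟨⟨x, hx, hx'⟩, ⟨y, hy, hy'⟩⟩ := R.exists_asc_desc h₁ h₂
  have e1 := key (M.Asc g) ⟨x, hx, hx'⟩ ⟨y, hy, hy'.not_asc⟩
  have e2 := key (M.Desc g) ⟨y, hy, hy'⟩ ⟨x, hx, hx'.not_desc⟩
  linarith

omit R in
theorem exists_desc_of_asc {d : D} (h : M.Asc g d) :
    ∃ z, M.next.SameCycle d z ∧ M.Desc g z := by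
  have hc : M.next.SameCycle (M.next d) d := by simp
  obtain ⟨z, hz, h1, h2⟩ := hc.exists_exit (fun x => g (M.org (M.rev d)) ≤ g (M.org x))
    (by rw [M.org_next]) (not_le.2 h)
  refine ⟨z, by simpa using hz, ?_⟩
  rw [M.org_next] at h2
  exact lt_of_lt_of_le (not_le.1 h2) h1

omit R in
theorem exists_asc_of_desc {d : D} (h : M.Desc g d) :
    ∃ z, M.next.SameCycle d z ∧ M.Asc g z := by
  have hc : M.next.SameCycle (M.next d) d := by simp
  obtain ⟨z, hz, h1, h2⟩ := hc.exists_exit (fun x => g (M.org x) ≤ g (M.org (M.rev d)))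
    (by rw [M.org_next]) (not_le.2 h)
  refine ⟨z, by simpa using hz, ?_⟩
  rw [M.org_next] at h2
  exact lt_of_le_of_lt h1 (not_le.1 h2)

omit R in
open Classical in
theorem sum_face_next (F : M.Face) (f : D → ℤ) :
    ∑ d with M.face d = F, f (M.next d) = ∑ d with M.face d = F, f d := by
  refine Finset.sum_bij (fun d _ => M.next d) ?_ ?_ ?_ ?_
  · intro d hd; simpa [M.face_next] using hd
  · intro a _ b _ h; exact M.next.injective h
  · intro d hd
    refine ⟨M.next.symm d, ?_, by simp⟩
    have := M.face_next (M.next.symm d)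
    rw [Equiv.apply_symm_apply] at this
    simpa [← this] using hd
  · intros; rfl

omit R in
open Classical in
/-- A two-cell with a strictly monotone side has at least four sign changes, and more if `g`
is constant on two consecutive sides. -/
theorem face_sum_ge_aux {d : D} (hd : M.Inner d) (ε : ℤ)
    (hε : ε = 0 ∨ ε = 2 ∧ ∃ z, M.next.SameCycle d z ∧ ¬ M.Asc g z ∧ ¬ M.Desc g z ∧
      ¬ M.Asc g (M.next z) ∧ ¬ M.Desc g (M.next z)) :
    4 + ε ≤ ∑ z with M.face z = M.face d, (2 - M.cornerWeight g z) := by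
  have hmem : ∀ z, M.next.SameCycle d z → z ∈ Finset.univ.filter fun z => M.face z = M.face d :=
    fun z hz => by simpa [M.face_eq_iff] using hz.symm
  rw [← sum_face_next]
  by_cases hflat : ∃ z, M.next.SameCycle d z ∧ (M.Asc g z ∨ M.Desc g z)
  · obtain ⟨x, y, hx, hy, hxa, hyd⟩ : ∃ x y, M.next.SameCycle d x ∧ M.next.SameCycle d y ∧
        M.Asc g x ∧ M.Desc g y := by
      obtain ⟨z, hz, h | h⟩ := hflat
      · obtain ⟨w, hw, h'⟩ := exists_desc_of_asc h
        exact ⟨z, w, hz, hz.trans hw, h, h'⟩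
      · obtain ⟨w, hw, h'⟩ := exists_asc_of_desc h
        exact ⟨w, z, hz.trans hw, hz, h', h⟩
    have e1 := (hx.symm.trans hy).two_le_sum (M.Asc g) hxa hyd.not_asc _
      (fun z hz => hmem z (hx.trans hz))
    have e2 := (hy.symm.trans hx).two_le_sum (M.Desc g) hyd hxa.not_desc _
      (fun z hz => hmem z (hy.trans hz))
    have e3 : ε ≤ ∑ z with M.face z = M.face d, ((2 - M.cornerWeight g (M.next z)) -
        ((if (M.Asc g z ↔ M.Asc g (M.next z)) then 0 else 1) +
        (if (M.Desc g z ↔ M.Desc g (M.next z)) then 0 else 1))) := by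
      have hnn : ∀ z ∈ Finset.univ.filter fun z => M.face z = M.face d,
          0 ≤ (2 - M.cornerWeight g (M.next z)) -
        ((if (M.Asc g z ↔ M.Asc g (M.next z)) then 0 else 1) +
        (if (M.Desc g z ↔ M.Desc g (M.next z)) then 0 else 1)) := fun z _ => by
        have := M.cornerWeight_next_le g z
        linarith
      rcases hε with rfl | ⟨rfl, z, hz, h1, h2, h3, h4⟩
      · exact Finset.sum_nonneg hnn
      · refine le_trans (le_of_eq ?_) (Finset.single_le_sum hnn (hmem z hz))
        simp [cornerWeight, M.rot_next, asc_rev, desc_rev, h1, h2, h3, h4]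
    rw [Finset.sum_sub_distrib, Finset.sum_add_distrib] at e3
    linarith
  · push Not at hflat
    obtain ⟨-, n1, n2, hcyc⟩ := hd.cycle
    have hw : ∀ z, M.next.SameCycle d z → 2 - M.cornerWeight g (M.next z) = 2 := by
      intro z hz
      have f1 := hflat z hz
      have f2 := hflat (M.next z) (by simpa using hz)
      simp [cornerWeight, M.rot_next, asc_rev, desc_rev, f1, f2]
    have n3 : M.next (M.next d) ≠ M.next d := fun h => n1 (M.next.injective h)
    calc 4 + ε ≤ 6 := by rcases hε with rfl | ⟨rfl, -⟩ <;> norm_num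
      _ = ∑ z ∈ {d, M.next d, M.next (M.next d)}, (2 - M.cornerWeight g (M.next z)) := by
        rw [Finset.sum_insert (by simp [n1.symm, n2.symm]), Finset.sum_pair n3.symm,
          hw d (Equiv.Perm.SameCycle.refl _ _), hw _ (by simp), hw _ (by simp)]
        norm_num
      _ ≤ _ := by
        refine Finset.sum_le_sum_of_subset_of_nonneg ?_ fun z _ _ => by
          have := M.cornerWeight_le g (M.next z)
          linarith
        intro z hz
        simp only [Finset.mem_insert, Finset.mem_singleton] at hz
        apply hmem
        rcases hz with rfl | rfl | rfl <;> simp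

open Classical in
theorem cornerWeight_of_not_inner {d : D} (hd : ¬ M.Inner d) : M.cornerWeight g d = 0 := by
  have h2 : ¬ M.Inner (M.next.symm d) := by rwa [M.inner_symm]
  have e1 : ¬ M.Asc g d := fun h => hd (R.inner_of_asc h)
  have e2 : ¬ M.Desc g d := fun h => hd (R.inner_of_desc h)
  have e3 : ¬ M.Asc g (M.rot d) := by
    rw [M.rot_apply, asc_rev]; exact fun h => h2 (R.inner_of_desc h)
  have e4 : ¬ M.Desc g (M.rot d) := by
    rw [M.rot_apply, desc_rev]; exact fun h => h2 (R.inner_of_asc h)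
  simp [cornerWeight, e1, e2, e3, e4]

open Classical in
/-- By Euler's formula, the numbers of sign changes about the vertices and the two-cells are
minimal. -/
theorem index_eq :
    (∀ v, ∑ d with M.org d = v, (M.cornerWeight g d + 2 * M.boundaryWeight d) = 4) ∧
    ∀ d, M.Inner d → ∑ z with M.face z = M.face d, (2 - M.cornerWeight g z) = 4 := by
  -- The corner weights enter the vertex sums and the face sums with opposite signs, so the grand
  -- total is 2 #D. The lower bounds are 4 per vertex, 4 per cell and 0 for the two removed faces;
  -- by Euler's formula they also add up to 2 #D.
  let X : D → ℤ := fun z => 2 - M.cornerWeight g z - 2 * M.boundaryWeight z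
  let Y : M.Face → ℤ := fun F => if F = M.face M.outerDart ∨ F = M.face M.holeDart then 0 else 4
  have hX : ∀ F, Y F ≤ ∑ z with M.face z = F, X z := by
    intro F
    obtain ⟨d, rfl⟩ := Quotient.exists_rep F
    change Y (M.face d) ≤ ∑ z with M.face z = M.face d, X z
    by_cases hd : M.Inner d
    · have : Y (M.face d) = 4 := by
        have h1 : ¬ M.face d = M.face M.outerDart := by
          rw [M.face_eq_iff]; exact fun h => hd.1 h.symm
        have h2 : ¬ M.face d = M.face M.holeDart := by
          rw [M.face_eq_iff]; exact fun h => hd.2 h.symm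
        simp [Y, h1, h2]
      rw [this]
      refine (face_sum_ge_aux (g := g) hd 0 (Or.inl rfl)).trans (Finset.sum_le_sum ?_)
      intro z hz
      have hz' : M.Inner z := Inner.of_sameCycle
        ((M.face_eq_iff z d).1 (Finset.mem_filter.1 hz).2).symm hd
      simp [X, boundaryWeight, hz']
    · have : Y (M.face d) = 0 := by
        simp only [Inner, not_and_or, not_not, ← M.face_eq_iff] at hd
        simp only [Y, ite_eq_left_iff]
        intro h
        rcases hd with hd | hd <;> simp [hd] at h
      rw [this]
      apply Finset.sum_nonneg
      intro z hz
      have hz' : ¬ M.Inner z := fun h => hd (Inner.of_sameCycle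
        ((M.face_eq_iff z d).1 (Finset.mem_filter.1 hz).2) h)
      simp [X, boundaryWeight, hz', R.cornerWeight_of_not_inner hz']
  have hYsum : ∑ F, Y F = 4 * Fintype.card M.Face - 8 := by
    have hne : M.face M.outerDart ≠ M.face M.holeDart := by
      rw [Ne, M.face_eq_iff]
      intro h
      exact M.boundary_disjoint _ _ h (Equiv.Perm.SameCycle.refl _ _) rfl
    have : ∀ F, Y F = 4 - (if F = M.face M.outerDart then 4 else 0) -
        (if F = M.face M.holeDart then 4 else 0) := by
      intro F
      simp only [Y]
      by_cases h1 : F = M.face M.outerDart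
      · subst h1; simp [hne]
      · by_cases h2 : F = M.face M.holeDart <;> simp [h1, h2, hne.symm]
    simp only [this, Finset.sum_sub_distrib]
    simp
    ring
  have htot : ∑ v, ∑ d with M.org d = v, (M.cornerWeight g d + 2 * M.boundaryWeight d) +
      ∑ F, ∑ z with M.face z = F, X z = 2 * Fintype.card D := by
    rw [Finset.sum_fiberwise Finset.univ M.face X, Finset.sum_fiberwise Finset.univ M.org
      fun d => M.cornerWeight g d + 2 * M.boundaryWeight d, ← Finset.sum_add_distrib]
    simp [X, mul_comm]
  have heul : (2 * (Fintype.card V + Fintype.card M.Face) : ℤ) = Fintype.card D + 4 := by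
    have := M.euler
    rw [Nat.card_eq_fintype_card] at this
    exact_mod_cast this
  have h0 : ∑ v, (∑ d with M.org d = v, (M.cornerWeight g d + 2 * M.boundaryWeight d) - 4) +
      ∑ F, (∑ z with M.face z = F, X z - Y F) = 0 := by
    rw [Finset.sum_sub_distrib, Finset.sum_sub_distrib, hYsum]
    simp only [Finset.sum_const, Finset.card_univ, nsmul_eq_mul]
    linarith
  have n1 : ∀ v ∈ Finset.univ, 0 ≤
      ∑ d with M.org d = v, (M.cornerWeight g d + 2 * M.boundaryWeight d) - 4 :=
    fun v _ => by have := R.vertex_sum_ge v; linarith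
  have n2 : ∀ F ∈ Finset.univ, 0 ≤ ∑ z with M.face z = F, X z - Y F :=
    fun F _ => by have := hX F; linarith
  have s1 := Finset.sum_nonneg n1
  have s2 := Finset.sum_nonneg n2
  have z1 := (Finset.sum_eq_zero_iff_of_nonneg n1).1 (by linarith)
  have z2 := (Finset.sum_eq_zero_iff_of_nonneg n2).1 (by linarith)
  refine ⟨fun v => by have := z1 v (Finset.mem_univ _); linarith, fun d hd => ?_⟩
  have := z2 (M.face d) (Finset.mem_univ _)
  have h1 : ¬ M.face d = M.face M.outerDart := by
    rw [M.face_eq_iff]; exact fun h => hd.1 h.symm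
  have h2 : ¬ M.face d = M.face M.holeDart := by
    rw [M.face_eq_iff]; exact fun h => hd.2 h.symm
  simp only [Y, h1, h2, or_self, if_false] at this
  rw [sub_eq_zero] at this
  rw [← this]
  refine Finset.sum_congr rfl fun z hz => ?_
  have hz' : M.Inner z := Inner.of_sameCycle
    ((M.face_eq_iff z d).1 (Finset.mem_filter.1 hz).2).symm hd
  simp [X, boundaryWeight, hz']

/-- `g` is not constant on two consecutive sides of a two-cell. -/
theorem not_flat_flat {d : D} (hd : M.Inner d) (h : g (M.org d) = g (M.org (M.rev d)))
    (h' : g (M.org (M.next d)) = g (M.org (M.rev (M.next d)))) : False := by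
  classical
  have := face_sum_ge_aux (g := g) hd 2 (Or.inr ⟨rfl, d, Equiv.Perm.SameCycle.refl _ _,
    h.not_lt, h.symm.not_lt, h'.not_lt, h'.symm.not_lt⟩)
  rw [R.index_eq.2 d hd] at this
  omega

/-- There is no saddle in a two-cell. -/
theorem eq_of_crossing (P : V → Prop) (hP : (∀ x y, P x → ¬ P y → g y < g x) ∨
    (∀ x y, P x → ¬ P y → g x < g y)) {d d' : D} (hd : M.Inner d) (hc : M.next.SameCycle d d')
    (h₁ : P (M.org d)) (h₂ : ¬ P (M.org (M.rev d)))
    (h₁' : P (M.org d')) (h₂' : ¬ P (M.org (M.rev d'))) : d = d' := by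
  classical
  obtain ⟨hmem, n1, n2, h34⟩ := hd.cycle
  rw [← M.org_next] at h₂ h₂'
  rcases hmem d' hc with rfl | rfl | rfl | rfl
  · rfl
  · exact absurd h₁' h₂
  · rcases h34 with h3 | ⟨h3, h4⟩
    · rw [h3] at h₂'
      exact absurd h₁ h₂'
    exfalso
    -- In a quadrilateral whose corners alternate between `P` and its negation, every corner is a
    -- strict local extremum of `g` on the boundary of the cell and contributes 2. The sum would be
    -- 8 instead of 4.
    have hopp : ∀ z, (P (M.org z) ↔ ¬ P (M.org (M.next z))) →
        (P (M.org (M.next z)) ↔ ¬ P (M.org (M.next (M.next z)))) →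
        2 - M.cornerWeight g (M.next z) = 2 := by
      intro z hz1 hz2
      have : (M.Asc g z ↔ M.Desc g (M.next z)) ∧ (M.Desc g z ↔ M.Asc g (M.next z)) := by
        by_cases hp : P (M.org (M.next z))
        · have a1 : ¬ P (M.org z) := by tauto
          have a2 : ¬ P (M.org (M.next (M.next z))) := by tauto
          rcases hP with hP | hP
          · have b1 := hP _ _ hp a1
            have b2 := hP _ _ hp a2
            simp only [Asc, Desc, ← M.org_next]
            exact ⟨⟨fun _ => b2, fun _ => b1⟩,
              ⟨fun h => absurd b1 h.not_gt, fun h => absurd b2 h.not_gt⟩⟩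
          · have b1 := hP _ _ hp a1
            have b2 := hP _ _ hp a2
            simp only [Asc, Desc, ← M.org_next]
            exact ⟨⟨fun h => absurd b1 h.not_gt, fun h => absurd b2 h.not_gt⟩,
              ⟨fun _ => b2, fun _ => b1⟩⟩
        · have a1 : P (M.org z) := by tauto
          have a2 : P (M.org (M.next (M.next z))) := by tauto
          rcases hP with hP | hP
          · have b1 := hP _ _ a1 hp
            have b2 := hP _ _ a2 hp
            simp only [Asc, Desc, ← M.org_next]
            exact ⟨⟨fun h => absurd b1 h.not_gt, fun h => absurd b2 h.not_gt⟩,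
              ⟨fun _ => b2, fun _ => b1⟩⟩
          · have b1 := hP _ _ a1 hp
            have b2 := hP _ _ a2 hp
            simp only [Asc, Desc, ← M.org_next]
            exact ⟨⟨fun _ => b2, fun _ => b1⟩,
              ⟨fun h => absurd b1 h.not_gt, fun h => absurd b2 h.not_gt⟩⟩
      simp [cornerWeight, M.rot_next, asc_rev, desc_rev, this]
    have hsum := R.index_eq.2 d hd
    rw [← sum_face_next] at hsum
    have n3 : M.next (M.next d) ≠ M.next d := fun h => n1 (M.next.injective h)
    have n4 : M.next (M.next (M.next d)) ≠ M.next d := fun h => n2 (M.next.injective h)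
    have n5 : M.next (M.next (M.next d)) ≠ M.next (M.next d) :=
      fun h => n1 (M.next.injective (M.next.injective h))
    have : (8 : ℤ) ≤ ∑ z with M.face z = M.face d, (2 - M.cornerWeight g (M.next z)) := by
      calc (8 : ℤ) = ∑ z ∈ {d, M.next d, M.next (M.next d), M.next (M.next (M.next d))},
            (2 - M.cornerWeight g (M.next z)) := by
            rw [Finset.sum_insert (by simp [n1.symm, n2.symm, h3.symm]),
              Finset.sum_insert (by simp [n3.symm, n4.symm]), Finset.sum_pair n5.symm,
              hopp d (by tauto) (by tauto), hopp _ (by tauto) (by tauto),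
              hopp (M.next (M.next d)) (by tauto) (by rw [h4]; tauto),
              hopp (M.next (M.next (M.next d))) (by rw [h4]; tauto) (by rw [h4]; tauto)]
            norm_num
        _ ≤ _ := by
          refine Finset.sum_le_sum_of_subset_of_nonneg ?_ fun z _ _ => by
            have := M.cornerWeight_le g (M.next z)
            linarith
          intro z hz
          simp only [Finset.mem_insert, Finset.mem_singleton] at hz
          simp only [Finset.mem_filter, Finset.mem_univ, true_and, M.face_eq_iff]
          rcases hz with rfl | rfl | rfl | rfl <;> simp
    omega
  · rcases h34 with h3 | ⟨h3, h4⟩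
    · exact h3.symm
    · rw [h4] at h₂'
      exact absurd h₁ h₂'

end IsRegular

/-- The corner `d` lies on an ascending part of the boundary of its two-cell. -/
def Pos (M : AnnulusMap D V) (g : V → ℝ) (d : D) : Prop :=
  (M.Asc g (M.next.symm d) ∧ ¬ M.Desc g d) ∨ (¬ M.Desc g (M.next.symm d) ∧ M.Asc g d)

namespace IsRegular

variable {M : AnnulusMap D V} {c : D → ℝ} {k : ℝ} {g : V → ℝ} (R : M.IsRegular c k g)
include R

/-- At every vertex there is at most one corner on an ascending part of a two-cell. -/
theorem pos_unique {d d' : D} (ho : M.org d = M.org d') (h : M.Pos g d) (h' : M.Pos g d') :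
    d = d' := by
  classical
  by_contra hne
  set v := M.org d with hv
  have hpos : ∀ x, M.Pos g x ↔ (M.Desc g (M.rot x) ∧ ¬ M.Desc g x) ∨
      (¬ M.Asc g (M.rot x) ∧ M.Asc g x) := by
    intro x
    rw [Pos, M.rot_apply, asc_rev, desc_rev]
  have hsum := R.index_eq.1 v
  rw [Finset.sum_add_distrib, ← Finset.mul_sum] at hsum
  have hb : 0 ≤ ∑ x with M.org x = v, M.boundaryWeight x :=
    Finset.sum_nonneg fun _ _ => M.boundaryWeight_nonneg _
  have key : ∀ (P : D → Prop) (n : ℤ), (∀ x, M.org x = v → ¬ (P x ↔ P (M.rot x)) →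
      n ≤ M.cornerWeight g x) → (∀ x, M.org x = v → M.Pos g x → P x ∧ ¬ P (M.rot x)) →
      3 * n ≤ ∑ x with M.org x = v, M.cornerWeight g x := by
    intro P n hn hP
    have hPd := hP d hv.symm h
    have hPd' := hP d' ho.symm h'
    have hcyc : M.rot.SameCycle (M.rot d) d := by simp
    obtain ⟨z, hz, hPz, hPz'⟩ := hcyc.exists_exit (fun x => ¬ P x) hPd.2 (by simpa using hPd.1)
    have hzv : M.org z = v := by
      rw [← (M.org_eq_iff_rot _ _).2 hz, M.org_rot]
    have z1 : d ≠ z := by rintro rfl; exact hPz hPd.1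
    have z2 : d' ≠ z := by rintro rfl; exact hPz hPd'.1
    calc 3 * n = n + (n + n) := by ring
      _ ≤ M.cornerWeight g d + (M.cornerWeight g d' + M.cornerWeight g z) := by
        have := hn d hv.symm (by tauto)
        have := hn d' ho.symm (by tauto)
        have := hn z hzv (by tauto)
        omega
      _ = ∑ x ∈ {d, d', z}, M.cornerWeight g x := by
        rw [Finset.sum_insert (by simp [hne, z1]), Finset.sum_pair z2]
      _ ≤ _ := by
        refine Finset.sum_le_sum_of_subset_of_nonneg ?_ fun z _ _ => M.cornerWeight_nonneg g z
        intro x hx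
        simp only [Finset.mem_insert, Finset.mem_singleton] at hx
        simp only [Finset.mem_filter, Finset.mem_univ, true_and]
        rcases hx with rfl | rfl | rfl
        exacts [hv.symm, ho.symm, hzv]
  by_cases h₁ : v ∈ M.E₁
  · have hbs := boundaryWeight_sum (Or.inl h₁)
    have := key (fun x => ¬ M.Desc g x) 1 (fun x hx hx' => by
        unfold cornerWeight
        rw [if_neg (c := M.Desc g x ↔ _) (by tauto)]
        split_ifs <;> simp)
      (fun x hx hx' => by
        have := R.not_asc_of_mem_E₁ (d := x) (hx ▸ h₁)
        rw [hpos] at hx'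
        tauto)
    omega
  by_cases h₂ : v ∈ M.E₂
  · have hbs := boundaryWeight_sum (Or.inr h₂)
    have := key (M.Asc g) 1 (fun x hx hx' => by
        unfold cornerWeight
        rw [if_neg (c := M.Asc g x ↔ _) (by tauto)]
        split_ifs <;> simp)
      (fun x hx hx' => by
        have := R.not_desc_of_mem_E₂ (d := x) (hx ▸ h₂)
        have := R.not_desc_of_mem_E₂ (d := M.rot x) (by rw [M.org_rot]; exact hx ▸ h₂)
        rw [hpos] at hx'
        tauto)
    omega
  have hor : ∀ x, M.org x = v → (M.Desc g x ↔ ¬ M.Asc g x) := by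
    intro x hx
    constructor
    · exact Desc.not_asc
    · intro hx'
      exact (R.asc_or_desc (hx ▸ h₁) (hx ▸ h₂)).resolve_left hx'
  have := key (M.Asc g) 2 (fun x hx hx' => by
      unfold cornerWeight
      rw [hor x hx, hor (M.rot x) (by rw [M.org_rot, hx]), if_neg (by tauto), if_neg (by tauto)]
      norm_num)
    (fun x hx hx' => by
      rw [hpos, hor x hx, hor (M.rot x) (by rw [M.org_rot, hx])] at hx'
      tauto)
  omega

/-- With removed faces on both sides, such a dart would be fixed by the rotation and be the only
dart at its origin. But every boundary vertex has a neighbour off its component, and the dart to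
this neighbour is inner. -/
theorem inner_rev_of_not_inner {d : D} (hd : ¬ M.Inner d) : M.Inner (M.rev d) := by
  by_contra hr
  have h1 : M.rev d = M.next d := M.eq_of_not_inner hr (by rwa [M.inner_next]) (M.org_next d).symm
  have h2 : M.next (M.rev d) = d := M.eq_of_not_inner (by rwa [M.inner_next]) hd
    (by rw [M.org_next, M.rev_rev])
  have hrot : M.rot d = d := by
    rw [M.rot_apply]
    nth_rewrite 1 [← h2]
    rw [Equiv.symm_apply_apply, M.rev_rev]
  obtain ⟨x, hx, hxd⟩ : ∃ x, M.org x = M.org d ∧ M.Inner x := by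
    rcases M.mem_boundary_of_not_inner hd with ⟨h, -⟩ | ⟨h, -⟩
    · obtain ⟨x, hx, hx'⟩ := R.exists_desc_of_mem_E₁ h
      exact ⟨x, hx, R.inner_of_desc hx'⟩
    · obtain ⟨x, hx, hx'⟩ := R.exists_asc_of_mem_E₂ h
      exact ⟨x, hx, R.inner_of_asc hx'⟩
  obtain ⟨z, -, hz, hz'⟩ := ((M.org_eq_iff_rot d x).1 hx.symm).exists_exit (fun x => x = d) rfl
    (by rintro rfl; exact hd hxd)
  subst hz
  exact hz' hrot

/-- The sides of the two-cells on which `g` is constant are in the boundary of the annulus. -/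
theorem not_inner_rev_of_flat {d : D} (hd : M.Inner d)
    (h : g (M.org d) = g (M.org (M.rev d))) : ¬ M.Inner (M.rev d) := by
  have hnext : ∀ x, M.Inner x → g (M.org x) = g (M.org (M.rev x)) →
      (M.Asc g (M.next x) ∨ M.Desc g (M.next x)) ∧
      (M.Asc g (M.next.symm x) ∨ M.Desc g (M.next.symm x)) := by
    intro x hx hxf
    constructor
    · rcases M.asc_or_desc_or_flat g (M.next x) with h | h | h
      exacts [Or.inl h, Or.inr h, (R.not_flat_flat hx hxf h).elim]
    · rcases M.asc_or_desc_or_flat g (M.next.symm x) with h | h | h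
      exacts [Or.inl h, Or.inr h, (R.not_flat_flat (M.inner_symm.2 hx) h (by simpa using hxf)).elim]
  rcases R.flat d h with ⟨h₁, -⟩ | ⟨-, h₂⟩
  -- An inner dart from a vertex of E₁ along which `g` is constant sits at a `Pos` corner, since the
  -- preceding side ascends. The reverse of the boundary dart ending at the vertex is already of
  -- this kind, so `pos_unique` identifies `d` with it. On E₂ the argument uses the corner at the
  -- end of the dart.
  · have hp : ∀ x, M.Inner x → g (M.org x) = g (M.org (M.rev x)) → M.org x ∈ M.E₁ →
        M.Pos g x := by
      intro x hx hxf hx₁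
      have := R.not_asc_of_mem_E₁ (d := M.rot x) (by rwa [M.org_rot])
      rw [M.rot_apply, asc_rev] at this
      exact Or.inl ⟨(hnext x hx hxf).2.resolve_right this, hxf.symm.not_lt⟩
    obtain ⟨o, ho, hov⟩ := M.exists_not_inner₁ h₁
    have ho' : ¬ M.Inner (M.next.symm o) := by rwa [M.inner_symm]
    have hx := R.inner_rev_of_not_inner ho'
    have e := R.pos_unique (d := d) (d' := M.rev (M.next.symm o))
      (by rw [← M.org_eq_end_symm, hov]) (hp d hd h h₁)
      (hp _ hx (by rw [M.rev_rev]; exact (R.flat_of_not_inner ho').symm)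
        (by rwa [← M.org_eq_end_symm, hov]))
    rwa [e, M.rev_rev]
  · have hp : ∀ x, M.Inner x → g (M.org x) = g (M.org (M.rev x)) → M.org (M.rev x) ∈ M.E₂ →
        M.Pos g (M.next x) := by
      intro x hx hxf hx₁
      have := R.not_desc_of_mem_E₂ (d := M.next x) (by rwa [M.org_next])
      exact Or.inr ⟨by simpa [Desc] using hxf.le,
        (hnext x hx hxf).1.resolve_right this⟩
    obtain ⟨o, ho, hov⟩ := M.exists_not_inner₂ h₂
    have hx := R.inner_rev_of_not_inner ho
    have e := R.pos_unique (d := M.next d) (d' := M.next (M.rev o))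
      (by rw [M.org_next, M.org_next, M.rev_rev, hov]) (hp d hd h h₂)
      (hp _ hx (by rw [M.rev_rev]; exact (R.flat_of_not_inner ho).symm)
        (by rwa [M.rev_rev, hov]))
    rwa [M.next.injective e, M.rev_rev]

end IsRegular

end Index

end AnnulusMap

/-! ### Superlevel sets, the slit and the harmonic conjugate on the cells -/

namespace AnnulusMap

variable {D V : Type*} [Fintype D] [Fintype V]

/-- A superlevel set of `g` that separates the boundary components, with boundary at level `a`. -/
structure IsCut (M : AnnulusMap D V) (g : V → ℝ) (U : V → Prop) (a : ℝ) : Prop where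
  le : ∀ v, U v → a ≤ g v
  ge : ∀ v, ¬ U v → g v ≤ a
  lt : ∀ v w, U v → ¬ U w → g w < g v
  on_E₁ : ∀ v ∈ M.E₁, U v
  on_E₂ : ∀ v ∈ M.E₂, ¬ U v

/-- The dart `d` leaves `U`. -/
def Exits (M : AnnulusMap D V) (U : V → Prop) (d : D) : Prop :=
  U (M.org d) ∧ ¬ U (M.org (M.rev d))

open Classical in
/-- The signed number of times a dart runs along the slit. -/
noncomputable def jump (M : AnnulusMap D V) (S : Set D) (d : D) : ℝ :=
  (if d ∈ S then 1 else 0) - (if M.rev d ∈ S then 1 else 0)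

open Classical in
/-- The total flux of `g`. -/
noncomputable def totalFlux (M : AnnulusMap D V) (c : D → ℝ) (g : V → ℝ) : ℝ :=
  ∑ d, if M.org d ∈ M.E₁ then M.flux c g d else 0

theorem Exits.desc {M : AnnulusMap D V} {g : V → ℝ} {U : V → Prop} {a : ℝ} (hU : M.IsCut g U a)
    {d : D} (h : M.Exits U d) : M.Desc g d := hU.lt _ _ h.1 h.2

namespace IsSlit

variable {M : AnnulusMap D V} {g : V → ℝ} {n : ℕ} {s : Fin (n + 1) → D} (hs : M.IsSlit g s)
include hs

theorem desc {d : D} (hd : d ∈ Set.range s) : M.Desc g d := by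
  obtain ⟨i, rfl⟩ := hd
  exact hs.decreasing i

theorem strictAnti : StrictAnti fun i => g (M.org (s i)) := by
  rw [Fin.strictAnti_iff_succ_lt]
  intro i
  have := hs.decreasing i.castSucc
  rwa [hs.path i] at this

theorem injective : Function.Injective s := fun _ _ h =>
  hs.strictAnti.injective (congrArg (fun d => g (M.org d)) h)

theorem le_of_lt {i j : Fin (n + 1)} (h : i < j) :
    g (M.org (s j)) ≤ g (M.org (M.rev (s i))) := by
  obtain ⟨i, rfl⟩ : ∃ i' : Fin n, i = i'.castSucc :=
    ⟨i.castPred (Fin.ne_last_of_lt h), by simp⟩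
  rw [hs.path i]
  exact hs.strictAnti.antitone (Fin.castSucc_lt_iff_succ_le.1 h)

theorem exists_exits {U : V → Prop} {a : ℝ} (hU : M.IsCut g U a) :
    ∃ d ∈ Set.range s, M.Exits U d := by
  by_contra! hcon
  have h' : ∀ i, U (M.org (s i)) → U (M.org (M.rev (s i))) := fun i hi =>
    by_contra fun h => hcon _ ⟨i, rfl⟩ ⟨hi, h⟩
  have key : ∀ i, U (M.org (s i)) := by
    intro i
    induction i using Fin.induction with
    | zero => exact hU.on_E₁ _ hs.start
    | succ i ih => rw [← hs.path i]; exact h' _ ih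
  exact hU.on_E₂ _ hs.finish (h' _ (key _))

theorem exits_unique {U : V → Prop} {a : ℝ} (hU : M.IsCut g U a) {d d' : D}
    (hd : d ∈ Set.range s) (hd' : d' ∈ Set.range s) (h : M.Exits U d) (h' : M.Exits U d') :
    d = d' := by
  obtain ⟨i, rfl⟩ := hd
  obtain ⟨j, rfl⟩ := hd'
  rcases lt_trichotomy i j with hij | rfl | hij
  · exact absurd (hU.lt _ _ h'.1 h.2) (not_lt.2 (hs.le_of_lt hij))
  · rfl
  · exact absurd (hU.lt _ _ h.1 h'.2) (not_lt.2 (hs.le_of_lt hij))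

theorem rev_notMem {d : D} (hd : d ∈ Set.range s) : M.rev d ∉ Set.range s := fun h =>
  ((M.desc_rev g d).1 (hs.desc h)).not_desc (hs.desc hd)

/-- The slit carries a unit flow from its first vertex to its last one, and the sum telescopes. -/
theorem sum_jump (f : V → ℝ) :
    ∑ d, M.jump (Set.range s) d * f (M.org d) =
      f (M.org (s 0)) - f (M.org (M.rev (s (Fin.last n)))) := by
  classical
  have h1 : ∑ d, (if M.rev d ∈ Set.range s then (1 : ℝ) else 0) * f (M.org d) =
      ∑ d, (if d ∈ Set.range s then (1 : ℝ) else 0) * f (M.org (M.rev d)) := by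
    rw [← M.sum_rev]
    simp only [M.rev_rev]
  have h2 : ∀ F : D → ℝ, ∑ d, (if d ∈ Set.range s then (1 : ℝ) else 0) * F d = ∑ i, F (s i) := by
    intro F
    simp only [ite_mul, one_mul, zero_mul]
    rw [← Finset.sum_filter, ← Finset.sum_image (f := F) (g := s) (s := Finset.univ)
      fun i _ j _ h => hs.injective h]
    refine Finset.sum_congr ?_ fun _ _ => rfl
    ext d
    simp
  simp only [jump, sub_mul, Finset.sum_sub_distrib]
  have e1 := h2 fun d => f (M.org d)
  have e2 := h2 fun d => f (M.org (M.rev d))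
  rw [Fin.sum_univ_succ] at e1
  rw [Fin.sum_univ_castSucc] at e2
  simp only [hs.path] at e2
  refine Eq.trans (b := (∑ d, (if d ∈ Set.range s then (1 : ℝ) else 0) * f (M.org d)) -
    ∑ d, (if M.rev d ∈ Set.range s then (1 : ℝ) else 0) * f (M.org d)) ?_ ?_
  · congr!
  · rw [h1, e1, e2]
    ring

end IsSlit

namespace IsRegular

variable {M : AnnulusMap D V} {c : D → ℝ} {k : ℝ} {g : V → ℝ} (R : M.IsRegular c k g)
include R

theorem isCut_ge {a : ℝ} (h0 : 0 < a) (hk : a ≤ k) : M.IsCut g (fun v => a ≤ g v) a where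
  le _ h := h
  ge _ h := (not_le.1 h).le
  lt _ _ h h' := (not_le.1 h').trans_le h
  on_E₁ v hv := by rwa [R.mem_E₁_iff.1 hv]
  on_E₂ v hv := by rwa [R.mem_E₂_iff.1 hv, not_le]

theorem isCut_gt {a : ℝ} (h0 : 0 ≤ a) (hk : a < k) : M.IsCut g (fun v => a < g v) a where
  le _ h := h.le
  ge _ h := not_lt.1 h
  lt _ _ h h' := (not_lt.1 h').trans_lt h
  on_E₁ v hv := by rwa [R.mem_E₁_iff.1 hv]
  on_E₂ v hv := by rwa [R.mem_E₂_iff.1 hv, not_lt]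

/-- A second exit from the superlevel set would make the cell a saddle. Together with
`enters_unique` this says that the cut passes through a cell at most once. -/
theorem exits_unique {U : V → Prop} {a : ℝ} (hU : M.IsCut g U a) {d d' : D} (hd : M.Exits U d)
    (hd' : M.Exits U d') (hc : M.next.SameCycle d d') : d = d' :=
  R.eq_of_crossing U (Or.inl hU.lt) (R.inner_of_desc (hd.desc hU)) hc hd.1 hd.2 hd'.1 hd'.2

theorem enters_unique {U : V → Prop} {a : ℝ} (hU : M.IsCut g U a) {d d' : D}
    (hd : M.Exits U (M.rev d)) (hd' : M.Exits U (M.rev d')) (hc : M.next.SameCycle d d') :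
    d = d' := by
  have hd₁ := hd.2
  have hd₂ := hd'.2
  rw [M.rev_rev] at hd₁ hd₂
  exact R.eq_of_crossing (fun v => ¬ U v) (Or.inr fun x y hx hy => hU.lt _ _ (not_not.1 hy) hx)
    (R.inner_of_asc ((M.desc_rev g d).1 (hd.desc hU))) hc hd₁ (not_not.2 hd.1) hd₂
    (not_not.2 hd'.1)

omit R in
/-- A face that meets `U` and its complement has sides that leave and that enter `U`. -/
theorem exists_exits {U : V → Prop} {x y : D} (hc : M.next.SameCycle x y) (hx : U (M.org x))
    (hy : ¬ U (M.org y)) :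
    (∃ d, M.next.SameCycle x d ∧ M.Exits U d) ∧
      ∃ d, M.next.SameCycle x d ∧ M.Exits U (M.rev d) := by
  constructor
  · obtain ⟨z, hz, h1, h2⟩ := hc.exists_exit (fun z => U (M.org z)) hx hy
    exact ⟨z, hz, h1, by rwa [← M.org_next]⟩
  · obtain ⟨z, hz, h1, h2⟩ := hc.symm.exists_exit (fun z => ¬ U (M.org z)) hy (not_not.2 hx)
    exact ⟨z, hc.trans hz, by rw [← M.org_next]; exact not_not.1 h2, by rwa [M.rev_rev]⟩

omit R in
theorem flux_eq_zero {d : D} (h : g (M.org d) = g (M.org (M.rev d))) : M.flux c g d = 0 := by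
  rw [flux, h, sub_self, mul_zero]

theorem flux_nonneg_of_mem_E₁ {d : D} (h : M.org d ∈ M.E₁) : 0 ≤ M.flux c g d := by
  rcases M.asc_or_desc_or_flat g d with h' | h' | h'
  · exact absurd h' (R.not_asc_of_mem_E₁ h)
  · exact (R.flux_pos h').le
  · exact (flux_eq_zero h').ge

theorem flux_nonpos_of_mem_E₂ {d : D} (h : M.org d ∈ M.E₂) : M.flux c g d ≤ 0 := by
  rcases M.asc_or_desc_or_flat g d with h' | h' | h'
  · exact (R.flux_neg h').le
  · exact absurd h' (R.not_desc_of_mem_E₂ h)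
  · exact (flux_eq_zero h').le

theorem totalFlux_pos : 0 < M.totalFlux c g := by
  classical
  have h₁ : M.org M.outerDart ∈ M.E₁ := ⟨_, M.next.sameCycle_self _, rfl⟩
  obtain ⟨d, hd, hd'⟩ := R.exists_desc_of_mem_E₁ h₁
  refine Finset.sum_pos' (fun d _ => ?_) ⟨d, Finset.mem_univ _, ?_⟩
  · split_ifs with h
    · exact R.flux_nonneg_of_mem_E₁ h
    · exact le_rfl
  · rw [if_pos (hd ▸ h₁)]
    exact R.flux_pos hd'

theorem laplacian_pos {v : V} (h : v ∈ M.E₁) : 0 < M.laplacian c g v := by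
  classical
  rw [laplacian_eq]
  obtain ⟨d, hd, hd'⟩ := R.exists_desc_of_mem_E₁ h
  refine Finset.sum_pos' (fun d hd => R.flux_nonneg_of_mem_E₁ ?_) ⟨d, by simp [hd],
    R.flux_pos hd'⟩
  rw [(Finset.mem_filter.1 hd).2]; exact h

theorem laplacian_neg {v : V} (h : v ∈ M.E₂) : M.laplacian c g v < 0 := by
  classical
  rw [laplacian_eq]
  obtain ⟨d, hd, hd'⟩ := R.exists_asc_of_mem_E₂ h
  refine Finset.sum_neg' (fun d hd => R.flux_nonpos_of_mem_E₂ ?_) ⟨d, by simp [hd],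
    R.flux_neg hd'⟩
  rw [(Finset.mem_filter.1 hd).2]; exact h

omit R in
theorem sum_mul_org (φ : D → ℝ) (f : V → ℝ) [DecidableEq V] :
    ∑ d, φ d * f (M.org d) = ∑ v, f v * ∑ d with M.org d = v, φ d := by
  rw [← Finset.sum_fiberwise (s := Finset.univ) (g := M.org)]
  refine Finset.sum_congr rfl fun v _ => ?_
  rw [Finset.mul_sum]
  refine Finset.sum_congr rfl fun d hd => ?_
  rw [(Finset.mem_filter.1 hd).2, mul_comm]

/-- Green's formula. By antisymmetry the fluxes of all darts add up to zero, so `f` may be shifted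
to vanish on E₂; harmonicity removes the interior vertices, and E₁ contributes the total flux. -/
theorem sum_flux_mul (f : V → ℝ) (a₁ a₂ : ℝ) (h₁ : ∀ v ∈ M.E₁, f v = a₁)
    (h₂ : ∀ v ∈ M.E₂, f v = a₂) :
    ∑ d, M.flux c g d * f (M.org d) = (a₁ - a₂) * M.totalFlux c g := by
  classical
  have h0 : ∑ d, M.flux c g d = 0 := by
    have := M.sum_rev (M.flux c g)
    simp only [R.flux_rev, Finset.sum_neg_distrib] at this
    linarith
  have e1 : ∑ d, M.flux c g d * f (M.org d) = ∑ d, M.flux c g d * (f (M.org d) - a₂) := by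
    simp only [mul_sub, Finset.sum_sub_distrib, ← Finset.sum_mul, h0, zero_mul, sub_zero]
  have e2 : (a₁ - a₂) * M.totalFlux c g =
      ∑ d, M.flux c g d * (if M.org d ∈ M.E₁ then a₁ - a₂ else 0) := by
    rw [totalFlux, Finset.mul_sum]
    refine Finset.sum_congr rfl fun d _ => ?_
    split_ifs <;> ring
  rw [e1, e2, sum_mul_org (M.flux c g) fun v => f v - a₂,
    sum_mul_org (M.flux c g) fun v => if v ∈ M.E₁ then a₁ - a₂ else 0]
  refine Finset.sum_congr rfl fun v _ => ?_
  by_cases hv₁ : v ∈ M.E₁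
  · rw [h₁ v hv₁, if_pos hv₁]
  by_cases hv₂ : v ∈ M.E₂
  · rw [h₂ v hv₂, if_neg hv₁, sub_self]
  have := R.dirichlet.harmonic v hv₁ hv₂
  rw [laplacian_eq] at this
  rw [this, mul_zero, mul_zero]

/-- The harmonic conjugate of `g` on the two-cells. -/
theorem exists_conjugate {n : ℕ} {s : Fin (n + 1) → D} (hs : M.IsSlit g s) :
    ∃ h : D → ℝ, (∀ d, h (M.next d) = h d) ∧ ∀ d, M.Inner d → M.Inner (M.rev d) →
      h (M.rev d) = h d + M.flux c g d - M.totalFlux c g * M.jump (Set.range s) d := by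
  classical
  -- The flux alone has the period T about the annulus. Both it and T times the unit flow along the
  -- slit pair with an admissible `f` to T (f(E₁) - f(E₂)), so their difference has a potential.
  obtain ⟨h, h1, h2⟩ := M.exists_face_potential
    (fun d => M.flux c g d - M.totalFlux c g * M.jump (Set.range s) d) (fun d => by
      simp only [R.flux_rev, jump, M.rev_rev]; ring_nf) (fun f hf₁ hf₂ => by
      simp only [sub_mul, Finset.sum_sub_distrib, mul_assoc, ← Finset.mul_sum]
      rw [hs.sum_jump f, R.sum_flux_mul f _ _ (fun v hv => hf₁ v hv _ hs.start)
        (fun v hv => hf₂ v hv _ hs.finish)]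
      ring)
  exact ⟨h, h1, fun d hd hd' => by have := h2 d hd hd'; linarith⟩

open Classical in
/-- The flux, modified on the darts along which `g` is constant so that it has no zero and its sum
about every vertex vanishes. -/
theorem exists_modified_flux : ∃ φ : D → ℝ,
    (∀ d, M.Asc g d ∨ M.Desc g d → φ d = M.flux c g d) ∧
    (∀ v, ∑ d with M.org d = v, φ d = 0) ∧ (∀ d, φ d ≠ 0) ∧
    (∀ d, φ d < 0 → 0 < φ (M.rot d) → M.Pos g d) := by
  let N : V → ℝ := fun v => ∑ d with M.org d = v,
    if g (M.org d) = g (M.org (M.rev d)) then 1 else 0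
  have hN : ∀ v, v ∈ M.E₁ ∨ v ∈ M.E₂ → 0 < N v := by
    intro v hv
    obtain ⟨d, hd, rfl⟩ : ∃ d, ¬ M.Inner d ∧ M.org d = v :=
      hv.elim M.exists_not_inner₁ M.exists_not_inner₂
    refine Finset.sum_pos' (fun _ _ => by split_ifs <;> simp) ⟨d, by simp, ?_⟩
    rw [if_pos (R.flat_of_not_inner hd)]
    exact one_pos
  -- The defect of the vertex sum, which is nonzero only on the boundary, is spread evenly over the
  -- darts along which `g` is constant. They then have the sign of ascending darts on E₁ and of
  -- descending darts on E₂.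
  let φ : D → ℝ := fun d => if g (M.org d) = g (M.org (M.rev d)) then
    - (M.laplacian c g (M.org d) / N (M.org d)) else M.flux c g d
  have hφ : ∀ d, M.Asc g d ∨ M.Desc g d → φ d = M.flux c g d := by
    intro d hd
    simp only [φ]
    rw [if_neg]
    rcases hd with hd | hd
    exacts [hd.ne, hd.ne']
  have hflat : ∀ d, g (M.org d) = g (M.org (M.rev d)) → (M.org d ∈ M.E₁ ∧ φ d < 0) ∨
      (M.org d ∈ M.E₂ ∧ 0 < φ d) := by
    intro d hd
    simp only [φ]
    rw [if_pos hd]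
    rcases R.flat d hd with ⟨h, -⟩ | ⟨h, -⟩
    · left
      have := div_pos (R.laplacian_pos h) (hN _ (Or.inl h))
      exact ⟨h, by linarith⟩
    · right
      have := div_neg_of_neg_of_pos (R.laplacian_neg h) (hN _ (Or.inr h))
      exact ⟨h, by linarith⟩
  refine ⟨φ, hφ, ?_, ?_, ?_⟩
  · intro v
    have : ∀ d ∈ Finset.univ.filter fun d => M.org d = v, φ d = M.flux c g d -
        (M.laplacian c g v / N v) * if g (M.org d) = g (M.org (M.rev d)) then 1 else 0 := by
      intro d hd
      rw [Finset.mem_filter] at hd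
      simp only [φ]
      split_ifs with h
      · rw [flux_eq_zero h, hd.2]; ring
      · ring
    rw [Finset.sum_congr rfl this, Finset.sum_sub_distrib, ← Finset.mul_sum, ← laplacian_eq]
    change _ - _ / N v * N v = 0
    by_cases hv : v ∈ M.E₁ ∨ v ∈ M.E₂
    · rw [div_mul_cancel₀ _ (hN v hv).ne', sub_self]
    · push Not at hv
      rw [R.dirichlet.harmonic v hv.1 hv.2]
      simp
  · intro d
    rcases M.asc_or_desc_or_flat g d with h | h | h
    · rw [hφ d (Or.inl h)]; exact (R.flux_neg h).ne
    · rw [hφ d (Or.inr h)]; exact (R.flux_pos h).ne'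
    · rcases hflat d h with h | h
      exacts [h.2.ne, h.2.ne']
  · intro d hd hd'
    have a1 : ¬ M.Desc g d := fun h => by
      rw [hφ d (Or.inr h)] at hd
      exact lt_asymm hd (R.flux_pos h)
    have a2 : ¬ M.Asc g (M.rot d) := fun h => by
      rw [hφ _ (Or.inl h)] at hd'
      exact lt_asymm hd' (R.flux_neg h)
    rcases M.asc_or_desc_or_flat g (M.rot d) with h | h | h
    · exact absurd h a2
    · rw [M.rot_apply, desc_rev] at h
      exact Or.inl ⟨h, a1⟩
    · rw [M.rot_apply, asc_rev] at a2
      rcases hflat _ h with h | h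
      · exact absurd h.2 (lt_asymm hd')
      · rcases M.asc_or_desc_or_flat g d with h' | h' | h'
        · exact Or.inr ⟨a2, h'⟩
        · exact absurd h' a1
        · rcases hflat _ h' with h'' | h''
          · rw [M.org_rot] at h
            exact (M.disjoint_boundary h''.1 h.1).elim
          · exact absurd h''.2 (lt_asymm hd)

/-- The increments of the harmonic conjugate about the vertices, starting from the ascending
corner. -/
theorem exists_corner_potential :
    ∃ q : D → ℝ, (∀ d, M.Asc g d ∨ M.Desc g d → q d - q (M.next (M.rev d)) = M.flux c g d) ∧
      (∀ d, M.Pos g d → q d = 0) ∧ (∀ d, ¬ M.Pos g d → 0 < q d) := by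
  classical
  obtain ⟨φ, hφ, hsum, hne, hpos⟩ := R.exists_modified_flux
  obtain ⟨q, hq⟩ := M.rot.exists_potential (fun d => φ (M.rot d)) (by
    intro y hy
    have hy' : ∀ d d', M.org d = M.org d' → y d = y d' := by
      intro d d' h
      by_contra hne
      obtain ⟨z, -, h1, h2⟩ := ((M.org_eq_iff_rot d d').1 h).exists_exit (fun z => y d = y z)
        rfl hne
      exact h2 (h1.trans (hy z).symm)
    have e1 : ∑ d, y d * φ (M.rot d) = ∑ d, φ d * y d := by
      rw [← Equiv.sum_comp M.rot fun d => φ d * y d]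
      exact Finset.sum_congr rfl fun d _ => by rw [hy, mul_comm]
    have e2 : ∀ d, y d = y (Function.surjInv M.org_surjective (M.org d)) := fun d =>
      hy' _ _ (Function.surjInv_eq M.org_surjective _).symm
    rw [e1, Finset.sum_congr rfl fun d _ => by rw [e2 d],
      sum_mul_org φ fun v => y (Function.surjInv M.org_surjective v)]
    simp [hsum])
  have hmin : ∀ v, ∃ d, M.org d = v ∧ ∀ d', M.org d' = v → q d ≤ q d' := by
    intro v
    obtain ⟨d₀, hd₀⟩ := M.org_surjective v
    obtain ⟨d, hd, hd'⟩ := Finset.exists_min_image (Finset.univ.filter fun d => M.org d = v) q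
      ⟨d₀, by simp [hd₀]⟩
    exact ⟨d, (Finset.mem_filter.1 hd).2, fun d' h => hd' d' (by simp [h])⟩
  choose m hm hm' using hmin
  -- A minimum is preceded by a negative increment and followed by a positive one, which happens
  -- only at a `Pos` corner. This corner is unique at its vertex, so subtracting the minimum makes
  -- the potential 0 exactly there.
  have hminpos : ∀ d, q d = q (m (M.org d)) → M.Pos g d := by
    intro d hd
    have hle : ∀ d', M.org d' = M.org d → q d ≤ q d' := fun d' h => by
      rw [hd]; exact hm' _ _ h
    apply hpos d
    · have h1 := hq (M.rot.symm d)
      have h2 : M.org (M.rot.symm d) = M.org d := by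
        rw [← M.org_rot (M.rot.symm d), Equiv.apply_symm_apply]
      rw [Equiv.apply_symm_apply] at h1
      have := hle _ h2
      exact lt_of_le_of_ne (by linarith) (hne d)
    · have h1 := hq d
      have := hle _ (M.org_rot d)
      exact lt_of_le_of_ne (by linarith) (hne _).symm
  refine ⟨fun d => q d - q (m (M.org d)), fun d hd => ?_, fun d hd => ?_, fun d hd => ?_⟩
  · have h1 := hq (M.next (M.rev d))
    rw [M.rot_next, M.rev_rev, hφ d hd] at h1
    change q d - q (m (M.org d)) - (q (M.next (M.rev d)) - q (m (M.org (M.next (M.rev d))))) = _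
    rw [M.org_next, M.rev_rev, ← h1]
    ring
  · change q d - q (m (M.org d)) = 0
    rw [R.pos_unique (hm _).symm hd (hminpos _ (by rw [hm])), hm, sub_self]
  · refine lt_of_le_of_ne (sub_nonneg.2 (hm' _ _ rfl)) fun h => hd (hminpos d ?_)
    linarith

section Chain

variable {n : ℕ} {s : Fin (n + 1) → D} (hs : M.IsSlit g s) {U : V → Prop} {a : ℝ}
  (hU : M.IsCut g U a)
include hs hU

omit hs in
/-- The successor, in the counterclockwise sense, of a dart that leaves `U`. -/
theorem exists_succ : ∃ τ : Equiv.Perm {d // M.Exits U d},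
    ∀ d, M.next.SameCycle (M.rev d.1) (τ d).1 := by
  have hex : ∀ d : {d // M.Exits U d}, ∃ d' : {d // M.Exits U d},
      M.next.SameCycle (M.rev d.1) d'.1 := by
    rintro ⟨d, hd⟩
    have hx : U (M.org (M.next (M.rev d))) := by
      rw [M.org_next, M.rev_rev]; exact hd.1
    obtain ⟨⟨d', h, h'⟩, -⟩ := exists_exits (x := M.next (M.rev d)) (y := M.rev d) (by simp) hx hd.2
    exact ⟨⟨d', h'⟩, by simpa using h⟩
  choose τ hτ using hex
  -- Darts with the same successor lead into the same cell, and a cell has only one side that enters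
  -- `U`.
  have hinj : Function.Injective τ := by
    intro d d' h
    have h1 := hτ d
    rw [h] at h1
    have := R.enters_unique hU (d := M.rev d.1) (d' := M.rev d'.1) (by rw [M.rev_rev]; exact d.2)
      (by rw [M.rev_rev]; exact d'.2) (h1.trans (hτ d').symm)
    exact Subtype.ext (M.rev.injective this)
  exact ⟨Equiv.ofBijective τ (Finite.injective_iff_bijective.1 hinj), hτ⟩

/-- The darts that leave `U`, in their counterclockwise order from the slit to the slit. -/
theorem exists_chain : ∃ (m : ℕ) (d : ℕ → D), 0 < m ∧ (∀ i, M.Exits U (d i)) ∧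
    d 0 ∈ Set.range s ∧ d m ∈ Set.range s ∧ (∀ i, 0 < i → i < m → d i ∉ Set.range s) ∧
    (∀ i, M.next.SameCycle (M.rev (d i)) (d (i + 1))) ∧
    ∀ e, M.Exits U e → ∃ i < m, e = d (i + 1) := by
  obtain ⟨τ, hτ⟩ := R.exists_succ hU
  obtain ⟨h, h1, h2⟩ := R.exists_conjugate hs
  have hface : ∀ d d', M.next.SameCycle d d' → h d = h d' := by
    intro d d' hd
    by_contra hne
    obtain ⟨z, -, hz1, hz2⟩ := hd.exists_exit (fun z => h d = h z) rfl hne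
    exact hz2 (hz1.trans (h1 z).symm)
  have hstep : ∀ d : {d // M.Exits U d}, d.1 ∉ Set.range s → h d.1 < h (τ d).1 := by
    intro d hd
    have hdesc := d.2.desc hU
    rw [← hface _ _ (hτ d), h2 _ (R.inner_of_desc hdesc) (R.inner_rev_of_desc hdesc)]
    have hr : M.rev d.1 ∉ Set.range s := fun h' =>
      ((M.desc_rev g _).1 (hs.desc h')).not_desc hdesc
    have := R.flux_pos hdesc
    simp only [jump, hd, hr, if_false]
    linarith
  obtain ⟨s₀, hs₀, hs₀U⟩ := hs.exists_exits hU
  have hslit : ∀ d : {d // M.Exits U d}, d.1 ∈ Set.range s ↔ d = ⟨s₀, hs₀U⟩ := fun d =>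
    ⟨fun h => Subtype.ext (hs.exits_unique hU h hs₀ d.2 hs₀U), by rintro rfl; exact hs₀⟩
  -- On an orbit that avoids the slit the conjugate would increase forever, although there are
  -- finitely many darts.
  have hreach : ∀ d : {d // M.Exits U d}, ∃ i : ℕ, τ^[i] d = ⟨s₀, hs₀U⟩ := by
    intro d
    by_contra! hcon
    have hmono : StrictMono fun i : ℕ => h (τ^[i] d).1 := strictMono_nat_of_lt_succ fun i => by
      rw [Function.iterate_succ_apply']
      exact hstep _ fun h => hcon i ((hslit _).1 h)
    exact not_injective_infinite_finite (fun i : ℕ => τ^[i] d)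
      fun i j hij => hmono.injective (congrArg (fun d => h d.1) hij)
  set x : {d // M.Exits U d} := ⟨s₀, hs₀U⟩ with hx
  have hper : x ∈ Function.periodicPts τ := τ.injective.mem_periodicPts x
  -- The slit leaves `U` only at `x`, so every orbit contains `x` and `τ` is a single cycle. The
  -- chain runs through it once, from the slit dart back to the same dart.
  set m := Function.minimalPeriod τ x with hm
  have hm0 : 0 < m := Function.minimalPeriod_pos_of_mem_periodicPts hper
  refine ⟨m, fun i => (τ^[i] x).1, hm0, fun i => (τ^[i] x).2, hs₀, ?_, ?_, ?_, ?_⟩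
  · change (τ^[Function.minimalPeriod τ x] x).1 ∈ _
    rw [Function.iterate_minimalPeriod]
    exact hs₀
  · intro i hi him hmem
    exact absurd (Function.IsPeriodicPt.minimalPeriod_le hi ((hslit _).1 hmem)) (not_le.2 him)
  · intro i
    change M.next.SameCycle (M.rev (τ^[i] x).1) (τ^[i + 1] x).1
    rw [Function.iterate_succ_apply']
    exact hτ _
  · intro e he
    obtain ⟨i, hi⟩ := hreach ⟨e, he⟩
    have hsc : τ.SameCycle x ⟨e, he⟩ := by
      refine Equiv.Perm.SameCycle.symm ⟨i, ?_⟩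
      rw [zpow_natCast, ← Equiv.Perm.iterate_eq_pow, hi]
    obtain ⟨j, -, hj, hj'⟩ := hsc.exists_pow_eq''
    rw [← Equiv.Perm.iterate_eq_pow] at hj'
    rw [← Function.iterate_mod_minimalPeriod_eq, ← hm] at hj'
    -- The darts are listed as d 1, …, d m, so the slit dart has to be found at the index m and not
    -- at 0.
    rcases Nat.eq_zero_or_pos (j % m) with h0 | h0
    · rw [h0] at hj'
      refine ⟨m - 1, by omega, ?_⟩
      change e = (τ^[m - 1 + 1] x).1
      rw [Nat.sub_add_cancel hm0, hm, Function.iterate_minimalPeriod]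
      exact (congrArg Subtype.val hj').symm
    · refine ⟨j % m - 1, by have := Nat.mod_lt j hm0; omega, ?_⟩
      change e = (τ^[j % m - 1 + 1] x).1
      rw [Nat.sub_add_cancel h0, hj']

open Classical in
/-- The flux through every level is the same. -/
theorem sum_exits : ∑ d with M.Exits U d, M.flux c g d = M.totalFlux c g := by
  obtain ⟨τ, hτ⟩ := R.exists_succ hU
  obtain ⟨h, h1, h2⟩ := R.exists_conjugate hs
  have hface : ∀ d d', M.next.SameCycle d d' → h d = h d' := by
    intro d d' hd
    by_contra hne
    obtain ⟨z, -, hz1, hz2⟩ := hd.exists_exit (fun z => h d = h z) rfl hne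
    exact hz2 (hz1.trans (h1 z).symm)
  obtain ⟨s₀, hs₀, hs₀U⟩ := hs.exists_exits hU
  -- The differences of the conjugate cancel when summed over the permutation; only the jump at the
  -- slit remains.
  have hstep : ∀ d : {d // M.Exits U d}, M.flux c g d.1 =
      h (τ d).1 - h d.1 + if d = ⟨s₀, hs₀U⟩ then M.totalFlux c g else 0 := by
    intro d
    have hdesc := d.2.desc hU
    have hr : M.rev d.1 ∉ Set.range s := fun h' =>
      ((M.desc_rev g _).1 (hs.desc h')).not_desc hdesc
    have hd : d.1 ∈ Set.range s ↔ d = ⟨s₀, hs₀U⟩ :=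
      ⟨fun h => Subtype.ext (hs.exits_unique hU h hs₀ d.2 hs₀U), by rintro rfl; exact hs₀⟩
    rw [← hface _ _ (hτ d), h2 _ (R.inner_of_desc hdesc) (R.inner_rev_of_desc hdesc)]
    simp only [jump, hr, hd, if_false]
    split_ifs <;> ring
  rw [Finset.sum_subtype (p := fun d => M.Exits U d) _ (by simp),
    Finset.sum_congr rfl fun d _ => hstep d, Finset.sum_add_distrib, Finset.sum_sub_distrib,
    Equiv.sum_comp τ fun d => h d.1]
  simp

end Chain

end IsRegular

end AnnulusMap

/-! ### Segments of level curves in a cell, and the extension of functions on the sides -/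

namespace AnnulusMap

variable {D V : Type*} [Fintype D] [Fintype V]

section Corners

namespace IsRegular

variable {M : AnnulusMap D V} {c : D → ℝ} {k : ℝ} {g : V → ℝ} (R : M.IsRegular c k g)
include R

variable {U : V → Prop} {a : ℝ} (hU : M.IsCut g U a) {d e x : D} (hd : M.Exits U d)
  (he : M.Exits U (M.rev e)) (hed : M.next.SameCycle e d) (hx : M.next.SameCycle e x)
  (hxa : g (M.org x) = a)
include hU hd he hed hx hxa

/-- Suppose that the corner is at neither end of the part of the boundary of the cell in `U`. If
both neighbouring corners are higher, then {a < g} is left twice within the cell. If one of them is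
also at level `a`, then it is on E₁ with `x`, so a = k and `g` is constant on two consecutive sides.
Both are excluded. -/
theorem eq_or_eq_of_mem (hxU : U (M.org x)) : x = d ∨ M.next e = x := by
  by_contra! hcon
  obtain ⟨h1, h2⟩ := hcon
  have hei : M.Inner e := R.inner_of_asc ((M.desc_rev g e).1 (he.desc hU))
  have hxi : M.Inner x := Inner.of_sameCycle hx hei
  obtain ⟨p, rfl⟩ := M.next.surjective x
  have hpi : M.Inner p := M.inner_next.1 hxi
  have hdx : M.next.SameCycle (M.next p) d := hx.symm.trans hed
  have hend : U (M.org (M.next (M.next p))) := by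
    by_contra h
    rw [M.org_next (M.next p)] at h
    exact h1 (R.exits_unique hU ⟨hxU, h⟩ hd hdx)
  have hp : U (M.org p) := by
    by_contra h
    exact h2 (congrArg M.next (R.enters_unique hU he
      ⟨by rwa [← M.org_next], by rwa [M.rev_rev]⟩ (by simpa using hx)))
  have hflat : ∀ z, U (M.org z) → g (M.org z) = a → g (M.org (M.next z)) = a → a = k := by
    intro z hz ha hb
    rcases R.flat z (by rw [← M.org_next, ha, hb]) with h | h
    · rw [← ha, R.mem_E₁_iff.1 h.1]
    · exact absurd hz (hU.on_E₂ _ h.1)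
  rcases (hU.le _ hp).eq_or_lt with h3 | h3
  · have hak := hflat p hp h3.symm hxa
    have h4 := le_antisymm (R.le_k _) (hak ▸ hU.le _ hend)
    exact R.not_flat_flat hpi (by rw [← M.org_next, hxa, ← h3])
      (by rw [← M.org_next, hxa, h4, hak])
  rcases (hU.le _ hend).eq_or_lt with h4 | h4
  · have hak := hflat _ hxU hxa h4.symm
    exact h3.not_ge (hak ▸ R.le_k _)
  have hU' := R.isCut_gt (hxa ▸ R.nonneg _) (h3.trans_le (R.le_k _))
  have hpe : M.Exits (fun v => a < g v) p := ⟨h3, by rw [← M.org_next]; exact hxa.not_gt⟩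
  have hcyc : M.next.SameCycle (M.next (M.next p)) (M.next d) := by simpa using hdx
  obtain ⟨z, hz, hz1, hz2⟩ := hcyc.exists_exit
    (fun z => a < g (M.org z) ∨ z = M.next p) (Or.inl h4) (by
      rintro (h | h)
      · rw [M.org_next] at h
        exact h.not_ge (hU.ge _ hd.2)
      · rw [← h, M.org_next] at hxU
        exact hd.2 hxU)
  push Not at hz2
  rcases hz1 with hz1 | rfl
  · have : z = p := R.exits_unique hU' ⟨hz1, by rw [← M.org_next]; exact not_lt.2 hz2.1⟩ hpe
      (by simpa using hz.symm)
    exact hz2.2 (congrArg M.next this)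
  · exact hz2.1.not_gt h4

/-- The mirror image of `eq_or_eq_of_mem`: a strict local maximum strictly inside the part of the
boundary outside `U` would make {a ≤ g} be left twice. -/
theorem eq_or_eq_of_notMem (hxU : ¬ U (M.org x)) : x = e ∨ M.next d = x := by
  by_contra! hcon
  obtain ⟨h1, h2⟩ := hcon
  have hei : M.Inner e := R.inner_of_asc ((M.desc_rev g e).1 (he.desc hU))
  have hxi : M.Inner x := Inner.of_sameCycle hx hei
  obtain ⟨p, rfl⟩ := M.next.surjective x
  have hpi : M.Inner p := M.inner_next.1 hxi
  have hdx : M.next.SameCycle (M.next p) d := hx.symm.trans hed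
  have hend : ¬ U (M.org (M.next (M.next p))) := by
    intro h
    rw [M.org_next (M.next p)] at h
    exact h1 (R.enters_unique hU ⟨h, by rwa [M.rev_rev]⟩ he hx.symm)
  have hp : ¬ U (M.org p) := by
    intro h
    exact h2 (congrArg M.next (R.exits_unique hU hd
      ⟨h, by rwa [← M.org_next]⟩ (by simpa using hdx.symm)))
  have hflat : ∀ z, ¬ U (M.org z) → g (M.org z) = a → g (M.org (M.next z)) = a → a = 0 := by
    intro z hz ha hb
    rcases R.flat z (by rw [← M.org_next, ha, hb]) with h | h
    · exact absurd (hU.on_E₁ _ h.1) hz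
    · rw [← ha, R.mem_E₂_iff.1 h.1]
  rcases (hU.ge _ hp).eq_or_lt with h3 | h3
  · have hak := hflat p hp h3 hxa
    have h4 := le_antisymm (hak ▸ hU.ge _ hend) (R.nonneg _)
    exact R.not_flat_flat hpi (by rw [← M.org_next, hxa, ← h3])
      (by rw [← M.org_next, hxa, h4, hak])
  rcases (hU.ge _ hend).eq_or_lt with h4 | h4
  · have hak := hflat _ hxU hxa h4
    exact h3.not_ge (hak ▸ R.nonneg _)
  have hU' := R.isCut_ge ((R.nonneg _).trans_lt h3) (hxa ▸ R.le_k _)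
  have hpe : M.Exits (fun v => a ≤ g v) (M.next p) :=
    ⟨hxa.ge, by rw [← M.org_next]; exact not_le.2 h4⟩
  have hcyc : M.next.SameCycle d (M.next (M.next p)) := by simpa using hdx.symm
  obtain ⟨z, hz, hz1, hz2⟩ := hcyc.exists_exit
    (fun z => a ≤ g (M.org z) ∧ z ≠ M.next p)
    ⟨hU.le _ hd.1, by rintro rfl; exact hxU hd.1⟩ (fun h => h4.not_ge h.1)
  have hpz : M.next.SameCycle z (M.next p) := hz.symm.trans hdx.symm
  by_cases h5 : a ≤ g (M.org (M.next z))
  · have h6 : M.next z = M.next p := by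
      by_contra h
      exact hz2 ⟨h5, h⟩
    rw [M.next.injective h6] at hz1
    exact h3.not_ge hz1.1
  · exact hz1.2 (R.exits_unique hU' ⟨hz1.1, by rwa [← M.org_next]⟩ hpe hpz)

end IsRegular

end Corners

variable [DecidableEq D]

section SidePt

variable (M : AnnulusMap D V)

theorem sidePt_apply (d : D) (r : unitInterval) (x : D) :
    M.sidePt d r x = (1 - (r : ℝ)) * (if x = d then 1 else 0) +
      (r : ℝ) * if x = M.next d then 1 else 0 := by
  simp [sidePt, Pi.single_apply]

theorem sidePt_one (d : D) : M.sidePt d 1 = M.sidePt (M.next d) 0 := by simp [sidePt]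

theorem sidePt_eq (d : D) (r : unitInterval) :
    M.sidePt d r = (1 - (r : ℝ)) • M.sidePt d 0 + (r : ℝ) • M.sidePt (M.next d) 0 := by
  simp [sidePt]

theorem sidePt_ne_zero {d x : D} {r : unitInterval} (h : M.sidePt d r x ≠ 0) :
    M.next.SameCycle d x := by
  rw [sidePt_apply] at h
  by_cases h1 : x = d
  · simp [h1]
  by_cases h2 : x = M.next d
  · simp [h2]
  simp [h1, h2] at h

theorem sum_sidePt (d : D) (r : unitInterval) : ∑ x, M.sidePt d r x = 1 := by
  simp [sidePt, Finset.sum_add_distrib, ← Finset.mul_sum]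

variable {M}

/-- The coordinates of a point on a side are supported on its two corners. Cells have at least three
corners, so distinct sides of a cell share at most one. -/
theorem Inner.sidePt_eq_sidePt {d e : D} (hd : M.Inner d) (he : M.Inner e) {r r' : unitInterval}
    (h : M.sidePt d r = M.sidePt e r') :
    (d = e ∧ r = r') ∨ (r = 1 ∧ r' = 0 ∧ M.next d = e) ∨ (r = 0 ∧ r' = 1 ∧ M.next e = d) := by
  obtain ⟨-, d1, d2, -⟩ := hd.cycle
  obtain ⟨-, e1, e2, -⟩ := he.cycle
  have key : ∀ x, _ := fun x => congrFun h x
  simp only [sidePt_apply] at key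
  by_cases h1 : d = e
  · subst h1
    have := key (M.next d)
    simp [d1] at this
    exact Or.inl ⟨rfl, Subtype.ext this⟩
  right
  by_cases h2 : M.next d = e
  · left
    subst h2
    have a1 := key d
    have a2 := key (M.next (M.next d))
    simp only [d1.symm, d2.symm, e1, d2, if_true, if_false] at a1 a2
    refine ⟨Subtype.ext ?_, Subtype.ext ?_, rfl⟩ <;> push_cast <;> linarith
  · by_cases h3 : M.next e = d
    · right
      subst h3
      have a1 := key e
      have a2 := key (M.next (M.next e))
      simp only [e1.symm, e2.symm, d1, e2, if_true, if_false] at a1 a2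
      refine ⟨Subtype.ext ?_, Subtype.ext ?_, rfl⟩ <;> push_cast <;> linarith
    · exfalso
      have a1 := key d
      have a2 := key (M.next d)
      have h4 : M.next d ≠ M.next e := fun h => h1 (M.next.injective h)
      simp only [h1, h2, d1, h4, d1.symm, Ne.symm h3, if_true, if_false] at a1 a2
      linarith

variable {g : V → ℝ}

omit [DecidableEq D] in
theorem sideLevel_injective {d : D} (h : g (M.org d) ≠ g (M.org (M.rev d))) {r r' : unitInterval}
    (hr : M.sideLevel g d r = M.sideLevel g d r') : r = r' := by
  simp only [sideLevel] at hr
  have : ((r : ℝ) - r') * (g (M.org (M.rev d)) - g (M.org d)) = 0 := by linarith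
  rcases mul_eq_zero.1 this with h1 | h1
  · exact Subtype.ext (by linarith)
  · exact absurd (by linarith) h

omit [DecidableEq D] in
@[simp]
theorem sideLevel_zero (d : D) : M.sideLevel g d 0 = g (M.org d) := by simp [sideLevel]

omit [DecidableEq D] in
@[simp]
theorem sideLevel_one (d : D) : M.sideLevel g d 1 = g (M.org (M.rev d)) := by simp [sideLevel]

omit [DecidableEq D] in
theorem sideLevel_rev (d : D) (r : unitInterval) :
    M.sideLevel g (M.rev d) (unitInterval.symm r) = M.sideLevel g d r := by
  simp only [sideLevel, M.rev_rev, unitInterval.coe_symm_eq]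
  ring

omit [DecidableEq D] in
theorem exists_sideLevel_eq {d : D} {a : ℝ} (h : M.Desc g d) (h1 : g (M.org (M.rev d)) ≤ a)
    (h2 : a ≤ g (M.org d)) : ∃ r, M.sideLevel g d r = a := by
  have hpos : 0 < g (M.org d) - g (M.org (M.rev d)) := sub_pos.2 h
  refine ⟨⟨(g (M.org d) - a) / (g (M.org d) - g (M.org (M.rev d))),
    div_nonneg (by linarith) hpos.le, (div_le_one hpos).2 (by linarith)⟩, ?_⟩
  simp only [sideLevel]
  field_simp
  ring

omit [DecidableEq D] in
theorem exists_sideLevel_eq_of_asc {d : D} {a : ℝ} (h : M.Asc g d)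
    (h1 : g (M.org d) ≤ a) (h2 : a ≤ g (M.org (M.rev d))) : ∃ r, M.sideLevel g d r = a := by
  obtain ⟨r, hr⟩ := exists_sideLevel_eq (d := M.rev d) ((M.desc_rev g d).2 h)
    (by rwa [M.rev_rev]) h2
  exact ⟨unitInterval.symm r, by rw [← hr, ← sideLevel_rev, unitInterval.symm_symm]⟩

omit [DecidableEq D] in
theorem sideLevel_continuous (d : D) : Continuous (M.sideLevel g d) := by
  unfold sideLevel; fun_prop

end SidePt

/-- A function on the sides that extends to a function on `Q_slit` which is continuous and strictly
increasing along the level curves of `g`. -/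
structure IsSideFunction (M : AnnulusMap D V) (g : V → ℝ) (S : Set D)
    (B : M.Side → unitInterval → ℝ) : Prop where
  next : ∀ e e' : M.Side, e'.1 = M.next e.1 → B e 1 = B e' 0
  glue : ∀ e e' : M.Side, e'.1 = M.rev e.1 → e.1 ∉ S → e'.1 ∉ S →
    ∀ r, B e' (unitInterval.symm r) = B e r
  flat : ∀ e : M.Side, g (M.org e.1) = g (M.org (M.rev e.1)) →
    ∀ r : unitInterval, B e r = (1 - (r : ℝ)) * B e 0 + (r : ℝ) * B e 1
  cont : ∀ e, Continuous (B e)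
  lt : ∀ e e' : M.Side, M.next.SameCycle e.1 e'.1 → M.Asc g e.1 → M.Desc g e'.1 → ∀ r r',
    M.sideLevel g e.1 r = M.sideLevel g e'.1 r' → M.sidePt e.1 r ≠ M.sidePt e'.1 r' →
    B e r < B e' r'
  jump : ∀ e e' : M.Side, e'.1 = M.rev e.1 → e.1 ∈ S → ∀ r, B e' (unitInterval.symm r) < B e r

/-- The value at a chord point of the extension of a function on the sides. -/
def ChordPoint.val {M : AnnulusMap D V} {g : V → ℝ} (B : M.Side → unitInterval → ℝ)
    (p : M.ChordPoint g) : ℝ :=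
  (1 - (p.s : ℝ)) * B p.e p.r + (p.s : ℝ) * B p.e' p.r'

/-- The level of `g` at a chord point. -/
def ChordPoint.level {M : AnnulusMap D V} {g : V → ℝ} (p : M.ChordPoint g) : ℝ :=
  M.sideLevel g p.e.1 p.r

/-- The extension to `Q_slit` of a function on the sides. -/
noncomputable def sideExt (M : AnnulusMap D V) (g : V → ℝ) (S : Set D)
    (B : M.Side → unitInterval → ℝ) (z : M.QSlit g S) : ℝ :=
  (M.exists_chordPoint g S z).choose.val B

section LinearExt

variable {M : AnnulusMap D V} {g : V → ℝ}

omit [DecidableEq D] in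
theorem linearExt_add_smul (x y : D → ℝ) (s t : ℝ) :
    M.linearExt g (s • x + t • y) = s * M.linearExt g x + t * M.linearExt g y := by
  simp only [linearExt, Pi.add_apply, Pi.smul_apply, smul_eq_mul, add_mul,
    Finset.sum_add_distrib, Finset.mul_sum, mul_assoc]

theorem ChordPoint.linearExt_coord (p : M.ChordPoint g) : M.linearExt g p.coord = p.level := by
  rw [coord, linearExt_add_smul, linearExt_sidePt, linearExt_sidePt, ← p.same_level, level]
  ring

theorem ChordPoint.gExt_toQ (S : Set D) (p : M.ChordPoint g) : M.gExt g S (p.toQ S) = p.level :=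
  p.linearExt_coord

/-- The coordinates are supported on the corners of one cell and, having sum 1, do not all vanish.
-/
theorem ChordPoint.sameCycle_of_coord_eq {p q : M.ChordPoint g} (h : p.coord = q.coord) :
    M.next.SameCycle p.e.1 q.e.1 := by
  have key : ∀ p : M.ChordPoint g, ∀ x, p.coord x ≠ 0 → M.next.SameCycle p.e.1 x := by
    intro p x hx
    simp only [coord, Pi.add_apply, Pi.smul_apply, smul_eq_mul] at hx
    by_cases h1 : M.sidePt p.e.1 p.r x = 0
    · have h2 : M.sidePt p.e'.1 p.r' x ≠ 0 := fun h2 => by simp [h1, h2] at hx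
      exact p.same_cell.trans (M.sidePt_ne_zero h2)
    · exact M.sidePt_ne_zero h1
  have hsum : ∑ x, p.coord x = 1 := by
    simp [coord, Finset.sum_add_distrib, ← Finset.mul_sum, sum_sidePt]
  obtain ⟨x, -, hx⟩ := Finset.exists_ne_zero_of_sum_ne_zero (hsum.trans_ne one_ne_zero)
  exact (key p x hx).trans (key q x (h ▸ hx)).symm

end LinearExt

namespace IsRegular

variable {M : AnnulusMap D V} {c : D → ℝ} {k : ℝ} {g : V → ℝ} (R : M.IsRegular c k g)
  {S : Set D} {B : M.Side → unitInterval → ℝ}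
include R

omit [DecidableEq D] in
theorem sideLevel_mem (d : D) (r : unitInterval) :
    0 ≤ M.sideLevel g d r ∧ M.sideLevel g d r ≤ k := by
  have h1 := R.nonneg (M.org d)
  have h2 := R.nonneg (M.org (M.rev d))
  have h3 := R.le_k (M.org d)
  have h4 := R.le_k (M.org (M.rev d))
  have hr0 := r.2.1
  have hr1 := r.2.2
  simp only [sideLevel]
  constructor <;> nlinarith

omit R [DecidableEq D] in
theorem exists_le_le_sideLevel {d : D} {r : unitInterval} {a : ℝ}
    (h : M.sideLevel g d r = a) :
    (∃ x, M.next.SameCycle d x ∧ g (M.org x) ≤ a) ∧ ∃ x, M.next.SameCycle d x ∧ a ≤ g (M.org x) := by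
  have hr0 := r.2.1
  have hr1 := r.2.2
  have hn : M.next.SameCycle d (M.next d) := by simp
  simp only [sideLevel] at h
  rcases le_total (g (M.org d)) (g (M.org (M.rev d))) with h1 | h1
  · exact ⟨⟨d, by simp, by nlinarith⟩, ⟨M.next d, hn, by rw [M.org_next]; nlinarith⟩⟩
  · exact ⟨⟨M.next d, hn, by rw [M.org_next]; nlinarith⟩, ⟨d, by simp, by nlinarith⟩⟩

omit [DecidableEq D] in
/-- A cut that passes through a given point of a two-cell. -/
theorem exists_isCut {d₀ : D} (hd₀ : M.Inner d₀) {r : unitInterval} {a : ℝ}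
    (h : M.sideLevel g d₀ r = a) : ∃ U : V → Prop, M.IsCut g U a ∧
      (∃ d, M.next.SameCycle d₀ d ∧ M.Exits U d) ∧
      ∃ e, M.next.SameCycle d₀ e ∧ M.Exits U (M.rev e) := by
  obtain ⟨h0, hk⟩ := R.sideLevel_mem d₀ r
  rw [h] at h0 hk
  obtain ⟨⟨x, hx, hxa⟩, ⟨y, hy, hya⟩⟩ := exists_le_le_sideLevel h
  -- The cut {a ≤ g} works if the cell has a corner below `a`. Otherwise some corner lies above `a`,
  -- since `g` is not constant on a cell, and {a < g} works.
  by_cases hlt : ∃ x, M.next.SameCycle d₀ x ∧ g (M.org x) < a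
  · obtain ⟨x, hx, hxa⟩ := hlt
    have hU := R.isCut_ge ((R.nonneg _).trans_lt hxa) hk
    obtain ⟨⟨d, hd, hd'⟩, ⟨e, he, he'⟩⟩ :=
      exists_exits (U := fun v => a ≤ g v) (hy.symm.trans hx) hya (not_le.2 hxa)
    exact ⟨_, hU, ⟨d, hy.trans hd, hd'⟩, ⟨e, hy.trans he, he'⟩⟩
  · push Not at hlt
    obtain ⟨y, hy, hya⟩ : ∃ y, M.next.SameCycle d₀ y ∧ a < g (M.org y) := by
      by_contra! hle
      have heq : ∀ z, M.next.SameCycle d₀ z → g (M.org z) = a := fun z hz =>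
        le_antisymm (hle z hz) (hlt z hz)
      refine R.not_flat_flat hd₀ ?_ ?_ <;> rw [← M.org_next] <;> rw [heq, heq] <;> simp
    have hU := R.isCut_gt h0 (hya.trans_le (R.le_k _))
    obtain ⟨⟨d, hd, hd'⟩, ⟨e, he, he'⟩⟩ :=
      exists_exits (U := fun v => a < g v) (hy.symm.trans hx) hya (not_lt.2 hxa)
    exact ⟨_, hU, ⟨d, hy.trans hd, hd'⟩, ⟨e, hy.trans he, he'⟩⟩

section Seg

variable (hB₁ : ∀ e e' : M.Side, e'.1 = M.next e.1 → B e 1 = B e' 0)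
  (hB₂ : ∀ e : M.Side, g (M.org e.1) = g (M.org (M.rev e.1)) →
    ∀ r : unitInterval, B e r = (1 - (r : ℝ)) * B e 0 + (r : ℝ) * B e 1)
  {U : V → Prop} {a : ℝ} (hU : M.IsCut g U a) {d e : M.Side} (hd : M.Exits U d.1)
  (he : M.Exits U (M.rev e.1)) (hed : M.next.SameCycle e.1 d.1) {re rd : unitInterval}
  (hre : M.sideLevel g e.1 re = a) (hrd : M.sideLevel g d.1 rd = a)
include hB₁ hU hd he hed hre hrd

theorem corner_eq {x : M.Side} (hx : M.next.SameCycle e.1 x.1) (hxa : g (M.org x.1) = a) :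
    (M.sidePt x.1 0 = M.sidePt e.1 re ∧ B x 0 = B e re) ∨
    (M.sidePt x.1 0 = M.sidePt d.1 rd ∧ B x 0 = B d rd) := by
  have hdd := hd.desc hU
  have hee := (M.desc_rev g e.1).1 (he.desc hU)
  have hd0 : x.1 = d.1 → rd = 0 := fun h =>
    sideLevel_injective hdd.ne' (by rw [hrd, sideLevel_zero, ← h, hxa])
  have hd1 : M.next d.1 = x.1 → rd = 1 := fun h =>
    sideLevel_injective hdd.ne' (by rw [hrd, sideLevel_one, ← M.org_next, h, hxa])
  have he0 : x.1 = e.1 → re = 0 := fun h =>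
    sideLevel_injective hee.ne (by rw [hre, sideLevel_zero, ← h, hxa])
  have he1 : M.next e.1 = x.1 → re = 1 := fun h =>
    sideLevel_injective hee.ne (by rw [hre, sideLevel_one, ← M.org_next, h, hxa])
  by_cases hxU : U (M.org x.1)
  · rcases R.eq_or_eq_of_mem hU hd he hed hx hxa hxU with h | h
    · right
      rw [hd0 h, Subtype.ext h]
      exact ⟨rfl, rfl⟩
    · left
      rw [he1 h, sidePt_one, h, hB₁ e x h.symm]
      exact ⟨rfl, rfl⟩
  · rcases R.eq_or_eq_of_notMem hU hd he hed hx hxa hxU with h | h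
    · left
      rw [he0 h, Subtype.ext h]
      exact ⟨rfl, rfl⟩
    · right
      rw [hd1 h, sidePt_one, h, hB₁ d x h.symm]
      exact ⟨rfl, rfl⟩

include hB₂

/-- The points of the boundary of a two-cell at a given level are on one segment. -/
theorem side_mem_seg {x : M.Side} (hx : M.next.SameCycle e.1 x.1) {r : unitInterval}
    (hxa : M.sideLevel g x.1 r = a) : ∃ t : unitInterval,
    M.sidePt x.1 r = (1 - (t : ℝ)) • M.sidePt e.1 re + (t : ℝ) • M.sidePt d.1 rd ∧
    B x r = (1 - (t : ℝ)) * B e re + (t : ℝ) * B d rd := by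
  have hcor : ∀ x : M.Side, M.next.SameCycle e.1 x.1 → g (M.org x.1) = a →
      ∃ t : unitInterval,
      M.sidePt x.1 0 = (1 - (t : ℝ)) • M.sidePt e.1 re + (t : ℝ) • M.sidePt d.1 rd ∧
      B x 0 = (1 - (t : ℝ)) * B e re + (t : ℝ) * B d rd := by
    intro x hx hxa
    rcases R.corner_eq hB₁ hU hd he hed hre hrd hx hxa with ⟨h1, h2⟩ | ⟨h1, h2⟩
    · exact ⟨0, by simp [h1], by simp [h2]⟩
    · exact ⟨1, by simp [h1], by simp [h2]⟩
  let y : M.Side := ⟨M.next x.1, M.inner_next.2 x.2⟩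
  have hy : M.next.SameCycle e.1 y.1 := by simpa [y] using hx
  have hr0 := r.2.1
  have hr1 := r.2.2
  by_cases h1 : U (M.org x.1) ∧ ¬ U (M.org (M.rev x.1))
  · have : x = d := Subtype.ext (R.exits_unique hU h1 hd (hx.symm.trans hed))
    subst this
    rw [sideLevel_injective (hd.desc hU).ne' (hxa.trans hrd.symm)]
    exact ⟨1, by simp, by simp⟩
  by_cases h2 : ¬ U (M.org x.1) ∧ U (M.org (M.rev x.1))
  · have : x = e := Subtype.ext (R.enters_unique hU ⟨h2.2, by rw [M.rev_rev]; exact h2.1⟩ he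
      hx.symm)
    subst this
    rw [sideLevel_injective ((M.desc_rev g x.1).1 (he.desc hU)).ne (hxa.trans hre.symm)]
    exact ⟨0, by simp, by simp⟩
  by_cases hr : r = 0
  · subst hr
    exact hcor x hx (by simpa using hxa)
  by_cases hr' : r = 1
  · subst hr'
    obtain ⟨t, ht1, ht2⟩ := hcor y hy (by rw [M.org_next]; simpa using hxa)
    exact ⟨t, by rw [sidePt_one, ← ht1], by rw [hB₁ x y rfl, ← ht2]⟩
  have hr0' : 0 < (r : ℝ) := lt_of_le_of_ne hr0 fun h => hr (Subtype.ext h.symm)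
  have hr1' : (r : ℝ) < 1 := lt_of_le_of_ne hr1 fun h => hr' (Subtype.ext h)
  -- Both ends of the side are in `U`, or both are outside it. Since an inner point of the side is
  -- at level `a`, the whole side is, and its two corners determine the rest.
  have hflat : g (M.org x.1) = a ∧ g (M.org (M.rev x.1)) = a := by
    simp only [sideLevel] at hxa
    by_cases hUx : U (M.org x.1)
    · have h3 : U (M.org (M.rev x.1)) := by tauto
      have l1 := hU.le _ hUx
      have l2 := hU.le _ h3
      constructor <;> nlinarith
    · have h3 : ¬ U (M.org (M.rev x.1)) := by tauto
      have l1 := hU.ge _ hUx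
      have l2 := hU.ge _ h3
      constructor <;> nlinarith
  obtain ⟨t, ht1, ht2⟩ := hcor x hx hflat.1
  obtain ⟨t', ht1', ht2'⟩ := hcor y hy (by rw [M.org_next]; exact hflat.2)
  have m1 := t.2.1
  have m2 := t.2.2
  have m3 := t'.2.1
  have m4 := t'.2.2
  refine ⟨⟨(1 - (r : ℝ)) * t + r * t', by nlinarith, by nlinarith⟩, ?_, ?_⟩
  · rw [sidePt_eq, ht1, ht1']
    module
  · rw [hB₂ x (hflat.1.trans hflat.2.symm), hB₁ x y rfl, ht2, ht2']
    ring

theorem chord_mem_seg (p : M.ChordPoint g) (hp : M.next.SameCycle e.1 p.e.1) (hpa : p.level = a) :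
    ∃ t : unitInterval,
    p.coord = (1 - (t : ℝ)) • M.sidePt e.1 re + (t : ℝ) • M.sidePt d.1 rd ∧
    p.val B = (1 - (t : ℝ)) * B e re + (t : ℝ) * B d rd := by
  obtain ⟨t, ht1, ht2⟩ := R.side_mem_seg hB₁ hB₂ hU hd he hed hre hrd hp hpa
  obtain ⟨t', ht1', ht2'⟩ := R.side_mem_seg hB₁ hB₂ hU hd he hed hre hrd (hp.trans p.same_cell)
    (p.same_level.symm.trans hpa)
  have m1 := t.2.1
  have m2 := t.2.2
  have m3 := t'.2.1
  have m4 := t'.2.2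
  have hr0 := p.s.2.1
  have hr1 := p.s.2.2
  refine ⟨⟨(1 - (p.s : ℝ)) * t + p.s * t', by nlinarith, by nlinarith⟩, ?_, ?_⟩
  · rw [ChordPoint.coord, ht1, ht1']
    module
  · rw [ChordPoint.val, ht2, ht2']
    ring

end Seg

omit [DecidableEq D] in
theorem exists_sides {d₀ : D} (hd₀ : M.Inner d₀) {r : unitInterval} {a : ℝ}
    (h : M.sideLevel g d₀ r = a) : ∃ U : V → Prop, M.IsCut g U a ∧ ∃ (e d : M.Side)
      (re rd : unitInterval), M.next.SameCycle e.1 d₀ ∧ M.next.SameCycle e.1 d.1 ∧ M.Exits U d.1 ∧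
      M.Exits U (M.rev e.1) ∧ M.sideLevel g e.1 re = a ∧ M.sideLevel g d.1 rd = a := by
  obtain ⟨U, hU, ⟨d, hd, hd'⟩, ⟨e, he, he'⟩⟩ := R.exists_isCut hd₀ h
  have hdd := hd'.desc hU
  have hee := (M.desc_rev g e).1 (he'.desc hU)
  obtain ⟨rd, hrd⟩ := exists_sideLevel_eq hdd (hU.ge _ hd'.2) (hU.le _ hd'.1)
  obtain ⟨re, hre⟩ := exists_sideLevel_eq_of_asc hee
    (by have := hU.ge _ he'.2; rwa [M.rev_rev] at this) (hU.le _ he'.1)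
  exact ⟨U, hU, ⟨e, R.inner_of_asc hee⟩, ⟨d, R.inner_of_desc hdd⟩, re, rd, he.symm,
    he.symm.trans hd, hd', he', hre, hrd⟩

/-- All chords of a cell at one level are parts of one segment, on which the value is affine in the
same parameter as the coordinates. If the segment is a point, then its two end values agree. Hence
the choice of a chord point in `sideExt` does not matter. -/
theorem val_eq_of_coord_eq (hB : M.IsSideFunction g S B) {p q : M.ChordPoint g}
    (h : p.coord = q.coord) : p.val B = q.val B := by
  have hc := ChordPoint.sameCycle_of_coord_eq h
  have hl : q.level = p.level := by
    rw [← q.linearExt_coord, ← p.linearExt_coord, h]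
  obtain ⟨U, hU, e, d, re, rd, hep, hed, hd, he, hre, hrd⟩ := R.exists_sides p.e.2
    (r := p.r) (a := p.level) rfl
  obtain ⟨t, ht1, ht2⟩ := R.chord_mem_seg hB.next hB.flat hU hd he hed hre hrd p hep rfl
  obtain ⟨t', ht1', ht2'⟩ := R.chord_mem_seg hB.next hB.flat hU hd he hed hre hrd q
    (hep.trans hc) hl
  rw [ht2, ht2']
  by_cases hne : M.sidePt e.1 re = M.sidePt d.1 rd
  · have : B e re = B d rd := by
      rcases e.2.sidePt_eq_sidePt d.2 hne with ⟨h1, rfl⟩ | ⟨rfl, rfl, h1⟩ | ⟨rfl, rfl, h1⟩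
      · rw [Subtype.ext h1]
      · exact hB.next _ _ h1.symm
      · exact (hB.next _ _ h1.symm).symm
    rw [this]
    ring
  · have : ((t : ℝ) - t') • (M.sidePt d.1 rd - M.sidePt e.1 re) = 0 := by
      have h0 := (ht1.symm.trans h).trans ht1'
      rw [← sub_eq_zero] at h0
      rw [← h0]
      module
    rcases smul_eq_zero.1 this with h1 | h1
    · rw [sub_eq_zero.1 h1]
    · exact absurd (sub_eq_zero.1 h1).symm hne

theorem val_eq_of_toQ_eq (hB : M.IsSideFunction g S B) {p q : M.ChordPoint g}
    (h : p.toQ S = q.toQ S) : p.val B = q.val B := by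
  let F : M.Cells g → ℝ := fun x => (Classical.choose x.2).val B
  have hF : ∀ p : M.ChordPoint g, F ⟨p.coord, p, rfl⟩ = p.val B := fun p =>
    R.val_eq_of_coord_eq hB
      (Classical.choose_spec (⟨p, rfl⟩ : p.coord ∈ M.Cells g))
  have hF' : ∀ (e : M.Side) (r : unitInterval) (x : M.Cells g), x.1 = M.sidePt e.1 r →
      F x = B e r := by
    intro e r x hx
    let p : M.ChordPoint g := ⟨e, e, Equiv.Perm.SameCycle.refl _ _, r, r, rfl, 0⟩
    have hp : p.coord = M.sidePt e.1 r := by simp [ChordPoint.coord, p]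
    have hx' : x = ⟨p.coord, p, rfl⟩ := Subtype.ext (hx.trans hp.symm)
    rw [hx', hF]
    simp [ChordPoint.val, p]
  have hglue : ∀ x y, M.Glue g S x y → F x = F y := by
    rintro x y ⟨d, hd, hd', hS, hS', r, hx, hy⟩
    rw [hF' ⟨d, hd⟩ r x hx, hF' ⟨M.rev d, hd'⟩ _ y hy]
    exact (hB.glue ⟨d, hd⟩ ⟨M.rev d, hd'⟩ rfl hS hS' r).symm
  have := congrArg (Quot.lift F hglue) h
  simpa [ChordPoint.toQ, hF] using this

theorem sideExt_toQ (hB : M.IsSideFunction g S B) (p : M.ChordPoint g) :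
    M.sideExt g S B (p.toQ S) = p.val B :=
  R.val_eq_of_toQ_eq hB (M.exists_chordPoint g S (p.toQ S)).choose_spec

theorem sideExt_pt (hB : M.IsSideFunction g S B) (e : M.Side) (r : unitInterval) :
    M.sideExt g S B (M.pt g S e r) = B e r := by
  rw [pt, R.sideExt_toQ hB]
  simp [ChordPoint.val]

omit R in
theorem gExt_pt (e : M.Side) (r : unitInterval) :
    M.gExt g S (M.pt g S e r) = M.sideLevel g e.1 r := by
  rw [pt, ChordPoint.gExt_toQ]
  rfl

end IsRegular

end AnnulusMap

/-! ### The topology of `QSlit`, and the level curves of `g` as simple arcs -/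

/-- A concatenation of segments, along which a function increases, is a simple arc. -/
theorem chain_arc {Z : Type*} (F : Z → ℝ) (m : ℕ) (z : ℕ → unitInterval → Z) (b : ℕ → ℝ)
    (hF : ∀ i < m, ∀ t : unitInterval, F (z i t) = (1 - (t : ℝ)) * b i + t * b (i + 1))
    (hz : ∀ i, i + 1 < m → z i 1 = z (i + 1) 0) (hle : ∀ i < m, b i ≤ b (i + 1))
    (hdeg : ∀ i < m, b i = b (i + 1) → ∀ t t', z i t = z i t') :
    (∀ i < m, ∀ j < m, ∀ t t', F (z i t) = F (z j t') → z i t = z j t') ∧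
    (∀ i < m, ∀ t, F (z i t) ∈ Set.Icc (b 0) (b m)) ∧
    (b 0 < b m → ∀ τ ∈ Set.Icc (b 0) (b m), ∃ i < m, b i < b (i + 1) ∧ ∃ t, F (z i t) = τ) := by
  have hmono : ∀ i l, i + l ≤ m → b i ≤ b (i + l) := by
    intro i l
    induction l with
    | zero => intro _; exact le_rfl
    | succ l ih => intro h; exact (ih (by omega)).trans (hle (i + l) (by omega))
  have hmono' : ∀ i j, i ≤ j → j ≤ m → b i ≤ b j := fun i j hij hj => by
    obtain ⟨l, rfl⟩ := Nat.exists_eq_add_of_le hij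
    exact hmono i l hj
  have hmem : ∀ i < m, ∀ t, F (z i t) ∈ Set.Icc (b i) (b (i + 1)) := by
    intro i hi t
    rw [hF i hi]
    have h0 := t.2.1
    have h1 := t.2.2
    have := hle i hi
    constructor <;> nlinarith
  -- Segments along which `b` does not increase are single points, so a run of them joins the end of
  -- one segment to the start of a later one.
  have hlink : ∀ i l, i + 1 + l < m → b (i + 1) = b (i + 1 + l) → z i 1 = z (i + 1 + l) 0 := by
    intro i l
    induction l with
    | zero => intro h _; exact hz i h
    | succ l ih =>
      intro h heq
      have h1 := hmono (i + 1) l (by omega)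
      have h2 := hle (i + 1 + l) (by omega)
      rw [← add_assoc] at heq
      have h3 : b (i + 1) = b (i + 1 + l) := by linarith
      rw [ih (by omega) h3, hdeg (i + 1 + l) (by omega) (by linarith) 0 1]
      exact hz _ h
  have hlt : ∀ i j, i < j → i < m → j < m → ∀ t t', F (z i t) = F (z j t') → z i t = z j t' := by
    intro i j hij hi hj t t' h
    have m1 := hmem i hi t
    have m2 := hmem j hj t'
    have m3 := hmono' (i + 1) j hij hj.le
    have e1 : z i t = z i 1 := by
      rcases (hle i hi).eq_or_lt with h1 | h1
      · exact hdeg i hi h1 _ _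
      · have h2 : F (z i t) = b (i + 1) := le_antisymm m1.2 (by linarith [m2.1])
        rw [hF i hi] at h2
        have h3 : (1 - (t : ℝ)) * (b (i + 1) - b i) = 0 := by linarith
        rcases mul_eq_zero.1 h3 with h4 | h4
        · rw [show t = 1 from Subtype.ext (by push_cast; linarith)]
        · linarith
    have e2 : z j t' = z j 0 := by
      rcases (hle j hj).eq_or_lt with h1 | h1
      · exact hdeg j hj h1 _ _
      · have h2 : F (z j t') = b j := le_antisymm (by linarith [m1.2]) m2.1
        rw [hF j hj] at h2
        have h3 : (t' : ℝ) * (b (j + 1) - b j) = 0 := by linarith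
        rcases mul_eq_zero.1 h3 with h4 | h4
        · rw [show t' = 0 from Subtype.ext (by push_cast; linarith)]
        · linarith
    obtain ⟨l, rfl⟩ := Nat.exists_eq_add_of_le hij
    rw [e1, e2]
    exact hlink i l hj (le_antisymm m3 (by linarith [m1.2, m2.1]))
  refine ⟨?_, ?_, ?_⟩
  · intro i hi j hj t t' h
    rcases lt_trichotomy i j with hij | rfl | hij
    · exact hlt i j hij hi hj t t' h
    · rcases (hle i hi).eq_or_lt with h1 | h1
      · exact hdeg i hi h1 _ _
      · rw [hF i hi, hF i hi] at h
        have h3 : ((t : ℝ) - t') * (b (i + 1) - b i) = 0 := by linarith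
        rcases mul_eq_zero.1 h3 with h4 | h4
        · rw [show t = t' from Subtype.ext (by linarith)]
        · linarith
    · exact (hlt j i hij hj hi t' t h.symm).symm
  · intro i hi t
    have m1 := hmem i hi t
    exact ⟨(hmono' 0 i (Nat.zero_le _) hi.le).trans m1.1, m1.2.trans (hmono' (i + 1) m hi le_rfl)⟩
  · intro hb τ hτ
    have hex : ∃ i < m, b i < b (i + 1) ∧ b i ≤ τ ∧ τ ≤ b (i + 1) := by
      rcases hτ.1.eq_or_lt with h | h
      · by_contra! hcon
        have : ∀ i ≤ m, b i = b 0 := by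
          intro i
          induction i with
          | zero => intro _; rfl
          | succ i ih =>
            intro hi
            have h1 := ih (by omega)
            rcases (hle i (by omega)).eq_or_lt with h2 | h2
            · rw [← h2, h1]
            · have := hcon i (by omega) h2 (by linarith)
              linarith
        have := this m le_rfl
        linarith
      · by_contra! hcon
        have : ∀ i ≤ m, b i < τ := by
          intro i
          induction i with
          | zero => intro _; exact h
          | succ i ih =>
            intro hi
            have h1 := ih (by omega)
            rcases (hle i (by omega)).eq_or_lt with h2 | h2
            · rw [← h2]; exact h1
            · exact hcon i (by omega) h2 h1.le
        exact absurd hτ.2 (not_le.2 (this m le_rfl))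
    obtain ⟨i, hi, h1, h2, h3⟩ := hex
    have hpos : 0 < b (i + 1) - b i := sub_pos.2 h1
    refine ⟨i, hi, h1, ⟨(τ - b i) / (b (i + 1) - b i), div_nonneg (by linarith) hpos.le,
      (div_le_one hpos).2 (by linarith)⟩, ?_⟩
    rw [hF i hi]
    push_cast
    field_simp
    ring

namespace AnnulusMap

variable {D V : Type*} [Fintype D] [Fintype V] [DecidableEq D]

section Topology

variable {M : AnnulusMap D V} {g : V → ℝ} {S : Set D}

/-- The chord points with given sides, as a topological space. -/
abbrev ChordSpace (M : AnnulusMap D V) (g : V → ℝ) : Type _ :=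
  Σ ee : {ee : M.Side × M.Side // M.next.SameCycle ee.1.1 ee.2.1},
    {q : unitInterval × unitInterval × unitInterval //
      M.sideLevel g ee.1.1.1 q.1 = M.sideLevel g ee.1.2.1 q.2.1}

/-- The chord point with given parameters. -/
def ChordSpace.toChord (x : M.ChordSpace g) : M.ChordPoint g :=
  ⟨x.1.1.1, x.1.1.2, x.1.2, x.2.1.1, x.2.1.2.1, x.2.2, x.2.1.2.2⟩

omit [DecidableEq D] in
theorem ChordSpace.toChord_surjective :
    Function.Surjective (ChordSpace.toChord : M.ChordSpace g → M.ChordPoint g) := by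
  rintro ⟨e, e', h, r, r', h', s⟩
  exact ⟨⟨⟨(e, e'), h⟩, ⟨(r, r', s), h'⟩⟩, rfl⟩

/-- The point of a two-cell with given parameters. -/
noncomputable def ChordSpace.toCell (x : M.ChordSpace g) : M.Cells g :=
  ⟨x.toChord.coord, x.toChord, rfl⟩

instance : CompactSpace (M.ChordSpace g) := by
  have : ∀ ee : {ee : M.Side × M.Side // M.next.SameCycle ee.1.1 ee.2.1},
      CompactSpace {q : unitInterval × unitInterval × unitInterval //
        M.sideLevel g ee.1.1.1 q.1 = M.sideLevel g ee.1.2.1 q.2.1} := fun ee =>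
    isCompact_iff_compactSpace.1 (IsClosed.isCompact (isClosed_eq
      ((sideLevel_continuous _).comp continuous_fst)
      ((sideLevel_continuous _).comp (continuous_fst.comp continuous_snd))))
  infer_instance

theorem ChordSpace.continuous_toCell :
    Continuous (ChordSpace.toCell : M.ChordSpace g → M.Cells g) := by
  refine Continuous.subtype_mk (continuous_sigma fun ee => ?_) _
  simp only [toChord, ChordPoint.coord, sidePt]
  fun_prop

/-- The compact parameter space maps onto the Hausdorff union of the cells by a closed map, and
gluing is a quotient map by definition. Continuity on `QSlit` can therefore be checked in the
parameters of chord points. -/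
theorem ChordSpace.isQuotientMap :
    Topology.IsQuotientMap (fun x : M.ChordSpace g => x.toChord.toQ S) := by
  have h1 : Topology.IsQuotientMap (ChordSpace.toCell : M.ChordSpace g → M.Cells g) := by
    refine IsClosedMap.isQuotientMap continuous_toCell.isClosedMap continuous_toCell ?_
    rintro ⟨_, p, rfl⟩
    obtain ⟨x, rfl⟩ := toChord_surjective p
    exact ⟨x, rfl⟩
  exact (isQuotientMap_quot_mk (r := M.Glue g S)).comp h1

instance : CompactSpace (M.QSlit g S) :=
  (ChordSpace.isQuotientMap (M := M) (g := g) (S := S)).surjective.compactSpace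
    ChordSpace.isQuotientMap.continuous

theorem continuous_gExt : Continuous (M.gExt g S) := by
  rw [ChordSpace.isQuotientMap.continuous_iff]
  refine continuous_sigma fun ee => ?_
  simp only [Function.comp_def, ChordPoint.gExt_toQ, ChordPoint.level, ChordSpace.toChord]
  exact (sideLevel_continuous _).comp (continuous_fst.comp continuous_subtype_val)

theorem IsRegular.continuous_sideExt {c : D → ℝ} {k : ℝ} (R : M.IsRegular c k g)
    {B : M.Side → unitInterval → ℝ} (hB : M.IsSideFunction g S B) :
    Continuous (M.sideExt g S B) := by
  rw [ChordSpace.isQuotientMap.continuous_iff]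
  refine continuous_sigma fun ee => ?_
  simp only [Function.comp_def, R.sideExt_toQ hB, ChordPoint.val, ChordSpace.toChord]
  have h1 := (hB.cont ee.1.1).comp (continuous_fst.comp (continuous_subtype_val
    (p := fun q : unitInterval × unitInterval × unitInterval =>
      M.sideLevel g ee.1.1.1 q.1 = M.sideLevel g ee.1.2.1 q.2.1)))
  have h2 := (hB.cont ee.1.2).comp (continuous_fst.comp (continuous_snd.comp
    (continuous_subtype_val
    (p := fun q : unitInterval × unitInterval × unitInterval =>
      M.sideLevel g ee.1.1.1 q.1 = M.sideLevel g ee.1.2.1 q.2.1))))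
  have h3 : Continuous fun q : {q : unitInterval × unitInterval × unitInterval //
      M.sideLevel g ee.1.1.1 q.1 = M.sideLevel g ee.1.2.1 q.2.1} => (q.1.2.2 : ℝ) :=
    continuous_subtype_val.comp (continuous_snd.comp (continuous_snd.comp continuous_subtype_val))
  exact ((continuous_const.sub h3).mul h1).add (h3.mul h2)

end Topology

/-- A chord that joins the side that enters `U` to the side that leaves `U`. -/
structure ChordPoint.IsSeg {M : AnnulusMap D V} {g : V → ℝ} (p : M.ChordPoint g) (U : V → Prop)
    (a : ℝ) : Prop where
  enters : M.Exits U (M.rev p.e.1)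
  exits : M.Exits U p.e'.1
  level_eq : p.level = a

/-- The two ends of the chord are the same. -/
def ChordPoint.Degenerate {M : AnnulusMap D V} {g : V → ℝ} (p : M.ChordPoint g) : Prop :=
  M.sidePt p.e.1 p.r = M.sidePt p.e'.1 p.r'

theorem toQ_eq_of_coord_eq {M : AnnulusMap D V} {g : V → ℝ} {S : Set D} {p q : M.ChordPoint g}
    (h : p.coord = q.coord) : p.toQ S = q.toQ S :=
  congrArg (Quot.mk _) (Subtype.ext h)

namespace IsRegular

variable {M : AnnulusMap D V} {c : D → ℝ} {k : ℝ} {g : V → ℝ} (R : M.IsRegular c k g)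
include R

section Flat

variable {U : V → Prop} {a : ℝ} (hU : M.IsCut g U a) {p : M.ChordPoint g} (hp : p.IsSeg U a)
  (hdeg : ¬ p.Degenerate)
include hU hp hdeg

/-- If the cell lies below the level, both ends of the segment are corners in `U` at level `a`. They
are distinct, and by `eq_or_eq_of_mem` no further corner fits between them within `U`, so the
segment is a whole side. -/
theorem exists_flat_of_le (hle : ∀ x, M.next.SameCycle p.e.1 x → g (M.org x) ≤ a) :
    ∃ f : M.Side, g (M.org f.1) = a ∧ g (M.org (M.rev f.1)) = a ∧
      p.coord = M.sidePt f.1 p.s := by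
  have hdd := hp.exits.desc hU
  have hee := (M.desc_rev g p.e.1).1 (hp.enters.desc hU)
  have hod : g (M.org p.e'.1) = a := le_antisymm (hle _ p.same_cell) (hU.le _ hp.exits.1)
  have hoe : g (M.org (M.next p.e.1)) = a :=
    le_antisymm (hle _ (by simp)) (hU.le _ (by rw [M.org_next]; exact hp.enters.1))
  have hr : p.r = 1 := sideLevel_injective hee.ne
    (by rw [sideLevel_one, ← M.org_next, hoe]; exact hp.level_eq)
  have hr' : p.r' = 0 := sideLevel_injective hdd.ne'
    (by rw [sideLevel_zero, hod, ← p.same_level]; exact hp.level_eq)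
  have hne : M.next p.e.1 ≠ p.e'.1 := by
    intro h
    apply hdeg
    rw [ChordPoint.Degenerate, hr, hr', sidePt_one, h]
  have hUn : U (M.org (M.next (M.next p.e.1))) := by
    by_contra h
    refine hne (R.exits_unique hU ⟨by rw [M.org_next]; exact hp.enters.1, by rwa [← M.org_next]⟩
      hp.exits ?_)
    simpa using p.same_cell
  have hn : g (M.org (M.next (M.next p.e.1))) = a := le_antisymm (hle _ (by simp)) (hU.le _ hUn)
  have hx : M.next (M.next p.e.1) = p.e'.1 := by
    rcases R.eq_or_eq_of_mem hU hp.exits hp.enters p.same_cell (x := M.next (M.next p.e.1))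
      (by simp) hn hUn with h | h
    · exact h
    · exact absurd (M.next.injective h).symm p.e.2.cycle.2.1
  refine ⟨⟨M.next p.e.1, M.inner_next.2 p.e.2⟩, hoe, by rwa [← M.org_next], ?_⟩
  rw [ChordPoint.coord, hr, hr', sidePt_one, sidePt_eq M (M.next p.e.1) p.s, hx]

theorem exists_flat_of_ge (hge : ∀ x, M.next.SameCycle p.e.1 x → a ≤ g (M.org x)) :
    ∃ f : M.Side, g (M.org f.1) = a ∧ g (M.org (M.rev f.1)) = a ∧
      p.coord = M.sidePt f.1 (unitInterval.symm p.s) := by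
  have hdd := hp.exits.desc hU
  have hee := (M.desc_rev g p.e.1).1 (hp.enters.desc hU)
  have hed := p.same_cell
  have hUe : ¬ U (M.org p.e.1) := by have := hp.enters.2; rwa [M.rev_rev] at this
  have hoe : g (M.org p.e.1) = a := le_antisymm (hU.ge _ hUe) (hge _ (by simp))
  have hUd : ¬ U (M.org (M.next p.e'.1)) := by rw [M.org_next]; exact hp.exits.2
  have hod : g (M.org (M.next p.e'.1)) = a :=
    le_antisymm (hU.ge _ hUd) (hge _ (by simpa using hed))
  have hr : p.r = 0 := sideLevel_injective hee.ne
    (by rw [sideLevel_zero, hoe]; exact hp.level_eq)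
  have hr' : p.r' = 1 := sideLevel_injective hdd.ne'
    (by rw [sideLevel_one, ← M.org_next, hod, ← p.same_level]; exact hp.level_eq)
  have hne : M.next p.e'.1 ≠ p.e.1 := by
    intro h
    apply hdeg
    rw [ChordPoint.Degenerate, hr, hr', sidePt_one, h]
  have hUn : ¬ U (M.org (M.next (M.next p.e'.1))) := by
    intro h
    refine hne (R.enters_unique hU ⟨by rwa [← M.org_next], by rwa [M.rev_rev]⟩
      hp.enters ?_)
    simpa using hed.symm
  have hn : g (M.org (M.next (M.next p.e'.1))) = a :=
    le_antisymm (hU.ge _ hUn) (hge _ (by simpa using hed))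
  have hx : M.next (M.next p.e'.1) = p.e.1 := by
    rcases R.eq_or_eq_of_notMem hU hp.exits hp.enters hed (x := M.next (M.next p.e'.1))
      (by simpa using hed) hn hUn with h | h
    · exact h
    · exact absurd (M.next.injective h).symm p.e'.2.cycle.2.1
  refine ⟨⟨M.next p.e'.1, M.inner_next.2 p.e'.2⟩, hod, by rwa [← M.org_next], ?_⟩
  rw [ChordPoint.coord, hr, hr', sidePt_one, sidePt_eq M (M.next p.e'.1)
    (unitInterval.symm p.s), hx, unitInterval.coe_symm_eq]
  module

/-- A nondegenerate segment of a level curve is crossed by all cuts at this level. -/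
theorem exists_cross {U' : V → Prop} (hU' : M.IsCut g U' a) :
    (∃ d, M.next.SameCycle p.e.1 d ∧ M.Exits U' d) ∧
      ∃ e, M.next.SameCycle p.e.1 e ∧ M.Exits U' (M.rev e) := by
  suffices h : ∃ x y, M.next.SameCycle p.e.1 x ∧ M.next.SameCycle p.e.1 y ∧ U' (M.org x) ∧
      ¬ U' (M.org y) by
    obtain ⟨x, y, hx, hy, hxU, hyU⟩ := h
    obtain ⟨⟨d, hd, hd'⟩, ⟨e, he, he'⟩⟩ := exists_exits (hx.symm.trans hy) hxU hyU
    exact ⟨⟨d, hx.trans hd, hd'⟩, ⟨e, hx.trans he, he'⟩⟩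
  have hc : M.next.SameCycle p.e.1 (M.next p.e'.1) := by simpa using p.same_cell
  have hflat : ∀ f, g (M.org f) = a → g (M.org (M.rev f)) = a → a = k ∨ a = 0 := by
    intro f h1 h2
    rcases R.flat f (h1.trans h2.symm) with h | h
    · exact Or.inl (h1.symm.trans (R.mem_E₁_iff.1 h.1))
    · exact Or.inr (h1.symm.trans (R.mem_E₂_iff.1 h.1))
  -- At the extreme levels there is only one cut: `U` is E₁ for a = k and the complement of E₂ for a
  -- = 0. At the other levels `g` is not constant at level `a` on any side, so the cell has corners
  -- strictly above and strictly below `a`.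
  by_cases hak : a = k
  · refine ⟨p.e'.1, M.next p.e'.1, p.same_cell, hc, hU'.on_E₁ _ (R.mem_E₁_iff.2
      (le_antisymm (R.le_k _) (hak ▸ hU.le _ hp.exits.1))), fun h => hp.exits.2 (hU.on_E₁ _ ?_)⟩
    rw [M.org_next] at h
    exact R.mem_E₁_iff.2 (le_antisymm (R.le_k _) (hak ▸ hU'.le _ h))
  by_cases ha0 : a = 0
  · refine ⟨p.e'.1, M.next p.e'.1, p.same_cell, hc, ?_, hU'.on_E₂ _ (R.mem_E₂_iff.2
      (le_antisymm ?_ (R.nonneg _)))⟩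
    · by_contra h
      exact hU.on_E₂ _ (R.mem_E₂_iff.2 (le_antisymm (ha0 ▸ hU'.ge _ h) (R.nonneg _))) hp.exits.1
    · rw [M.org_next, ← ha0]
      exact hU.ge _ hp.exits.2
  obtain ⟨x, hx, hxa⟩ : ∃ x, M.next.SameCycle p.e.1 x ∧ a < g (M.org x) := by
    by_contra! hcon
    obtain ⟨f, h1, h2, -⟩ := R.exists_flat_of_le hU hp hdeg hcon
    exact (hflat f.1 h1 h2).elim hak ha0
  obtain ⟨y, hy, hya⟩ : ∃ y, M.next.SameCycle p.e.1 y ∧ g (M.org y) < a := by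
    by_contra! hcon
    obtain ⟨f, h1, h2, -⟩ := R.exists_flat_of_ge hU hp hdeg hcon
    exact (hflat f.1 h1 h2).elim hak ha0
  exact ⟨x, y, hx, hy, by_contra fun h => (hU'.ge _ h).not_gt hxa, fun h => (hU'.le _ h).not_gt hya⟩

end Flat

section Level

variable {n : ℕ} {s : Fin (n + 1) → D} (hs : M.IsSlit g s) {B : M.Side → unitInterval → ℝ}
  (hB : M.IsSideFunction g (Set.range s) B)
include hs hB

omit R hs in
theorem eq_of_sidePt_eq (e d : M.Side) {r r' : unitInterval}
    (h : M.sidePt e.1 r = M.sidePt d.1 r') : B e r = B d r' := by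
  rcases e.2.sidePt_eq_sidePt d.2 h with ⟨h1, rfl⟩ | ⟨rfl, rfl, h1⟩ | ⟨rfl, rfl, h1⟩
  · rw [Subtype.ext h1]
  · exact hB.next _ _ h1.symm
  · exact (hB.next _ _ h1.symm).symm

/-- The segments of a level curve of `g` form a simple arc. -/
theorem seg_arc {U : V → Prop} {a : ℝ} (hU : M.IsCut g U a) {e₀ e₁ : M.Side}
    (he₀ : e₀.1 ∈ Set.range s) (he₁ : e₁.1 = M.rev e₀.1) (heU : M.Exits U e₀.1)
    {r₀ : unitInterval} (hr₀ : M.sideLevel g e₀.1 r₀ = a) :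
    (∀ p q : M.ChordPoint g, p.IsSeg U a → q.IsSeg U a → p.val B = q.val B →
      p.toQ (Set.range s) = q.toQ (Set.range s)) ∧
    (∀ p : M.ChordPoint g, p.IsSeg U a →
      p.val B ∈ Set.Icc (B e₁ (unitInterval.symm r₀)) (B e₀ r₀)) ∧
    (∀ τ ∈ Set.Icc (B e₁ (unitInterval.symm r₀)) (B e₀ r₀), ∃ p : M.ChordPoint g, p.IsSeg U a ∧
      ¬ p.Degenerate ∧ p.val B = τ) := by
  obtain ⟨m, d, hm, hdU, hd0, hdm, hdi, hcyc, hall⟩ := R.exists_chain hs hU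
  have hdesc : ∀ i, M.Desc g (d i) := fun i => (hdU i).desc hU
  let Dn : ℕ → M.Side := fun i => ⟨d i, R.inner_of_desc (hdesc i)⟩
  let En : ℕ → M.Side := fun i => ⟨M.rev (d i), R.inner_rev_of_desc (hdesc i)⟩
  have hr : ∀ i, ∃ r, M.sideLevel g (d i) r = a := fun i =>
    exists_sideLevel_eq (hdesc i) (hU.ge _ (hdU i).2) (hU.le _ (hdU i).1)
  choose r hr using hr
  let P : ℕ → unitInterval → M.ChordPoint g := fun i t =>
    ⟨En i, Dn (i + 1), hcyc i, unitInterval.symm (r i), r (i + 1),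
      (sideLevel_rev _ _).trans ((hr i).trans (hr (i + 1)).symm), t⟩
  have hP : ∀ i t, (P i t).IsSeg U a := fun i t =>
    ⟨by simpa only [P, En, M.rev_rev] using hdU i, hdU (i + 1), (sideLevel_rev _ _).trans (hr i)⟩
  -- The first and the last dart of the chain are the same dart of the slit. The value at index 0 is
  -- taken on its base copy, that is, on the reversed side, and the value at `m` on its top copy.
  let b : ℕ → ℝ := fun i => if i = 0 then B (En 0) (unitInterval.symm (r 0)) else B (Dn i) (r i)
  have hbE : ∀ i < m, B (En i) (unitInterval.symm (r i)) = b i := by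
    intro i hi
    by_cases h0 : i = 0
    · subst h0; simp [b]
    · simp only [b, if_neg h0]
      refine hB.glue (Dn i) (En i) rfl (hdi i (Nat.pos_of_ne_zero h0) hi) ?_ _
      exact fun h' => ((M.desc_rev g _).1 (hs.desc h')).not_desc (hdesc i)
  have hbD : ∀ i, B (Dn (i + 1)) (r (i + 1)) = b (i + 1) := fun i => by simp [b]
  have hval : ∀ i < m, ∀ t : unitInterval,
      (P i t).val B = (1 - (t : ℝ)) * b i + t * b (i + 1) := by
    intro i hi t
    rw [← hbE i hi, ← hbD i]
    rfl
  have hlt : ∀ i < m, ∀ t, ¬ (P i t).Degenerate → b i < b (i + 1) := by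
    intro i hi t hdeg
    rw [← hbE i hi, ← hbD i]
    exact hB.lt (En i) (Dn (i + 1)) (hcyc i) ((M.asc_rev g _).2 (hdesc i)) (hdesc (i + 1)) _ _
      (P i t).same_level hdeg
  have heq : ∀ i < m, ∀ t, (P i t).Degenerate → b i = b (i + 1) := by
    intro i hi t hdeg
    rw [← hbE i hi, ← hbD i]
    exact eq_of_sidePt_eq hB _ _ hdeg
  have harc := chain_arc (M.sideExt g (Set.range s) B) m
    (fun i t => (P i t).toQ (Set.range s)) b
    (fun i hi t => by rw [R.sideExt_toQ hB, hval i hi])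
    (by
      intro i hi
      refine Quot.sound ⟨d (i + 1), (Dn (i + 1)).2, (En (i + 1)).2,
        hdi (i + 1) (Nat.succ_pos _) hi, fun h' =>
          ((M.desc_rev g _).1 (hs.desc h')).not_desc (hdesc (i + 1)), r (i + 1), ?_, ?_⟩
      · simp [P, ChordPoint.coord, Dn]
      · simp [P, ChordPoint.coord, En])
    (by
      intro i hi
      by_cases h : (P i 0).Degenerate
      · exact (heq i hi 0 h).le
      · exact (hlt i hi 0 h).le)
    (by
      intro i hi h t t'
      by_cases hdeg : (P i 0).Degenerate
      · apply toQ_eq_of_coord_eq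
        have hdeg' : M.sidePt (En i).1 (unitInterval.symm (r i)) =
          M.sidePt (Dn (i + 1)).1 (r (i + 1)) := hdeg
        simp only [ChordPoint.coord, P, hdeg']
        module
      · exact absurd h (hlt i hi 0 hdeg).ne)
  have hd0' : d 0 = e₀.1 := hs.exits_unique hU hd0 he₀ (hdU 0) heU
  have hdm' : d m = e₀.1 := hs.exits_unique hU hdm he₀ (hdU m) heU
  have hrr : ∀ i, d i = e₀.1 → r i = r₀ := fun i hi =>
    sideLevel_injective (hdesc i).ne' (by rw [hr, hi, hr₀])
  have hb0 : b 0 = B e₁ (unitInterval.symm r₀) := by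
    rw [← hbE 0 hm, hrr 0 hd0', show En 0 = e₁ from Subtype.ext (by rw [he₁, ← hd0'])]
  have hbm : b m = B e₀ r₀ := by
    obtain ⟨l, rfl⟩ := Nat.exists_eq_add_of_lt hm
    rw [zero_add] at *
    rw [← hbD l, hrr _ hdm', show Dn (l + 1) = e₀ from Subtype.ext hdm']
  -- The chain lists every dart that leaves `U`, and such a dart determines the entering side of its
  -- cell; the levels then fix the two ends.
  have hex : ∀ p : M.ChordPoint g, p.IsSeg U a → ∃ i < m, p = P i p.s := by
    rintro ⟨e, e', hc, re, re', hl, t⟩ ⟨h1, h2, h3⟩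
    obtain ⟨i, hi, hi'⟩ := hall e'.1 h2
    have he' : e' = Dn (i + 1) := Subtype.ext hi'
    subst he'
    have he : e = En i := Subtype.ext (R.enters_unique hU h1
      (by simpa only [En, M.rev_rev] using hdU i) (hc.trans (hcyc i).symm))
    subst he
    have e1 : re = unitInterval.symm (r i) := sideLevel_injective (d := (En i).1)
      ((M.asc_rev g _).2 (hdesc i)).ne (h3.trans ((sideLevel_rev _ _).trans (hr i)).symm)
    subst e1
    have e2 : re' = r (i + 1) := sideLevel_injective (hdesc (i + 1)).ne'
      ((hl.symm.trans h3).trans (hr (i + 1)).symm)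
    subst e2
    exact ⟨i, hi, rfl⟩
  rw [← hb0, ← hbm]
  have hb : b 0 < b m := by
    rw [hb0, hbm]
    exact hB.jump e₀ e₁ he₁ he₀ r₀
  obtain ⟨a1, a2, a3⟩ := harc
  refine ⟨?_, ?_, ?_⟩
  · intro p q hp hq h
    obtain ⟨i, hi, hi'⟩ := hex p hp
    obtain ⟨j, hj, hj'⟩ := hex q hq
    have := a1 i hi j hj p.s q.s (by
      rw [R.sideExt_toQ hB, R.sideExt_toQ hB, ← hi', ← hj', h])
    simpa only [← hi', ← hj'] using this
  · intro p hp
    obtain ⟨i, hi, hi'⟩ := hex p hp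
    have := a2 i hi p.s
    rwa [R.sideExt_toQ hB, ← hi'] at this
  · intro τ hτ
    obtain ⟨i, hi, hlt', t, ht⟩ := a3 hb τ hτ
    rw [R.sideExt_toQ hB] at ht
    exact ⟨P i t, hP i t, fun hdeg => hlt'.ne (heq i hi t hdeg), ht⟩

omit hs in
theorem exists_isSeg_of_cross {U : V → Prop} {a : ℝ} (hU : M.IsCut g U a) (p : M.ChordPoint g)
    (hp : p.level = a) (h : (∃ d, M.next.SameCycle p.e.1 d ∧ M.Exits U d) ∧
      ∃ e, M.next.SameCycle p.e.1 e ∧ M.Exits U (M.rev e)) :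
    ∃ q : M.ChordPoint g, q.IsSeg U a ∧ q.coord = p.coord := by
  obtain ⟨⟨d, hd, hd'⟩, ⟨e, he, he'⟩⟩ := h
  have hdd := hd'.desc hU
  have hee := (M.desc_rev g e).1 (he'.desc hU)
  obtain ⟨rd, hrd⟩ := exists_sideLevel_eq hdd (hU.ge _ hd'.2) (hU.le _ hd'.1)
  obtain ⟨re, hre⟩ := exists_sideLevel_eq_of_asc hee
    (by have := hU.ge _ he'.2; rwa [M.rev_rev] at this) (hU.le _ he'.1)
  obtain ⟨t, ht, -⟩ := R.chord_mem_seg hB.next hB.flat hU (d := ⟨d, R.inner_of_desc hdd⟩)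
    (e := ⟨e, R.inner_of_asc hee⟩) hd' he' (he.symm.trans hd) hre hrd p he.symm hp
  exact ⟨⟨⟨e, R.inner_of_asc hee⟩, ⟨d, R.inner_of_desc hdd⟩, he.symm.trans hd, re, rd,
    hre.trans hrd.symm, t⟩, ⟨he', hd', hre⟩, ht.symm⟩

omit [DecidableEq D] hB in
theorem exists_slit_side {U : V → Prop} {a : ℝ} (hU : M.IsCut g U a) : ∃ (e₀ e₁ : M.Side)
    (r₀ : unitInterval), e₀.1 ∈ Set.range s ∧ e₁.1 = M.rev e₀.1 ∧ M.Exits U e₀.1 ∧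
      M.sideLevel g e₀.1 r₀ = a := by
  obtain ⟨d, hd, hdU⟩ := hs.exists_exits hU
  have hdd := hdU.desc hU
  obtain ⟨r, hr⟩ := exists_sideLevel_eq hdd (hU.ge _ hdU.2) (hU.le _ hdU.1)
  exact ⟨⟨d, R.inner_of_desc hdd⟩, ⟨M.rev d, R.inner_rev_of_desc hdd⟩, r, hd, rfl, hdU, hr⟩

/-- Every point of a level curve of `g` is on a nondegenerate segment. -/
theorem exists_nondegenerate (p : M.ChordPoint g) : ∃ (U : V → Prop) (q : M.ChordPoint g),
    M.IsCut g U p.level ∧ q.IsSeg U p.level ∧ ¬ q.Degenerate ∧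
      q.toQ (Set.range s) = p.toQ (Set.range s) := by
  obtain ⟨U, hU, hc⟩ := R.exists_isCut p.e.2 (r := p.r) (a := p.level) rfl
  obtain ⟨q, hq, hqp⟩ := R.exists_isSeg_of_cross hB hU p rfl hc
  obtain ⟨e₀, e₁, r₀, h1, h2, h3, h4⟩ := R.exists_slit_side hs hU
  obtain ⟨a1, a2, a3⟩ := R.seg_arc hs hB hU h1 h2 h3 h4
  -- The segment of `q` may be a point, but the same value is also taken on a nondegenerate segment,
  -- and equal values on the arc mean equal points.
  obtain ⟨q', hq', hdeg, hv⟩ := a3 _ (a2 q hq)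
  exact ⟨U, q', hU, hq', hdeg, (a1 _ _ hq' hq hv).trans (toQ_eq_of_coord_eq hqp)⟩

/-- Different cuts at one level differ in their degenerate segments only: by `exists_cross`, each of
them crosses every cell that contains a nondegenerate segment. So the arc of any one cut is the
whole level curve. -/
theorem exists_isSeg {U : V → Prop} {a : ℝ} (hU : M.IsCut g U a) (p : M.ChordPoint g)
    (hp : p.level = a) : ∃ q : M.ChordPoint g, q.IsSeg U a ∧ ¬ q.Degenerate ∧
      q.toQ (Set.range s) = p.toQ (Set.range s) := by
  obtain ⟨U', q, hU', hq, hdeg, hqp⟩ := R.exists_nondegenerate hs hB p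
  rw [hp] at hU' hq
  obtain ⟨q', hq', hqq'⟩ := R.exists_isSeg_of_cross hB hU q hq.level_eq
    (R.exists_cross hU' hq hdeg hU)
  obtain ⟨e₀, e₁, r₀, h1, h2, h3, h4⟩ := R.exists_slit_side hs hU
  obtain ⟨a1, a2, a3⟩ := R.seg_arc hs hB hU h1 h2 h3 h4
  obtain ⟨q'', hq'', hdeg'', hv⟩ := a3 _ (a2 q' hq')
  exact ⟨q'', hq'', hdeg'', (a1 _ _ hq'' hq' hv).trans ((toQ_eq_of_coord_eq hqq').trans hqp)⟩

/-- The level of `g` and the value of a side function determine a point of `Q_slit`. -/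
theorem eq_of_gExt_eq_of_sideExt_eq {z w : M.QSlit g (Set.range s)}
    (h : M.gExt g _ z = M.gExt g _ w) (h' : M.sideExt g _ B z = M.sideExt g _ B w) : z = w := by
  obtain ⟨p, rfl⟩ := M.exists_chordPoint g _ z
  obtain ⟨q, rfl⟩ := M.exists_chordPoint g _ w
  rw [ChordPoint.gExt_toQ, ChordPoint.gExt_toQ] at h
  obtain ⟨U, hU, -⟩ := R.exists_isCut p.e.2 (r := p.r) (a := p.level) rfl
  obtain ⟨p', hp', -, hpp'⟩ := R.exists_isSeg hs hB hU p rfl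
  obtain ⟨q', hq', -, hqq'⟩ := R.exists_isSeg hs hB hU q h.symm
  obtain ⟨e₀, e₁, r₀, h1, h2, h3, h4⟩ := R.exists_slit_side hs hU
  obtain ⟨a1, -⟩ := R.seg_arc hs hB hU h1 h2 h3 h4
  rw [← hpp', ← hqq', R.sideExt_toQ hB, R.sideExt_toQ hB] at h'
  rw [← hpp', ← hqq']
  exact a1 _ _ hp' hq' h'

/-- The values of a side function on a level curve of `g`. -/
theorem sideExt_level {e₀ e₁ : M.Side} (he₀ : e₀.1 ∈ Set.range s) (he₁ : e₁.1 = M.rev e₀.1)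
    {r₀ : unitInterval} {a : ℝ} (hr₀ : M.sideLevel g e₀.1 r₀ = a) :
    (∀ z, M.gExt g _ z = a →
      M.sideExt g (Set.range s) B z ∈ Set.Icc (B e₁ (unitInterval.symm r₀)) (B e₀ r₀)) ∧
    ∀ τ ∈ Set.Icc (B e₁ (unitInterval.symm r₀)) (B e₀ r₀),
      ∃ z, M.gExt g _ z = a ∧ M.sideExt g (Set.range s) B z = τ := by
  have hdesc := hs.desc he₀
  have hr0 := r₀.2.1
  have hr1 := r₀.2.2
  -- The level may pass through an end of `e₀`. The choice between {a ≤ g} and {a < g} is made so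
  -- that `e₀` is the dart of the slit that leaves the cut.
  obtain ⟨U, hU, hUe⟩ : ∃ U, M.IsCut g U a ∧ M.Exits U e₀.1 := by
    have hl := hr₀
    have hd : g (M.org (M.rev e₀.1)) < g (M.org e₀.1) := hdesc
    simp only [sideLevel] at hl
    rcases lt_or_ge (g (M.org (M.rev e₀.1))) a with h | h
    · have h2 : a ≤ g (M.org e₀.1) := by nlinarith
      exact ⟨_, R.isCut_ge ((R.nonneg _).trans_lt h) (h2.trans (R.le_k _)), h2, not_le.2 h⟩
    · have h4 : g (M.org (M.rev e₀.1)) ≤ a := by nlinarith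
      have h2 : a < g (M.org e₀.1) := h.trans_lt hd
      have h3 : 0 ≤ a := hr₀ ▸ (R.sideLevel_mem e₀.1 r₀).1
      exact ⟨_, R.isCut_gt h3 (h2.trans_le (R.le_k _)), h2, not_lt.2 h4⟩
  obtain ⟨a1, a2, a3⟩ := R.seg_arc hs hB hU he₀ he₁ hUe hr₀
  constructor
  · intro z hz
    obtain ⟨p, rfl⟩ := M.exists_chordPoint g _ z
    rw [ChordPoint.gExt_toQ] at hz
    obtain ⟨q, hq, -, hqp⟩ := R.exists_isSeg hs hB hU p hz
    rw [← hqp, R.sideExt_toQ hB]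
    exact a2 q hq
  · intro τ hτ
    obtain ⟨p, hp, -, hv⟩ := a3 τ hτ
    exact ⟨p.toQ _, by rw [ChordPoint.gExt_toQ, hp.level_eq], by rw [R.sideExt_toQ hB, hv]⟩

/-- A point at the highest level lies on a nondegenerate segment, which is then a side of its cell
on which `g` is constant, and such sides belong to the boundary of the annulus. -/
theorem mem_QE₁_iff (z : M.QSlit g (Set.range s)) : z ∈ M.QE₁ g _ ↔ M.gExt g _ z = k := by
  constructor
  · rintro ⟨e, he, r, rfl⟩
    rw [gExt_pt, sideLevel, R.mem_E₁_iff.1 ⟨_, he, rfl⟩,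
      R.mem_E₁_iff.1 ⟨M.next (M.rev e.1), by simpa using he, by rw [M.org_next, M.rev_rev]⟩]
    ring
  · intro hz
    obtain ⟨p, rfl⟩ := M.exists_chordPoint g _ z
    rw [ChordPoint.gExt_toQ] at hz
    obtain ⟨U, q, hU, hq, hdeg, hqp⟩ := R.exists_nondegenerate hs hB p
    obtain ⟨f, h1, h2, h3⟩ := R.exists_flat_of_le hU hq hdeg (fun x _ => hz ▸ R.le_k _)
    refine ⟨f, ?_, q.s, ?_⟩
    · have hn := R.not_inner_rev_of_flat f.2 (h1.trans h2.symm)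
      simp only [Inner, not_and_or, not_not] at hn
      refine hn.resolve_right fun hn => ?_
      have := R.mem_E₂_iff.1 ⟨_, hn, rfl⟩
      rw [h2, hz] at this
      exact R.k_pos.ne' this
    · rw [← hqp]
      exact toQ_eq_of_coord_eq (by rw [h3]; simp [ChordPoint.coord])

theorem mem_QE₂_iff (z : M.QSlit g (Set.range s)) : z ∈ M.QE₂ g _ ↔ M.gExt g _ z = 0 := by
  constructor
  · rintro ⟨e, he, r, rfl⟩
    rw [gExt_pt, sideLevel, R.mem_E₂_iff.1 ⟨_, he, rfl⟩,
      R.mem_E₂_iff.1 ⟨M.next (M.rev e.1), by simpa using he, by rw [M.org_next, M.rev_rev]⟩]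
    ring
  · intro hz
    obtain ⟨p, rfl⟩ := M.exists_chordPoint g _ z
    rw [ChordPoint.gExt_toQ] at hz
    obtain ⟨U, q, hU, hq, hdeg, hqp⟩ := R.exists_nondegenerate hs hB p
    obtain ⟨f, h1, h2, h3⟩ := R.exists_flat_of_ge hU hq hdeg (fun x _ => hz ▸ R.nonneg _)
    refine ⟨f, ?_, unitInterval.symm q.s, ?_⟩
    · have hn := R.not_inner_rev_of_flat f.2 (h1.trans h2.symm)
      simp only [Inner, not_and_or, not_not] at hn
      refine hn.resolve_left fun hn => ?_
      have := R.mem_E₁_iff.1 ⟨_, hn, rfl⟩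
      rw [h2, hz] at this
      exact R.k_pos.ne this
    · rw [← hqp]
      exact toQ_eq_of_coord_eq (by rw [h3]; simp [ChordPoint.coord])

end Level

end IsRegular

end AnnulusMap

/-! ### Interpolation between nodes -/

open Classical in
/-- The function on the unit interval that is affine between consecutive nodes and has given values
at the nodes. -/
noncomputable def nodeInterp (N : Set unitInterval) (f : unitInterval → ℝ) (r : unitInterval) : ℝ :=
  let a : unitInterval := sSup {ρ | ρ ∈ N ∧ ρ ≤ r}
  let b : unitInterval := sInf {ρ | ρ ∈ N ∧ r ≤ ρ}
  if a = b then f a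
  else (((b : ℝ) - r) * f a + ((r : ℝ) - a) * f b) / ((b : ℝ) - a)

section NodeInterp

variable {N : Set unitInterval} {f f' : unitInterval → ℝ} {a b r : unitInterval}

theorem nodeInterp_eq (hab : a < b) (ha : a ∈ N) (hb : b ∈ N) (hN : ∀ ρ ∈ N, ρ ≤ a ∨ b ≤ ρ)
    (har : a ≤ r) (hrb : r ≤ b) :
    nodeInterp N f r = (((b : ℝ) - r) * f a + ((r : ℝ) - a) * f b) / ((b : ℝ) - a) := by
  have hpos : (0 : ℝ) < b - a := sub_pos.2 hab
  have hmem : r ∈ N → nodeInterp N f r = f r := by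
    intro hr
    have h1 : sSup {ρ | ρ ∈ N ∧ ρ ≤ r} = r :=
      IsGreatest.csSup_eq ⟨⟨hr, le_rfl⟩, fun ρ hρ => hρ.2⟩
    have h2 : sInf {ρ | ρ ∈ N ∧ r ≤ ρ} = r :=
      IsLeast.csInf_eq ⟨⟨hr, le_rfl⟩, fun ρ hρ => hρ.2⟩
    simp [nodeInterp, h1, h2]
  rcases har.eq_or_lt with rfl | har
  · rw [hmem ha]
    field_simp
    ring
  rcases hrb.eq_or_lt with rfl | hrb
  · rw [hmem hb]
    field_simp
    ring
  have h1 : sSup {ρ | ρ ∈ N ∧ ρ ≤ r} = a := IsGreatest.csSup_eq ⟨⟨ha, har.le⟩, fun ρ hρ =>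
    (hN ρ hρ.1).resolve_right fun h => (h.trans hρ.2).not_gt hrb⟩
  have h2 : sInf {ρ | ρ ∈ N ∧ r ≤ ρ} = b := IsLeast.csInf_eq ⟨⟨hb, hrb.le⟩, fun ρ hρ =>
    (hN ρ hρ.1).resolve_left fun h => (hρ.2.trans h).not_gt har⟩
  simp only [nodeInterp, h1, h2, if_neg hab.ne]

theorem nodeInterp_of_mem (hr : r ∈ N) : nodeInterp N f r = f r := by
  have h1 : sSup {ρ | ρ ∈ N ∧ ρ ≤ r} = r :=
    IsGreatest.csSup_eq ⟨⟨hr, le_rfl⟩, fun ρ hρ => hρ.2⟩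
  have h2 : sInf {ρ | ρ ∈ N ∧ r ≤ ρ} = r :=
    IsLeast.csInf_eq ⟨⟨hr, le_rfl⟩, fun ρ hρ => hρ.2⟩
  simp [nodeInterp, h1, h2]

variable (hfin : N.Finite) (h0 : 0 ∈ N) (h1 : 1 ∈ N)
include hfin h0 h1

theorem exists_consecutive (r : unitInterval) : ∃ a b : unitInterval, a < b ∧ a ∈ N ∧ b ∈ N ∧
    (∀ ρ ∈ N, ρ ≤ a ∨ b ≤ ρ) ∧ a ≤ r ∧ r ≤ b := by
  by_cases hr : r = 1
  · subst hr
    have hA : ({ρ | ρ ∈ N ∧ ρ < 1} : Set unitInterval).Finite := hfin.subset fun ρ h => h.1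
    obtain ⟨a, ha⟩ := hA.exists_maximal ⟨0, h0, zero_lt_one⟩
    refine ⟨a, 1, ha.1.2, ha.1.1, h1, fun ρ hρ => ?_, ha.1.2.le, le_rfl⟩
    by_contra! h
    exact h.1.not_ge (ha.2 ⟨hρ, h.2⟩ h.1.le)
  · have hA : ({ρ | ρ ∈ N ∧ ρ ≤ r} : Set unitInterval).Finite := hfin.subset fun ρ h => h.1
    have hB : ({ρ | ρ ∈ N ∧ r < ρ} : Set unitInterval).Finite := hfin.subset fun ρ h => h.1
    obtain ⟨a, ha⟩ := hA.exists_maximal ⟨0, h0, r.2.1⟩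
    obtain ⟨b, hb⟩ := hB.exists_minimal ⟨1, h1, lt_of_le_of_ne r.2.2 hr⟩
    refine ⟨a, b, ha.1.2.trans_lt hb.1.2, ha.1.1, hb.1.1, fun ρ hρ => ?_, ha.1.2, hb.1.2.le⟩
    by_contra! h
    rcases le_or_gt ρ r with hr | hr
    · exact h.1.not_ge (ha.2 ⟨hρ, hr⟩ h.1.le)
    · exact h.2.not_ge (hb.2 ⟨hρ, hr⟩ h.2.le)

theorem nodeInterp_lt (hf : ∀ ρ ∈ N, f ρ < f' ρ) (r : unitInterval) :
    nodeInterp N f r < nodeInterp N f' r := by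
  obtain ⟨a, b, hab, ha, hb, hN, har, hrb⟩ := exists_consecutive hfin h0 h1 r
  rw [nodeInterp_eq hab ha hb hN har hrb, nodeInterp_eq hab ha hb hN har hrb]
  have hpos : (0 : ℝ) < b - a := sub_pos.2 hab
  have i1 : (0 : ℝ) ≤ r - a := sub_nonneg.2 har
  have i2 : (0 : ℝ) ≤ b - r := sub_nonneg.2 hrb
  have i3 := hf a ha
  have i4 := hf b hb
  refine div_lt_div_of_pos_right ?_ hpos
  rcases i1.eq_or_lt with h | h <;> nlinarith

theorem nodeInterp_congr (hf : ∀ ρ ∈ N, f ρ = f' ρ) (r : unitInterval) :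
    nodeInterp N f r = nodeInterp N f' r := by
  obtain ⟨a, b, hab, ha, hb, hN, har, hrb⟩ := exists_consecutive hfin h0 h1 r
  rw [nodeInterp_eq hab ha hb hN har hrb, nodeInterp_eq hab ha hb hN har hrb, hf a ha, hf b hb]

theorem nodeInterp_symm {N' : Set unitInterval} (hN' : ∀ ρ, ρ ∈ N' ↔ unitInterval.symm ρ ∈ N)
    (r : unitInterval) :
    nodeInterp N' f (unitInterval.symm r) = nodeInterp N (fun ρ => f (unitInterval.symm ρ)) r := by
  obtain ⟨a, b, hab, ha, hb, hN, har, hrb⟩ := exists_consecutive hfin h0 h1 r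
  have hpos : (0 : ℝ) < b - a := sub_pos.2 hab
  rw [nodeInterp_eq hab ha hb hN har hrb,
    nodeInterp_eq (a := unitInterval.symm b) (b := unitInterval.symm a)
      (unitInterval.symm_lt_symm.2 hab)
      ((hN' _).2 (by rwa [unitInterval.symm_symm]))
      ((hN' _).2 (by rwa [unitInterval.symm_symm])) (fun ρ hρ => ?_)
      (unitInterval.symm_le_symm.2 hrb) (unitInterval.symm_le_symm.2 har)]
  · simp only [unitInterval.coe_symm_eq]
    rw [show (1 - (a : ℝ) - (1 - b)) = b - a by ring]
    congr 1
    ring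
  · rcases hN _ ((hN' ρ).1 hρ) with h | h
    · exact Or.inr (by rw [← unitInterval.symm_symm ρ]; exact unitInterval.symm_le_symm.2 h)
    · exact Or.inl (by rw [← unitInterval.symm_symm ρ]; exact unitInterval.symm_le_symm.2 h)

theorem continuous_nodeInterp : Continuous (nodeInterp N f) := by
  let I := {p : N × N // p.1.1 < p.2.1 ∧ ∀ ρ ∈ N, ρ ≤ p.1.1 ∨ p.2.1 ≤ ρ}
  have : Finite N := hfin
  refine (locallyFinite_of_finite (fun i : I => Set.Icc i.1.1.1 i.1.2.1)).continuous ?_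
    (fun i => isClosed_Icc) fun i => ?_
  · refine Set.eq_univ_of_forall fun r => ?_
    obtain ⟨a, b, hab, ha, hb, hN, har, hrb⟩ := exists_consecutive hfin h0 h1 r
    exact Set.mem_iUnion.2 ⟨⟨(⟨a, ha⟩, ⟨b, hb⟩), hab, hN⟩, har, hrb⟩
  · obtain ⟨⟨⟨a, ha⟩, ⟨b, hb⟩⟩, hab, hN⟩ := i
    refine ContinuousOn.congr (Continuous.continuousOn ?_) fun r hr =>
      nodeInterp_eq hab ha hb hN hr.1 hr.2
    fun_prop

end NodeInterp

namespace AnnulusMap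

variable {D V : Type*} [Fintype D] [Fintype V]

section NodeParams

variable {M : AnnulusMap D V} {g : V → ℝ}

theorem zero_mem_nodeParams (e : M.Side) : 0 ∈ M.nodeParams g e := Or.inl rfl

theorem one_mem_nodeParams (e : M.Side) : 1 ∈ M.nodeParams g e := Or.inr (Or.inl rfl)

theorem mem_nodeParams_iff {e : M.Side} (he : g (M.org e.1) ≠ g (M.org (M.rev e.1)))
    {r : unitInterval} : r ∈ M.nodeParams g e ↔ ∃ v, M.sideLevel g e.1 r = g v := by
  constructor
  · rintro (rfl | rfl | h)
    · exact ⟨_, sideLevel_zero _⟩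
    · exact ⟨_, sideLevel_one _⟩
    · exact h.2
  · exact fun h => Or.inr (Or.inr ⟨he, h⟩)

theorem nodeParams_of_flat {e : M.Side} (he : g (M.org e.1) = g (M.org (M.rev e.1))) :
    M.nodeParams g e = {0, 1} := by
  ext r
  simp [nodeParams, he]

theorem finite_nodeParams (e : M.Side) : (M.nodeParams g e).Finite := by
  by_cases he : g (M.org e.1) = g (M.org (M.rev e.1))
  · rw [nodeParams_of_flat he]
    exact Set.toFinite _
  · refine Set.Finite.of_finite_image (f := M.sideLevel g e.1)
      ((Set.finite_range g).subset ?_) fun r _ r' _ h => sideLevel_injective he h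
    rintro _ ⟨r, hr, rfl⟩
    obtain ⟨v, hv⟩ := (mem_nodeParams_iff he).1 hr
    exact ⟨v, hv.symm⟩

theorem symm_mem_nodeParams_iff {e e' : M.Side} (h : e'.1 = M.rev e.1) (r : unitInterval) :
    r ∈ M.nodeParams g e' ↔ unitInterval.symm r ∈ M.nodeParams g e := by
  have h1 : M.sideLevel g e.1 (unitInterval.symm r) = M.sideLevel g e'.1 r := by
    rw [h, ← sideLevel_rev, unitInterval.symm_symm]
  simp only [nodeParams, Set.mem_ofPred_eq, h1, h, M.rev_rev]
  rw [unitInterval.symm_eq_zero, unitInterval.symm_eq_one,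
    ne_comm (a := g (M.org (M.rev e.1)))]
  tauto

theorem sideLevel_strictMono {d : D} (h : M.Asc g d) : StrictMono (M.sideLevel g d) := by
  intro r r' hr
  have h1 : (r : ℝ) < r' := hr
  have h2 : g (M.org d) < g (M.org (M.rev d)) := h
  simp only [sideLevel]
  nlinarith

theorem sideLevel_strictAnti {d : D} (h : M.Desc g d) : StrictAnti (M.sideLevel g d) := by
  intro r r' hr
  have h1 : (r : ℝ) < r' := hr
  have h2 : g (M.org (M.rev d)) < g (M.org d) := h
  simp only [sideLevel]
  nlinarith

end NodeParams

/-- The function on the sides that is affine between consecutive nodes and has given values at the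
nodes. -/
noncomputable def sideInterp (M : AnnulusMap D V) (g : V → ℝ) (n : M.Side → unitInterval → ℝ)
    (e : M.Side) (r : unitInterval) : ℝ :=
  nodeInterp (M.nodeParams g e) (n e) r

section SideInterp

variable {M : AnnulusMap D V} {g : V → ℝ} {n : M.Side → unitInterval → ℝ}

/-- In terms of the level, the weights no longer depend on the side. Hence the values at equal
levels on two sides of a cell are the same convex combinations of values at the two neighbouring
node levels, and can be compared there. -/
theorem sideInterp_of_asc {e : M.Side} (he : M.Asc g e.1) {r rl ru : unitInterval} {a al au : ℝ}
    (hr : M.sideLevel g e.1 r = a) (hl : M.sideLevel g e.1 rl = al)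
    (hu : M.sideLevel g e.1 ru = au) (hm : al ∈ Set.range g) (hp : au ∈ Set.range g) (hlt : al < a)
    (hlt' : a < au) (hcons : ∀ v, g v ≤ al ∨ au ≤ g v) :
    M.sideInterp g n e r = ((au - a) * n e rl + (a - al) * n e ru) / (au - al) := by
  have hne : g (M.org e.1) ≠ g (M.org (M.rev e.1)) := ne_of_lt he
  have hmono := sideLevel_strictMono he
  subst hr hl hu
  obtain ⟨v, hv⟩ := hm
  obtain ⟨w, hw⟩ := hp
  rw [sideInterp, nodeInterp_eq (hmono.lt_iff_lt.1 (hlt.trans hlt'))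
    ((mem_nodeParams_iff hne).2 ⟨v, hv.symm⟩) ((mem_nodeParams_iff hne).2 ⟨w, hw.symm⟩) ?_
    (hmono.lt_iff_lt.1 hlt).le (hmono.lt_iff_lt.1 hlt').le]
  · have h1 : (rl : ℝ) < ru := hmono.lt_iff_lt.1 (hlt.trans hlt')
    have h2 : g (M.org e.1) < g (M.org (M.rev e.1)) := he
    have h3 := sub_pos.2 h1
    have h4 := sub_pos.2 (hlt.trans hlt')
    rw [div_eq_div_iff h3.ne' h4.ne']
    simp only [sideLevel]
    ring
  · intro ρ hρ
    obtain ⟨u, hw⟩ := (mem_nodeParams_iff hne).1 hρ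
    rcases hcons u with h | h
    · exact Or.inl (hmono.le_iff_le.1 (hw.trans_le h))
    · exact Or.inr (hmono.le_iff_le.1 (h.trans_eq hw.symm))

theorem sideInterp_of_desc {e : M.Side} (he : M.Desc g e.1) {r rl ru : unitInterval} {a al au : ℝ}
    (hr : M.sideLevel g e.1 r = a) (hl : M.sideLevel g e.1 rl = al)
    (hu : M.sideLevel g e.1 ru = au) (hm : al ∈ Set.range g) (hp : au ∈ Set.range g) (hlt : al < a)
    (hlt' : a < au) (hcons : ∀ v, g v ≤ al ∨ au ≤ g v) :
    M.sideInterp g n e r = ((au - a) * n e rl + (a - al) * n e ru) / (au - al) := by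
  have hne : g (M.org e.1) ≠ g (M.org (M.rev e.1)) := ne_of_gt he
  have hmono := sideLevel_strictAnti he
  subst hr hl hu
  obtain ⟨v, hv⟩ := hm
  obtain ⟨w, hw⟩ := hp
  rw [sideInterp, nodeInterp_eq (hmono.lt_iff_gt.1 (hlt.trans hlt'))
    ((mem_nodeParams_iff hne).2 ⟨w, hw.symm⟩) ((mem_nodeParams_iff hne).2 ⟨v, hv.symm⟩) ?_
    (hmono.lt_iff_gt.1 hlt').le (hmono.lt_iff_gt.1 hlt).le]
  · have h1 : (ru : ℝ) < rl := hmono.lt_iff_gt.1 (hlt.trans hlt')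
    have h2 : g (M.org (M.rev e.1)) < g (M.org e.1) := he
    have h3 := sub_pos.2 h1
    have h4 := sub_pos.2 (hlt.trans hlt')
    rw [div_eq_div_iff h3.ne' h4.ne']
    simp only [sideLevel]
    ring
  · intro ρ hρ
    obtain ⟨u, hw⟩ := (mem_nodeParams_iff hne).1 hρ
    rcases hcons u with h | h
    · exact Or.inr (hmono.le_iff_ge.1 (hw.trans_le h))
    · exact Or.inl (hmono.le_iff_ge.1 (h.trans_eq hw.symm))

theorem exists_consecutive_levels {a : ℝ} (ha : a ∉ Set.range g) (h : ∃ v, g v < a)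
    (h' : ∃ v, a < g v) : ∃ al au, al ∈ Set.range g ∧ au ∈ Set.range g ∧ al < a ∧ a < au ∧
      ∀ v, g v ≤ al ∨ au ≤ g v := by
  have hA : ({x | x ∈ Set.range g ∧ x < a} : Set ℝ).Finite :=
    (Set.finite_range g).subset fun x hx => hx.1
  have hB : ({x | x ∈ Set.range g ∧ a < x} : Set ℝ).Finite :=
    (Set.finite_range g).subset fun x hx => hx.1
  obtain ⟨v, hv⟩ := hA.exists_maximal (by obtain ⟨v, hv⟩ := h; exact ⟨g v, ⟨v, rfl⟩, hv⟩)
  obtain ⟨w, hw⟩ := hB.exists_minimal (by obtain ⟨v, hv⟩ := h'; exact ⟨g v, ⟨v, rfl⟩, hv⟩)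
  refine ⟨v, w, hv.1.1, hw.1.1, hv.1.2, hw.1.2, fun u => ?_⟩
  rcases lt_trichotomy (g u) a with h | h | h
  · left
    by_contra! hc
    exact hc.not_ge (hv.2 ⟨⟨u, rfl⟩, h⟩ hc.le)
  · exact absurd ⟨u, h⟩ ha
  · right
    by_contra! hc
    exact hc.not_ge (hw.2 ⟨⟨u, rfl⟩, h⟩ hc.le)

end SideInterp

variable [DecidableEq D]

/-- Values at the nodes that increase along the level curves of `g`. -/
structure IsNodeFunction (M : AnnulusMap D V) (g : V → ℝ) (S : Set D)
    (n : M.Side → unitInterval → ℝ) : Prop where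
  next : ∀ e e' : M.Side, e'.1 = M.next e.1 → n e 1 = n e' 0
  glue : ∀ e e' : M.Side, e'.1 = M.rev e.1 → e.1 ∉ S → e'.1 ∉ S →
    ∀ r ∈ M.nodeParams g e, n e' (unitInterval.symm r) = n e r
  lt : ∀ e e' : M.Side, M.next.SameCycle e.1 e'.1 → M.Asc g e.1 → M.Desc g e'.1 → ∀ r r',
    r ∈ M.nodeParams g e → M.sideLevel g e.1 r = M.sideLevel g e'.1 r' →
    M.sidePt e.1 r ≠ M.sidePt e'.1 r' → n e r < n e' r'
  jump : ∀ e e' : M.Side, e'.1 = M.rev e.1 → e.1 ∈ S → ∀ r ∈ M.nodeParams g e,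
    n e' (unitInterval.symm r) < n e r

/-- Between two consecutive node levels, strict monotonicity along the chords follows from weak
monotonicity at both levels and strict monotonicity at one of them. -/
theorem IsNodeFunction.isSideFunction {M : AnnulusMap D V} {g : V → ℝ} {S : Set D}
    {n : M.Side → unitInterval → ℝ} (hn : M.IsNodeFunction g S n) :
    M.IsSideFunction g S (M.sideInterp g n) where
  next e e' h := by
    rw [sideInterp, sideInterp, nodeInterp_of_mem (one_mem_nodeParams e),
      nodeInterp_of_mem (zero_mem_nodeParams e'), hn.next e e' h]
  glue e e' h hS hS' r := by
    rw [sideInterp, sideInterp, nodeInterp_symm (finite_nodeParams e) (zero_mem_nodeParams e)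
      (one_mem_nodeParams e) (symm_mem_nodeParams_iff h)]
    exact nodeInterp_congr (finite_nodeParams e) (zero_mem_nodeParams e)
      (one_mem_nodeParams e) (hn.glue e e' h hS hS') r
  flat e h r := by
    have h0 := zero_mem_nodeParams (g := g) e
    have h1 := one_mem_nodeParams (g := g) e
    rw [sideInterp, sideInterp, sideInterp, nodeInterp_of_mem h0, nodeInterp_of_mem h1,
      nodeInterp_eq zero_lt_one h0 h1 (fun ρ hρ => ?_) r.2.1 r.2.2]
    · simp
    · rw [nodeParams_of_flat h] at hρ
      rcases hρ with rfl | rfl <;> simp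
  cont e := continuous_nodeInterp (finite_nodeParams e) (zero_mem_nodeParams e)
    (one_mem_nodeParams e)
  jump e e' h hS r := by
    rw [sideInterp, sideInterp, nodeInterp_symm (finite_nodeParams e) (zero_mem_nodeParams e)
      (one_mem_nodeParams e) (symm_mem_nodeParams_iff h)]
    exact nodeInterp_lt (finite_nodeParams e) (zero_mem_nodeParams e)
      (one_mem_nodeParams e) (hn.jump e e' h hS) r
  lt e e' hc he he' r r' hl hne := by
    have hpos : g (M.org e.1) ≠ g (M.org (M.rev e.1)) := ne_of_lt he
    have hpos' : g (M.org e'.1) ≠ g (M.org (M.rev e'.1)) := ne_of_gt he'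
    by_cases hr : r ∈ M.nodeParams g e
    · have hr' : r' ∈ M.nodeParams g e' := by
        rw [mem_nodeParams_iff hpos', ← hl]
        exact (mem_nodeParams_iff hpos).1 hr
      rw [sideInterp, sideInterp, nodeInterp_of_mem hr, nodeInterp_of_mem hr']
      exact hn.lt e e' hc he he' r r' hr hl hne
    have ha : M.sideLevel g e.1 r ∉ Set.range g := fun ⟨v, hv⟩ =>
      hr ((mem_nodeParams_iff hpos).2 ⟨v, hv.symm⟩)
    have hr0 : 0 < r := lt_of_le_of_ne r.2.1 (by rintro rfl; exact hr (zero_mem_nodeParams e))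
    have hr1 : r < 1 := lt_of_le_of_ne r.2.2 (by rintro rfl; exact hr (one_mem_nodeParams e))
    have hr0' : 0 < r' := lt_of_le_of_ne r'.2.1 (by
      rintro rfl; exact ha ⟨_, by rw [hl, sideLevel_zero]⟩)
    have hr1' : r' < 1 := lt_of_le_of_ne r'.2.2 (by
      rintro rfl; exact ha ⟨_, by rw [hl, sideLevel_one]⟩)
    have l0 := sideLevel_strictMono he hr0
    have l1 := sideLevel_strictMono he hr1
    have l0' := sideLevel_strictAnti he' hr0'
    have l1' := sideLevel_strictAnti he' hr1'
    rw [sideLevel_zero] at l0 l0'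
    rw [sideLevel_one] at l1 l1'
    rw [← hl] at l0' l1'
    obtain ⟨al, au, hm, hp, hlt, hlt', hcons⟩ := exists_consecutive_levels ha ⟨_, l0⟩ ⟨_, l1⟩
    have hc' : ∀ v, g v < M.sideLevel g e.1 r → g v ≤ al := fun v h =>
      (hcons v).resolve_right fun h' => by linarith
    have hc'' : ∀ v, M.sideLevel g e.1 r < g v → au ≤ g v := fun v h =>
      (hcons v).resolve_left fun h' => by linarith
    have hmp := hlt.trans hlt'
    obtain ⟨p, hp1⟩ := exists_sideLevel_eq_of_asc he (hc' _ l0) (hmp.le.trans (hc'' _ l1))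
    obtain ⟨q, hq⟩ := exists_sideLevel_eq_of_asc he ((hc' _ l0).trans hmp.le) (hc'' _ l1)
    obtain ⟨p', hp'⟩ := exists_sideLevel_eq he' (hc' _ l1') (hmp.le.trans (hc'' _ l0'))
    obtain ⟨q', hq'⟩ := exists_sideLevel_eq he' ((hc' _ l1').trans hmp.le) (hc'' _ l0')
    rw [sideInterp_of_asc he rfl hp1 hq hm hp hlt hlt' hcons,
      sideInterp_of_desc he' hl.symm hp' hq' hm hp hlt hlt' hcons]
    have key : ∀ ρ ρ' b, b ∈ Set.range g → M.sideLevel g e.1 ρ = b → M.sideLevel g e'.1 ρ' = b →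
        M.sidePt e.1 ρ ≠ M.sidePt e'.1 ρ' → n e ρ < n e' ρ' := by
      rintro ρ ρ' b ⟨v, hv⟩ h1 h2 h3
      exact hn.lt e e' hc he he' ρ ρ' ((mem_nodeParams_iff hpos).2 ⟨v, by rw [h1, hv]⟩)
        (h1.trans h2.symm) h3
    have hee : e.1 ≠ e'.1 := fun h => he.not_desc (h ▸ he')
    have hpq : p < q := (sideLevel_strictMono he).lt_iff_lt.1 (by rw [hp1, hq]; exact hmp)
    have heq : ∀ ρ ρ', M.sidePt e.1 ρ = M.sidePt e'.1 ρ' → n e ρ = n e' ρ' ∧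
        ((ρ = 1 ∧ M.next e.1 = e'.1) ∨ (ρ = 0 ∧ M.next e'.1 = e.1)) := by
      intro ρ ρ' h
      rcases e.2.sidePt_eq_sidePt e'.2 h with ⟨h1, -⟩ | ⟨rfl, rfl, h1⟩ | ⟨rfl, rfl, h1⟩
      · exact absurd h1 hee
      · exact ⟨hn.next _ _ h1.symm, Or.inl ⟨rfl, h1⟩⟩
      · exact ⟨(hn.next _ _ h1.symm).symm, Or.inr ⟨rfl, h1⟩⟩
    refine div_lt_div_of_pos_right ?_ (sub_pos.2 hmp)
    have i1 := sub_pos.2 hlt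
    have i2 := sub_pos.2 hlt'
    -- The chords at the two neighbouring node levels cannot both be degenerate: the two sides would
    -- have both ends in common, and the cell would be a bigon.
    by_cases hP : M.sidePt e.1 p = M.sidePt e'.1 p'
    · obtain ⟨h1, h2⟩ := heq _ _ hP
      have h3 : n e q < n e' q' := by
        refine key _ _ _ hp hq hq' fun hQ => ?_
        obtain ⟨-, h4⟩ := heq _ _ hQ
        rcases h2 with ⟨rfl, -⟩ | ⟨-, h2⟩
        · exact hpq.not_ge q.2.2
        rcases h4 with ⟨-, h4⟩ | ⟨rfl, -⟩
        · exact e.2.cycle.2.2.1 (by rw [h4, h2])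
        · exact hpq.not_ge p.2.1
      rw [h1]
      nlinarith
    · have h1 := key _ _ _ hm hp1 hp' hP
      have h2 : n e q ≤ n e' q' := by
        by_cases hQ : M.sidePt e.1 q = M.sidePt e'.1 q'
        · exact (heq _ _ hQ).1.le
        · exact (key _ _ _ hp hq hq' hQ).le
      nlinarith

end AnnulusMap

/-! ### An auxiliary side function from the harmonic conjugate -/

namespace AnnulusMap

variable {D V : Type*} [Fintype D] [Fintype V]

/-- The values at the nodes that are given by a function on the two-cells, which is a conjugate of
`g`, and by a function on the corners. -/
noncomputable def cornerValue (M : AnnulusMap D V) (c : D → ℝ) (g : V → ℝ) (h q : D → ℝ)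
    (e : M.Side) (r : unitInterval) : ℝ :=
  open Classical in
  h e.1 + if r = 0 then q e.1 else if r = 1 then q (M.next e.1) else max (M.flux c g e.1) 0

variable [DecidableEq D]

namespace IsRegular

variable {M : AnnulusMap D V} {c : D → ℝ} {k : ℝ} {g : V → ℝ} (R : M.IsRegular c k g)
include R

/-- At a vertex at which a two-cell has a local minimum of `g`, it has no other points of the same
level. -/
theorem sidePt_eq_of_isMin {e x : M.Side} (he : M.Asc g e.1) (hd : M.Desc g (M.next.symm e.1))
    (hx : M.next.SameCycle e.1 x.1) {r : unitInterval}
    (hr : M.sideLevel g x.1 r = g (M.org e.1)) : M.sidePt x.1 r = M.sidePt e.1 0 := by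
  obtain ⟨d, hde⟩ := M.next.surjective e.1
  rw [← hde, Equiv.symm_apply_apply] at hd
  have hd' : M.Inner d := R.inner_of_desc hd
  have he' : g (M.org e.1) < g (M.org (M.rev e.1)) := he
  have hdo : g (M.org (M.rev d)) = g (M.org e.1) := by rw [← M.org_next, hde]
  have hd'' : g (M.org e.1) < g (M.org d) := hdo ▸ hd
  obtain ⟨t, ht, -⟩ := R.side_mem_seg (B := fun _ _ => 0) (fun _ _ _ => rfl) (by simp)
    (R.isCut_gt (R.nonneg (M.org e.1)) (he'.trans_le (R.le_k _))) (d := ⟨d, hd'⟩) (e := e)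
    ⟨hd'', by simp [hdo]⟩ ⟨he', by simp [M.rev_rev]⟩ (by rw [← hde]; simp)
    (sideLevel_zero _) ((sideLevel_one _).trans hdo) hx hr
  rw [ht, sidePt_one, hde]
  module

/-- At a vertex at which a two-cell has a local maximum of `g`, it has no other points of the same
level. -/
theorem sidePt_eq_of_isMax {e x : M.Side} (he : M.Asc g e.1) (hd : M.Desc g (M.next e.1))
    (hx : M.next.SameCycle e.1 x.1) {r : unitInterval}
    (hr : M.sideLevel g x.1 r = g (M.org (M.rev e.1))) : M.sidePt x.1 r = M.sidePt e.1 1 := by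
  have hd' : M.Inner (M.next e.1) := R.inner_of_desc hd
  have he' : g (M.org e.1) < g (M.org (M.rev e.1)) := he
  have hd'' : g (M.org (M.rev (M.next e.1))) < g (M.org (M.rev e.1)) := by
    rw [← M.org_next e.1]; exact hd
  obtain ⟨t, ht, -⟩ := R.side_mem_seg (B := fun _ _ => 0) (fun _ _ _ => rfl) (by simp)
    (R.isCut_ge ((R.nonneg _).trans_lt he') (R.le_k (M.org (M.rev e.1))))
    (d := ⟨M.next e.1, hd'⟩) (e := e)
    ⟨by simp [M.org_next], not_le.2 hd''⟩ ⟨le_rfl, by rw [M.rev_rev]; exact not_le.2 he'⟩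
    (by simp) (sideLevel_one _) ((sideLevel_zero _).trans (by rw [M.org_next])) hx hr
  rw [ht, ← sidePt_one]
  module

/-- The level curves enter a cell through its ascending sides and leave it through the descending
ones. The node values are chosen to be the conjugate of the cell at the points of entry and strictly
larger at the points of exit; the potential on the corners makes this consistent about the vertices.
-/
theorem exists_isSideFunction {n : ℕ} {s : Fin (n + 1) → D} (hs : M.IsSlit g s) :
    ∃ B, M.IsSideFunction g (Set.range s) B := by
  obtain ⟨h, hh, hh'⟩ := R.exists_conjugate hs
  obtain ⟨q, hq, hq0, hqpos⟩ := R.exists_corner_potential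
  -- Across an edge the conjugate changes by the flux, which is compensated by the change of the
  -- corner potential, respectively of the positive part of the flux. Only the jump across the slit
  -- is left.
  have hrev : ∀ e e' : M.Side, e'.1 = M.rev e.1 → ∀ r,
      M.cornerValue c g h q e' (unitInterval.symm r) =
        M.cornerValue c g h q e r - M.totalFlux c g * M.jump (Set.range s) e.1 := by
    intro e e' hee r
    have hi : M.Inner (M.rev e.1) := hee ▸ e'.2
    have hnf : M.Asc g e.1 ∨ M.Desc g e.1 := by
      by_contra! hc
      exact R.not_inner_rev_of_flat e.2 (le_antisymm (not_lt.1 hc.2) (not_lt.1 hc.1)) hi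
    have h1 := hh' e.1 e.2 hi
    have h2 := hq e.1 hnf
    have h3 := hq (M.rev e.1) (by rw [M.asc_rev, M.desc_rev]; exact hnf.symm)
    rw [M.rev_rev, R.flux_rev] at h3
    simp only [cornerValue, hee, unitInterval.symm_eq_zero, unitInterval.symm_eq_one,
      R.flux_rev]
    by_cases r0 : r = 0
    · subst r0
      simp
      linarith
    by_cases r1 : r = 1
    · subst r1
      simp
      linarith
    · simp only [r0, r1, if_false]
      rcases max_cases (M.flux c g e.1) 0 with h4 | h4 <;>
        rcases max_cases (-M.flux c g e.1) 0 with h5 | h5 <;> linarith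
  refine ⟨_, IsNodeFunction.isSideFunction (n := M.cornerValue c g h q)
    ⟨?_, ?_, ?_, ?_⟩⟩
  · intro e e' hee
    simp [cornerValue, hee, hh]
  · intro e e' hee hS hS' r _
    rw [hrev e e' hee, jump, if_neg hS, if_neg (hee ▸ hS')]
    simp
  · intro e e' hc he he' r r' _ hl hne
    have hcyc : h e'.1 = h e.1 := by
      obtain ⟨i, hi⟩ := hc.exists_nat_pow_eq
      have : ∀ i : ℕ, h ((M.next ^ i) e.1) = h e.1 := by
        intro i
        induction i with
        | zero => rfl
        | succ i ih => rw [pow_succ', Equiv.Perm.mul_apply, hh, ih]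
      rw [← hi, this]
    -- If the entry point is a vertex, the corner is `Pos`, with potential 0, unless the cell has a
    -- local extremum there; in that case the chord is degenerate.
    have h1 : M.cornerValue c g h q e r = h e.1 := by
      rw [cornerValue, add_eq_left]
      split_ifs with h0 h1
      · subst h0
        refine hq0 _ (Or.inr ⟨fun hd => hne ?_, he⟩)
        exact (R.sidePt_eq_of_isMin he hd hc (hl.symm.trans (sideLevel_zero _))).symm
      · subst h1
        refine hq0 _ (Or.inl ⟨by simpa using he, fun hd => hne ?_⟩)
        exact (R.sidePt_eq_of_isMax he hd hc (hl.symm.trans (sideLevel_one _))).symm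
      · exact max_eq_right (R.flux_neg he).le
    have h2 : h e'.1 < M.cornerValue c g h q e' r' := by
      rw [cornerValue, lt_add_iff_pos_right]
      split_ifs with h0 h1
      · refine hqpos _ ?_
        rintro (hP | hP)
        · exact hP.2 he'
        · exact hP.2.not_desc he'
      · refine hqpos _ ?_
        rintro (hP | hP)
        · rw [Equiv.symm_apply_apply] at hP
          exact hP.1.not_desc he'
        · rw [Equiv.symm_apply_apply] at hP
          exact hP.1 he'
      · exact lt_max_of_lt_left (R.flux_pos he')
    rw [h1, ← hcyc]
    exact h2
  · intro e e' hee hS r _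
    have hn := hs.rev_notMem hS
    rw [hrev e e' hee, jump, if_pos hS, if_neg hn]
    have := R.totalFlux_pos
    linarith

end IsRegular

end AnnulusMap

/-! ### The values of the conjugate function at the nodes as partial sums of fluxes -/

theorem finsum_mem_lt_finsum_mem {ι : Type*} {s t : Set ι} {f : ι → ℝ} (ht : t.Finite)
    (hst : s ⊆ t) (hf : ∀ i ∈ t, 0 < f i) {i : ι} (hi : i ∈ t) (his : i ∉ s) :
    ∑ᶠ j ∈ s, f j < ∑ᶠ j ∈ t, f j := by
  rw [← finsum_mem_add_sdiff hst ht, lt_add_iff_pos_right]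
  refine finsum_cond_pos (fun j hj => (hf j hj.1).le) ⟨i, ⟨hi, his⟩, hf i hi⟩ ?_
  exact (ht.subset Set.sdiff_subset).subset Set.inter_subset_right

namespace AnnulusMap

variable {D V : Type*} [Fintype D] [Fintype V]

/-- The vertices above the level curve of `g` at level `a`. -/
def Above (g : V → ℝ) (a : ℝ) (v : V) : Prop := a ≤ g v ∧ 0 < g v

namespace IsRegular

variable {M : AnnulusMap D V} {c : D → ℝ} {k : ℝ} {g : V → ℝ} (R : M.IsRegular c k g)
include R

/-- The condition 0 < g matters at a = 0 only, where a ≤ g would hold everywhere. The darts leaving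
this cut go down from level `a` if a > 0 and come down to it if a = 0, in accordance with the two
cases in `nodeValue`. -/
theorem isCut_above {a : ℝ} (h0 : 0 ≤ a) (hk : a ≤ k) : M.IsCut g (Above g a) a where
  le _ h := h.1
  ge v h := by
    by_contra! hc
    exact h ⟨hc.le, h0.trans_lt hc⟩
  lt v w h h' := by
    by_contra! hc
    exact h' ⟨h.1.trans hc, h.2.trans_le hc⟩
  on_E₁ v hv := by
    rw [Above, R.mem_E₁_iff.1 hv]
    exact ⟨hk, R.k_pos⟩
  on_E₂ v hv h := h.2.ne' (R.mem_E₂_iff.1 hv)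

end IsRegular

variable [DecidableEq D]

section NormalDeriv

variable {M : AnnulusMap D V} {c : D → ℝ} {k : ℝ} {g : V → ℝ} (R : M.IsRegular c k g)
  {S : Set D} {u : M.QSlit g S}
include R

/-- The sides that go down from the point `u`. -/
def downSides (M : AnnulusMap D V) (g : V → ℝ) (S : Set D) (u : M.QSlit g S) : Set M.Side :=
  {e | M.Exits (Above g (M.gExt g S u)) e.1 ∧ ∃ r, u = M.pt g S e r}

/-- The conductance of a lower segment times the drop of `g` along it is the flux of the whole edge,
so the point of subdivision is irrelevant. -/
theorem IsRegular.normalDerivBelow_eq (hu : 0 < M.gExt g S u) :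
    M.normalDerivBelow c g S u = ∑ᶠ e ∈ M.downSides g S u, M.flux c g e.1 := by
  refine finsum_mem_congr (s := {e : M.Side | _}) (Set.ext fun e => ?_) fun e he => ?_
  · constructor
    · rintro ⟨h, r, hr, rfl⟩
      rw [gExt_pt] at hu
      have h1 := sideLevel_strictAnti h hr
      have h2 := (sideLevel_strictAnti h).antitone (show 0 ≤ r from r.2.1)
      rw [sideLevel_one] at h1
      rw [sideLevel_zero] at h2
      simp only [downSides, gExt_pt]
      exact ⟨⟨⟨h2, hu.trans_le h2⟩, fun h3 => h3.1.not_gt h1⟩, r, rfl⟩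
    · rintro ⟨h, r, rfl⟩
      rw [gExt_pt] at hu h
      have hd := h.desc (R.isCut_above hu.le (R.sideLevel_mem _ _).2)
      refine ⟨hd, r, lt_of_le_of_ne r.2.2 ?_, rfl⟩
      rintro rfl
      rw [sideLevel_one] at h hu
      exact h.2 ⟨le_rfl, hu⟩
  · obtain ⟨h, r, rfl⟩ := he
    rw [gExt_pt] at hu h
    rw [gExt_pt, segConductance, flux]
    have : M.sideLevel g e.1 r - g (M.org (M.rev e.1)) ≠ 0 := by
      intro h3
      rw [sub_eq_zero] at h3
      rw [h3] at h hu
      exact h.2 ⟨le_rfl, hu⟩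
    field_simp

theorem IsRegular.abs_normalDerivAbove_eq (hu : M.gExt g S u = 0) :
    |M.normalDerivAbove c g S u| = ∑ᶠ e ∈ M.downSides g S u, M.flux c g e.1 := by
  have h : M.normalDerivAbove c g S u = -∑ᶠ e ∈ M.downSides g S u, M.flux c g e.1 := by
    rw [← finsum_mem_neg_distrib _ (Set.toFinite _)]
    refine finsum_mem_congr (s := {e : M.Side | _}) (Set.ext fun e => ?_) fun e he => ?_
    · constructor
      · rintro ⟨h, r, hr, rfl⟩
        rw [gExt_pt] at hu
        have h3 : g (M.org (M.rev e.1)) < g (M.org e.1) := h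
        have h4 := R.nonneg (M.org (M.rev e.1))
        have h5 := (sideLevel_strictAnti h).antitone (show r ≤ 1 from r.2.2)
        rw [sideLevel_one] at h5
        simp only [downSides, gExt_pt, hu] at h5 ⊢
        exact ⟨⟨⟨R.nonneg _, by linarith⟩, fun h6 => h6.2.not_ge h5⟩, r, rfl⟩
      · rintro ⟨h, r, rfl⟩
        rw [hu] at h
        rw [gExt_pt] at hu
        have hd := h.desc (R.isCut_above le_rfl R.k_pos.le)
        refine ⟨hd, r, lt_of_le_of_ne r.2.1 ?_, rfl⟩
        rintro rfl
        rw [sideLevel_zero] at hu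
        exact h.1.2.ne' hu
    · obtain ⟨h, r, rfl⟩ := he
      rw [segConductance, flux, hu]
      have : g (M.org e.1) ≠ 0 := h.1.2.ne'
      field_simp
      ring
  rw [h, abs_neg, abs_of_nonneg]
  refine finsum_nonneg fun e => finsum_nonneg fun he => (R.flux_pos ?_).le
  rw [downSides, hu] at he
  exact he.1.desc (R.isCut_above le_rfl R.k_pos.le)

end NormalDeriv

section Conjugate

variable {M : AnnulusMap D V} {c : D → ℝ} {k : ℝ} {g : V → ℝ} (R : M.IsRegular c k g) {n : ℕ}
  {s : Fin (n + 1) → D} (hs : M.IsSlit g s) {B : M.Side → unitInterval → ℝ}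
  (hB : M.IsSideFunction g (Set.range s) B)

namespace IsRegular

include R

theorem gExt_mem {S : Set D} (z : M.QSlit g S) : M.gExt g S z ∈ Set.Icc 0 k := by
  obtain ⟨p, rfl⟩ := M.exists_chordPoint g _ z
  rw [ChordPoint.gExt_toQ]
  exact R.sideLevel_mem _ _

omit [DecidableEq D] in
include hs in
/-- The end points of the level curve of `g` at a given level. -/
theorem exists_slit_pt {a : ℝ} (ha : a ∈ Set.Icc 0 k) : ∃ (e₀ e₁ : M.Side) (r₀ : unitInterval),
    e₀.1 ∈ Set.range s ∧ e₁.1 = M.rev e₀.1 ∧ M.sideLevel g e₀.1 r₀ = a := by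
  obtain ⟨e₀, e₁, r₀, h1, h2, -, h3⟩ := R.exists_slit_side hs (R.isCut_above ha.1 ha.2)
  exact ⟨e₀, e₁, r₀, h1, h2, h3⟩

include hs hB

/-- A continuous injection of a compact space into the plane is a closed embedding; injectivity is
the arc property of the level curves of `g`. -/
theorem isEmbedding : Topology.IsClosedEmbedding fun z : M.QSlit g (Set.range s) =>
    (M.gExt g _ z, M.sideExt g _ B z) :=
  (continuous_gExt.prodMk (R.continuous_sideExt hB)).isClosedEmbedding fun _ _ h =>
    R.eq_of_gExt_eq_of_sideExt_eq hs hB (congrArg Prod.fst h) (congrArg Prod.snd h)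

theorem sideExt_le_of_mem_base {z w : M.QSlit g (Set.range s)} (hz : z ∈ M.base g (Set.range s))
    (h : M.gExt g _ w = M.gExt g _ z) :
    M.sideExt g (Set.range s) B z ≤ M.sideExt g (Set.range s) B w := by
  obtain ⟨e, he, r, rfl⟩ := hz
  have hi : M.Inner (M.rev e.1) := R.inner_of_desc (hs.desc he)
  have := ((R.sideExt_level hs hB (e₀ := ⟨M.rev e.1, hi⟩) (e₁ := e) he (M.rev_rev _).symm
    (r₀ := unitInterval.symm r) rfl).1 w (by rw [h, gExt_pt, sideLevel_rev])).1
  rwa [unitInterval.symm_symm, ← R.sideExt_pt hB] at this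

omit hB in
theorem exists_mem_base (z : M.QSlit g (Set.range s)) :
    ∃ p ∈ M.base g (Set.range s), M.gExt g _ p = M.gExt g _ z := by
  obtain ⟨e₀, e₁, r₀, h1, h2, h3⟩ := R.exists_slit_pt hs (R.gExt_mem z)
  refine ⟨M.pt g _ e₁ (unitInterval.symm r₀), ⟨e₁, by rwa [h2, M.rev_rev], _, rfl⟩, ?_⟩
  rw [gExt_pt, h2, sideLevel_rev, h3]

theorem lt_of_notMem_base {z p : M.QSlit g (Set.range s)} (hz : z ∉ M.base g (Set.range s))
    (hp : p ∈ M.base g (Set.range s)) (h : M.gExt g _ p = M.gExt g _ z) :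
    M.sideExt g (Set.range s) B p < M.sideExt g (Set.range s) B z := by
  refine lt_of_le_of_ne (R.sideExt_le_of_mem_base hs hB hp h.symm) fun h' => hz ?_
  rwa [← R.eq_of_gExt_eq_of_sideExt_eq hs hB h h']

theorem le_sideExt_pt {e : M.Side} (he : e.1 ∈ Set.range s) {r : unitInterval}
    {w : M.QSlit g (Set.range s)} (h : M.gExt g _ w = M.sideLevel g e.1 r) :
    M.sideExt g (Set.range s) B w ≤ B e r :=
  ((R.sideExt_level hs hB (e₁ := ⟨M.rev e.1, R.inner_rev_of_desc (hs.desc he)⟩) he rfl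
    (r₀ := r) rfl).1 w h).2

/-- The part of a level curve of `g` between its starting point and one of its points. -/
theorem connectedComponentIn_eq {v p : M.QSlit g (Set.range s)}
    (hv : v ∉ M.base g (Set.range s)) (hp : p ∈ M.base g (Set.range s))
    (h : M.gExt g _ p = M.gExt g _ v) :
    connectedComponentIn ({w | M.gExt g _ w = M.gExt g _ v} \ {v}) p =
      {w | M.gExt g _ w = M.gExt g _ v ∧
        M.sideExt g (Set.range s) B w < M.sideExt g (Set.range s) B v} := by
  have hpv := R.lt_of_notMem_base hs hB hv hp h
  have hpF : p ∈ {w | M.gExt g _ w = M.gExt g _ v} \ {v} := ⟨h, fun h' => hv (by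
    rw [Set.mem_singleton_iff] at h'; rwa [← h'])⟩
  apply Set.Subset.antisymm
  · intro w hw
    have hwF := connectedComponentIn_subset _ _ hw
    refine ⟨hwF.1, ?_⟩
    by_contra! hc
    have hpre := (isPreconnected_connectedComponentIn (F := {w | M.gExt g _ w = M.gExt g _ v} \ {v})
      (x := p)).image _ (R.continuous_sideExt hB).continuousOn
    obtain ⟨x, hx, hxv⟩ := hpre.ordConnected.out (Set.mem_image_of_mem _
      (mem_connectedComponentIn hpF)) (Set.mem_image_of_mem _ hw) ⟨hpv.le, hc⟩
    have hxF := connectedComponentIn_subset _ _ hx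
    exact hxF.2 (R.eq_of_gExt_eq_of_sideExt_eq hs hB hxF.1 hxv)
  · refine IsPreconnected.subset_connectedComponentIn ?_ ⟨h, hpv⟩ ?_
    -- In the coordinates given by the level and the side function, the initial part of the level
    -- curve is a point times a half-open interval, which is connected.
    · refine (R.isEmbedding hs hB).isInducing.isPreconnected_image.1 ?_
      obtain ⟨e, he, r, rfl⟩ := hp
      have hi : M.Inner (M.rev e.1) := R.inner_of_desc (hs.desc he)
      have hr : M.sideLevel g (M.rev e.1) (unitInterval.symm r) = M.gExt g _ v := by
        rw [← h, gExt_pt, sideLevel_rev]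
      obtain ⟨h1, h2⟩ := R.sideExt_level hs hB (e₀ := ⟨M.rev e.1, hi⟩) (e₁ := e) he
        (M.rev_rev _).symm hr
      have : (fun z : M.QSlit g (Set.range s) => (M.gExt g _ z, M.sideExt g _ B z)) ''
          {w | M.gExt g _ w = M.gExt g _ v ∧
            M.sideExt g (Set.range s) B w < M.sideExt g (Set.range s) B v} =
          {M.gExt g _ v} ×ˢ Set.Ico (B e r) (M.sideExt g (Set.range s) B v) := by
        ext ⟨x, y⟩
        constructor
        · rintro ⟨w, ⟨hw, hw'⟩, hxy⟩
          rw [Prod.mk.injEq] at hxy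
          obtain ⟨rfl, rfl⟩ := hxy
          have := (h1 w hw).1
          rw [unitInterval.symm_symm] at this
          exact ⟨hw, this, hw'⟩
        · rintro ⟨hx, hy, hy'⟩
          have hx' : x = M.gExt g _ v := hx
          obtain ⟨w, hw, hw'⟩ := h2 y
            ⟨by rwa [unitInterval.symm_symm], hy'.le.trans (h1 v rfl).2⟩
          simp only at hy'
          exact ⟨w, ⟨hw, by rwa [hw']⟩, Prod.ext (hw.trans hx'.symm) hw'⟩
      rw [this]
      exact isPreconnected_singleton.prod isPreconnected_Ico
    · rintro w ⟨hw, hw'⟩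
      refine ⟨hw, ?_⟩
      rintro rfl
      exact hw'.false

theorem nodesUpTo_eq {v : M.QSlit g (Set.range s)} (hv : v ∉ M.base g (Set.range s))
    (hn : M.IsNode g _ v) : M.nodesUpTo g _ v = {u | M.IsNode g _ u ∧ M.gExt g _ u = M.gExt g _ v ∧
      M.sideExt g (Set.range s) B u ≤ M.sideExt g (Set.range s) B v} := by
  ext u
  constructor
  · rintro ⟨h1, h2, h3⟩
    refine ⟨h1, h2, ?_⟩
    rcases h3 with rfl | ⟨p, hp, hpv, hu⟩
    · exact le_rfl
    · rw [R.connectedComponentIn_eq hs hB hv hp hpv] at hu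
      exact hu.2.le
  · rintro ⟨h1, h2, h3⟩
    refine ⟨h1, h2, ?_⟩
    by_cases h4 : u = v
    · exact Or.inl h4
    · obtain ⟨p, hp, hpv⟩ := R.exists_mem_base hs v
      refine Or.inr ⟨p, hp, hpv, ?_⟩
      rw [R.connectedComponentIn_eq hs hB hv hp hpv]
      exact ⟨h2, lt_of_le_of_ne h3 fun h => h4 (R.eq_of_gExt_eq_of_sideExt_eq hs hB h2 h)⟩

omit hs in
-- An edge that leaves the superlevel set meets the level curve in exactly one point, and this is a
-- node. So the double sum over nodes and edges is a sum over edges.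
theorem nodeValue_eq_aux {v : M.QSlit g (Set.range s)} (hn : ∃ x, g x = M.gExt g _ v) :
    ∑ᶠ u ∈ {u | M.IsNode g _ u ∧ M.gExt g _ u = M.gExt g _ v ∧
        M.sideExt g (Set.range s) B u ≤ M.sideExt g (Set.range s) B v},
      ∑ᶠ e ∈ M.downSides g _ u, M.flux c g e.1 =
    ∑ᶠ e ∈ {e : M.Side | M.Exits (Above g (M.gExt g _ v)) e.1 ∧
      ∃ r, M.sideLevel g e.1 r = M.gExt g _ v ∧ B e r ≤ M.sideExt g (Set.range s) B v},
      M.flux c g e.1 := by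
  have hmem := R.gExt_mem v
  rw [← finsum_mem_biUnion ?_ ?_ fun _ _ => Set.toFinite _]
  · refine finsum_mem_congr (Set.ext fun e => ?_) fun _ _ => rfl
    simp only [Set.mem_iUnion]
    constructor
    · rintro ⟨u, ⟨h1, h2, h3⟩, h4, r, rfl⟩
      rw [h2] at h4
      rw [gExt_pt] at h2
      rw [R.sideExt_pt hB] at h3
      exact ⟨h4, r, h2, h3⟩
    · rintro ⟨h1, r, h2, h3⟩
      refine ⟨M.pt g _ e r, ⟨⟨e, r, ?_, rfl⟩, by rwa [gExt_pt], by rwa [R.sideExt_pt hB]⟩,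
        by rwa [gExt_pt, h2], r, rfl⟩
      obtain ⟨x, hx⟩ := hn
      refine (mem_nodeParams_iff ?_).2 ⟨x, by rw [h2, hx]⟩
      exact ne_of_gt (h1.desc (R.isCut_above hmem.1 hmem.2))
  · rintro u ⟨-, h1, -⟩ u' ⟨-, h1', -⟩ hne
    refine Set.disjoint_left.2 ?_
    rintro e ⟨h2, r, rfl⟩ ⟨-, r', rfl⟩
    rw [h1] at h2
    rw [gExt_pt] at h1 h1'
    exact hne (by rw [sideLevel_injective (ne_of_gt (h2.desc (R.isCut_above hmem.1 hmem.2)))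
      (h1.trans h1'.symm)])
  · refine (Set.finite_iUnion (f := fun e : M.Side => M.pt g (Set.range s) e '' M.nodeParams g e)
      fun e => (finite_nodeParams e).image _).subset ?_
    rintro u ⟨⟨e, r, hr, rfl⟩, -⟩
    exact Set.mem_iUnion.2 ⟨e, r, hr, rfl⟩

/-- This turns the topological definition into a computable one. The side function `B` serves only
to order the points of the level curve. -/
theorem nodeValue_eq {v : M.QSlit g (Set.range s)} (hv : v ∉ M.base g (Set.range s))
    (hn : M.IsNode g _ v) : M.nodeValue c g _ v =
    ∑ᶠ e ∈ {e : M.Side | M.Exits (Above g (M.gExt g _ v)) e.1 ∧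
      ∃ r, M.sideLevel g e.1 r = M.gExt g _ v ∧ B e r ≤ M.sideExt g (Set.range s) B v},
      M.flux c g e.1 := by
  rw [← R.nodeValue_eq_aux hB ?_, ← R.nodesUpTo_eq hs hB hv hn, nodeValue, if_neg hv]
  · split_ifs with h2
    · rw [R.mem_QE₂_iff hs hB] at h2
      exact finsum_mem_congr rfl fun u hu => R.abs_normalDerivAbove_eq (hu.2.1.trans h2)
    · rw [R.mem_QE₂_iff hs hB] at h2
      exact finsum_mem_congr rfl fun u hu => R.normalDerivBelow_eq
        (hu.2.1.symm ▸ lt_of_le_of_ne (R.gExt_mem v).1 (Ne.symm h2))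
  · obtain ⟨e, r, hr, rfl⟩ := hn
    rw [gExt_pt]
    by_cases he : g (M.org e.1) = g (M.org (M.rev e.1))
    · refine ⟨M.org e.1, ?_⟩
      rw [sideLevel, ← he]
      ring
    · obtain ⟨x, hx⟩ := (mem_nodeParams_iff he).1 hr
      exact ⟨x, hx.symm⟩

end IsRegular

end Conjugate

end AnnulusMap

/-! ### The conjugate function as a side function, and the rectangle -/

namespace AnnulusMap

variable {D V : Type*} [Fintype D] [Fintype V] [DecidableEq D]

theorem sideValue_eq_sideInterp (M : AnnulusMap D V) (c : D → ℝ) (g : V → ℝ) (S : Set D) :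
    M.sideValue c g S = M.sideInterp g fun e r => M.nodeValue c g S (M.pt g S e r) := rfl

theorem pt_one (M : AnnulusMap D V) (g : V → ℝ) (S : Set D) {e e' : M.Side}
    (h : e'.1 = M.next e.1) : M.pt g S e 1 = M.pt g S e' 0 :=
  toQ_eq_of_coord_eq (by simp [ChordPoint.coord, sidePt_one, h])

theorem pt_symm (M : AnnulusMap D V) (g : V → ℝ) {S : Set D} {e e' : M.Side}
    (h : e'.1 = M.rev e.1) (hS : e.1 ∉ S) (hS' : e'.1 ∉ S) (r : unitInterval) :
    M.pt g S e' (unitInterval.symm r) = M.pt g S e r := by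
  symm
  refine Quot.sound ⟨e.1, e.2, h ▸ e'.2, hS, h ▸ hS', r, ?_, ?_⟩
  · simp [ChordPoint.coord]
  · simp [ChordPoint.coord, h]

namespace IsRegular

variable {M : AnnulusMap D V} {c : D → ℝ} {k : ℝ} {g : V → ℝ} (R : M.IsRegular c k g)
include R

/-- From the right end of a segment of a level curve, an edge goes down. -/
theorem exists_downSide {S : Set D} {e d : M.Side} (hc : M.next.SameCycle e.1 d.1)
    (hd : M.Desc g d.1) {r r' : unitInterval}
    (hl : M.sideLevel g e.1 r = M.sideLevel g d.1 r') (hne : M.sidePt e.1 r ≠ M.sidePt d.1 r') :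
    ∃ f : M.Side, M.Exits (Above g (M.sideLevel g d.1 r')) f.1 ∧
      ∃ ρ, M.pt g S f ρ = M.pt g S d r' := by
  have h0 := R.sideLevel_mem d.1 r'
  have hanti := sideLevel_strictAnti hd
  have hd' : g (M.org (M.rev d.1)) < g (M.org d.1) := hd
  have horg : Above g (M.sideLevel g d.1 r') (M.org d.1) := by
    have := hanti.antitone (show 0 ≤ r' from r'.2.1)
    rw [sideLevel_zero] at this
    exact ⟨this, (R.nonneg _).trans_lt hd'⟩
  by_cases hend : Above g (M.sideLevel g d.1 r') (M.org (M.rev d.1))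
  · have hr' : r' = 1 := by
      by_contra h
      have := hanti (lt_of_le_of_ne r'.2.2 h)
      rw [sideLevel_one] at this
      exact this.not_ge hend.1
    subst hr'
    rw [sideLevel_one] at *
    -- The level passes through the lower end of `d`, so `d` does not leave the superlevel set, but
    -- the next side does. Were that side ascending, the cell would have a local minimum at the
    -- corner and the segment would be a point. Constancy on it is excluded because the level is
    -- positive and less than that of the origin of `d`.
    let f : M.Side := ⟨M.next d.1, M.inner_next.2 d.2⟩
    have hfo : g (M.org f.1) = g (M.org (M.rev d.1)) := by rw [M.org_next]
    have hf : M.Desc g f.1 := by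
      by_contra hf
      rcases (not_lt.1 hf).eq_or_lt with h | h
      · rcases R.flat f.1 h with h1 | h1
        · have := R.mem_E₁_iff.1 h1.1
          have := R.le_k (M.org d.1)
          linarith
        · have := R.mem_E₂_iff.1 h1.1
          have := hend.2
          linarith
      · refine hne ?_
        rw [sidePt_one]
        exact R.sidePt_eq_of_isMin (e := f) h (by simpa [f] using hd)
          (by simpa [f] using hc.symm) (by rw [hl, hfo])
    refine ⟨f, ⟨by rwa [Above, hfo], fun h => h.1.not_gt ?_⟩, 0, (M.pt_one g S rfl).symm⟩
    rw [← hfo]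
    exact hf
  · exact ⟨d, ⟨horg, hend⟩, r', rfl⟩

variable {n : ℕ} {s : Fin (n + 1) → D} (hs : M.IsSlit g s)
include hs

omit R hs in
theorem nodeValue_base {e : M.Side} (he : M.rev e.1 ∈ Set.range s) (r : unitInterval) :
    M.nodeValue c g (Set.range s) (M.pt g _ e r) = 0 := if_pos ⟨e, he, r, rfl⟩

/-- At the end of a level curve all edges that leave the superlevel set have been counted, and by
`sum_exits` their fluxes add up to the same total at every level. -/
theorem nodeValue_top {e : M.Side} (he : e.1 ∈ Set.range s) {r : unitInterval}
    (hr : r ∈ M.nodeParams g e) :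
    M.nodeValue c g (Set.range s) (M.pt g _ e r) = M.totalFlux c g := by
  obtain ⟨B, hB⟩ := R.exists_isSideFunction hs
  have hi := R.inner_rev_of_desc (hs.desc he)
  have hnb : M.pt g (Set.range s) e r ∉ M.base g (Set.range s) := by
    intro hb
    have h1 := R.sideExt_le_of_mem_base hs hB hb
      (w := M.pt g _ ⟨M.rev e.1, hi⟩ (unitInterval.symm r)) (by simp only [gExt_pt, sideLevel_rev])
    rw [R.sideExt_pt hB, R.sideExt_pt hB] at h1
    exact h1.not_gt (hB.jump e ⟨M.rev e.1, hi⟩ rfl he r)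
  have hmem := R.sideLevel_mem e.1 r
  have hU := R.isCut_above hmem.1 hmem.2
  rw [R.nodeValue_eq hs hB hnb ⟨e, r, hr, rfl⟩, gExt_pt, R.sideExt_pt hB, ← R.sum_exits hs hU]
  classical
  rw [← finsum_mem_coe_finset]
  refine finsum_mem_eq_of_bijOn Subtype.val ⟨fun f hf => ?_, Subtype.val_injective.injOn,
    fun d hd => ?_⟩ fun _ _ => rfl
  · simpa using hf.1
  · have hd' : M.Exits (Above g (M.sideLevel g e.1 r)) d := by simpa using hd
    have hdd := hd'.desc hU
    obtain ⟨ρ, hρ⟩ := exists_sideLevel_eq hdd (hU.ge _ hd'.2) (hU.le _ hd'.1)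
    refine ⟨⟨d, R.inner_of_desc hdd⟩, ⟨hd', ρ, hρ, ?_⟩, rfl⟩
    rw [← R.sideExt_pt hB]
    exact R.le_sideExt_pt hs hB he (by rw [gExt_pt, hρ])

/-- From the left end of a nondegenerate segment to its right end, the sum of fluxes keeps all its
terms and gains the edge that goes down from the right end. Across the slit the value jumps from 0
to the total flux. -/
theorem isNodeFunction_nodeValue : M.IsNodeFunction g (Set.range s)
    fun e r => M.nodeValue c g (Set.range s) (M.pt g _ e r) where
  next e e' h := by rw [M.pt_one g _ h]
  glue e e' h hS hS' r _ := by rw [M.pt_symm g h hS hS']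
  jump e e' h hS r hr := by
    rw [R.nodeValue_top hs hS hr, nodeValue_base (by rwa [h, M.rev_rev])]
    exact R.totalFlux_pos
  lt e e' hc he he' r r' hr hl hne := by
    obtain ⟨B, hB⟩ := R.exists_isSideFunction hs
    have hlt := hB.lt e e' hc he he' r r' hl hne
    have hr' : r' ∈ M.nodeParams g e' := by
      obtain ⟨x, hx⟩ := (mem_nodeParams_iff (ne_of_lt he)).1 hr
      exact (mem_nodeParams_iff (ne_of_gt he')).2 ⟨x, by rw [← hl, hx]⟩
    have hnb : M.pt g (Set.range s) e' r' ∉ M.base g (Set.range s) := by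
      intro hb
      have h1 := R.sideExt_le_of_mem_base hs hB hb (w := M.pt g _ e r)
        (by rw [gExt_pt, gExt_pt, hl])
      rw [R.sideExt_pt hB, R.sideExt_pt hB] at h1
      exact h1.not_gt hlt
    have hmem := R.sideLevel_mem e'.1 r'
    have hU := R.isCut_above hmem.1 hmem.2
    obtain ⟨f, hf, ρ, hρ⟩ := R.exists_downSide (S := Set.range s) hc he' hl hne
    have hρl : M.sideLevel g f.1 ρ = M.sideLevel g e'.1 r' := by
      rw [← gExt_pt (S := Set.range s), hρ, gExt_pt]
    have hρB : B f ρ = B e' r' := by rw [← R.sideExt_pt hB, hρ, R.sideExt_pt hB]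
    rw [R.nodeValue_eq hs hB hnb ⟨e', r', hr', rfl⟩, gExt_pt, R.sideExt_pt hB]
    have hpos : ∀ i ∈ {e : M.Side | M.Exits (Above g (M.sideLevel g e'.1 r')) e.1 ∧
        ∃ r, M.sideLevel g e.1 r = M.sideLevel g e'.1 r' ∧ B e r ≤ B e' r'},
        0 < M.flux c g i.1 := fun i hi => R.flux_pos (hi.1.desc hU)
    have hmemf : f ∈ {e : M.Side | M.Exits (Above g (M.sideLevel g e'.1 r')) e.1 ∧
        ∃ r, M.sideLevel g e.1 r = M.sideLevel g e'.1 r' ∧ B e r ≤ B e' r'} :=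
      ⟨hf, ρ, hρl, hρB.le⟩
    by_cases hb : M.pt g (Set.range s) e r ∈ M.base g (Set.range s)
    · rw [nodeValue, if_pos hb]
      simpa using finsum_mem_lt_finsum_mem (Set.toFinite _) (Set.empty_subset _) hpos hmemf
        (Set.notMem_empty _)
    · rw [R.nodeValue_eq hs hB hb ⟨e, r, hr, rfl⟩, gExt_pt, R.sideExt_pt hB, hl]
      refine finsum_mem_lt_finsum_mem (Set.toFinite _) ?_ hpos hmemf ?_
      · rintro i ⟨h1, ρ', h2, h3⟩
        exact ⟨h1, ρ', h2, h3.trans hlt.le⟩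
      · rintro ⟨h1, ρ', h2, h3⟩
        rw [sideLevel_injective (ne_of_gt (h1.desc hU)) (h2.trans hρl.symm), hρB] at h3
        exact h3.not_gt hlt

theorem isSideFunction_sideValue : M.IsSideFunction g (Set.range s)
    (M.sideValue c g (Set.range s)) :=
  (R.isNodeFunction_nodeValue hs).isSideFunction

omit R hs in
theorem sideValue_base {e : M.Side} (he : M.rev e.1 ∈ Set.range s) (r : unitInterval) :
    M.sideValue c g (Set.range s) e r = 0 := by
  rw [sideValue_eq_sideInterp, sideInterp]
  obtain ⟨a, b, hab, ha, hb, hN, har, hrb⟩ := exists_consecutive (finite_nodeParams (g := g) e)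
    (zero_mem_nodeParams e) (one_mem_nodeParams e) r
  rw [nodeInterp_eq hab ha hb hN har hrb, nodeValue_base he, nodeValue_base he]
  simp

theorem sideValue_top {e : M.Side} (he : e.1 ∈ Set.range s) (r : unitInterval) :
    M.sideValue c g (Set.range s) e r = M.totalFlux c g := by
  rw [sideValue_eq_sideInterp, sideInterp]
  obtain ⟨a, b, hab, ha, hb, hN, har, hrb⟩ := exists_consecutive (finite_nodeParams (g := g) e)
    (zero_mem_nodeParams e) (one_mem_nodeParams e) r
  have hpos : (0 : ℝ) < b - a := sub_pos.2 hab
  rw [nodeInterp_eq hab ha hb hN har hrb, R.nodeValue_top hs he ha, R.nodeValue_top hs he hb]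
  field_simp
  ring

/-- By definition `gStar` is the extension of `sideValue`, so the result for an arbitrary side
function applies. -/
theorem isClosedEmbedding_gStar : Topology.IsClosedEmbedding fun z : M.QSlit g (Set.range s) =>
    (M.gExt g _ z, M.gStar c g _ z) :=
  R.isEmbedding hs (R.isSideFunction_sideValue hs)

/-- The function `g` and its conjugate map `Q_slit` onto a rectangle. -/
theorem range_gExt_gStar : Set.range (fun z : M.QSlit g (Set.range s) =>
    (M.gExt g _ z, M.gStar c g _ z)) = Set.Icc 0 k ×ˢ Set.Icc 0 (M.totalFlux c g) := by
  have hB := R.isSideFunction_sideValue hs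
  have key : ∀ a ∈ Set.Icc 0 k, (∀ z, M.gExt g (Set.range s) z = a →
      M.gStar c g (Set.range s) z ∈ Set.Icc 0 (M.totalFlux c g)) ∧
      ∀ t ∈ Set.Icc 0 (M.totalFlux c g),
        ∃ z, M.gExt g (Set.range s) z = a ∧ M.gStar c g (Set.range s) z = t := fun a ha => by
    obtain ⟨e₀, e₁, r₀, h1, h2, h3⟩ := R.exists_slit_pt hs ha
    have := R.sideExt_level hs hB h1 h2 h3
    rwa [sideValue_base (by rwa [h2, M.rev_rev]), R.sideValue_top hs h1] at this
  ext ⟨a, t⟩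
  constructor
  · rintro ⟨z, hz⟩
    rw [← hz]
    exact ⟨R.gExt_mem z, (key _ (R.gExt_mem z)).1 z rfl⟩
  · rintro ⟨ha, ht⟩
    obtain ⟨z, hz, hz'⟩ := (key a ha).2 t ht
    exact ⟨z, Prod.ext hz hz'⟩

end IsRegular

end AnnulusMap

/-! ### Level curves in a rectangle -/

section Curve

variable {X : Type*} [TopologicalSpace X] {f h : X → ℝ} {k T t : ℝ}
  (hk : 0 < k) (hfh : Topology.IsClosedEmbedding fun z => (f z, h z))
  (hr : Set.range (fun z => (f z, h z)) = Set.Icc 0 k ×ˢ Set.Icc 0 T) (ht : t ∈ Set.Icc 0 T)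
include hk hfh hr ht

/-- Parametrization of a level curve of the second one of two functions that map a space
homeomorphically onto a rectangle. -/
theorem exists_curve : ∃ γ : unitInterval → X, Topology.IsEmbedding γ ∧
    Set.range γ = {z | h z = t} ∧ ∀ τ, f (γ τ) = k * (1 - (τ : ℝ)) := by
  have hex : ∀ τ : unitInterval, ∃ z, (f z, h z) = (k * (1 - (τ : ℝ)), t) := by
    intro τ
    have h0 := τ.2.1
    have h1 := τ.2.2
    exact Set.mem_range.1 (hr ▸ ⟨⟨by nlinarith, by nlinarith⟩, ht⟩)
  choose γ hγ using hex
  have hcomp : (fun z => (f z, h z)) ∘ γ = fun τ : unitInterval => (k * (1 - (τ : ℝ)), t) :=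
    funext hγ
  have hcont : Continuous fun τ : unitInterval => (k * (1 - (τ : ℝ)), t) := by fun_prop
  have hemb : Topology.IsEmbedding fun τ : unitInterval => (k * (1 - (τ : ℝ)), t) := by
    refine (hcont.isClosedEmbedding fun τ τ' h => ?_).isEmbedding
    have h1 := mul_left_cancel₀ hk.ne' (congrArg Prod.fst h)
    exact Subtype.ext (by simpa using h1)
  refine ⟨γ, ?_, ?_, fun τ => congrArg Prod.fst (hγ τ)⟩
  · refine Topology.IsEmbedding.of_comp ?_ hfh.continuous (hcomp ▸ hemb)
    rw [hfh.isInducing.continuous_iff, hcomp]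
    exact hcont
  · apply Set.Subset.antisymm
    · rintro _ ⟨τ, rfl⟩
      exact congrArg Prod.snd (hγ τ)
    · intro z hz
      have hmem : (f z, h z) ∈ Set.Icc 0 k ×ˢ Set.Icc 0 T := hr ▸ ⟨z, rfl⟩
      refine ⟨⟨1 - f z / k, sub_nonneg.2 ((div_le_one hk).2 hmem.1.2),
        sub_le_self _ (div_nonneg hmem.1.1 hk.le)⟩, hfh.injective ?_⟩
      rw [hγ, Prod.mk.injEq]
      refine ⟨?_, hz.symm⟩
      push_cast
      field_simp
      ring

theorem isSimpleCurveJoining_of_rectangle :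
    IsSimpleCurveJoining {z | h z = t} {z | f z = k} {z | f z = 0} := by
  obtain ⟨γ, h1, h2, h3⟩ := exists_curve hk hfh hr ht
  refine ⟨γ, h1, h2, by simp [h3], by simp [h3], fun τ h0 h1 => ?_⟩
  have h0' : (0 : ℝ) < τ := h0
  have h1' : (τ : ℝ) < 1 := h1
  rintro (h | h)
  · have : k * (1 - (τ : ℝ)) = k := by rw [← h3]; exact h
    nlinarith
  · have : k * (1 - (τ : ℝ)) = 0 := by rw [← h3]; exact h
    nlinarith

theorem isNotEndpoint_of_rectangle {z : X} (hz : f z ≠ k) (hz' : f z ≠ 0) :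
    IsNotEndpoint {z | h z = t} z := by
  have hf : Continuous f := continuous_fst.comp hfh.continuous
  have hmem : ∀ z, f z ∈ Set.Icc 0 k := fun z =>
    (show (f z, h z) ∈ Set.Icc 0 k ×ˢ Set.Icc 0 T from hr ▸ ⟨z, rfl⟩).1
  obtain ⟨γ, h1, h2, h3⟩ := exists_curve hk hfh hr ht
  refine ⟨f ⁻¹' Set.Ioo 0 k, isOpen_Ioo.preimage hf, ⟨lt_of_le_of_ne (hmem z).1 hz'.symm,
    lt_of_le_of_ne (hmem z).2 hz⟩, ?_⟩
  -- The sigmoid identifies the real line with the open unit interval, so the part of the curve over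
  -- the open interval (0, k) is an open arc.
  have hrange : Set.range (γ ∘ unitInterval.sigmoid) = {z | h z = t} ∩ f ⁻¹' Set.Ioo 0 k := by
    rw [Set.range_comp, unitInterval.range_sigmoid, ← h2]
    ext w
    constructor
    · rintro ⟨τ, ⟨h0, h1⟩, rfl⟩
      have h0' : (0 : ℝ) < τ := h0
      have h1' : (τ : ℝ) < 1 := h1
      refine ⟨⟨τ, rfl⟩, ?_, ?_⟩
      · rw [h3]; nlinarith
      · rw [h3]; nlinarith
    · rintro ⟨⟨τ, rfl⟩, h0, h1⟩
      rw [h3] at h0 h1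
      exact ⟨τ, ⟨show (0 : ℝ) < τ by nlinarith, show (τ : ℝ) < 1 by nlinarith⟩, rfl⟩
  exact ⟨(Homeomorph.setCongr hrange.symm).trans (h1.comp Topology.isEmbedding_sigmoid).toHomeomorph.symm⟩

end Curve

theorem proposition3 {D V : Type*} [Fintype D] [Fintype V] [DecidableEq D]
    (M : AnnulusMap D V) (c : D → ℝ) (hc : M.IsConductance c) (k : ℝ) (hk : 0 < k)
    (g : V → ℝ) (hg : M.IsDirichletSolution c k g)
    -- adjacent vertices have different `g`-values, unless they are on the same boundary component
    (hne : ∀ d, g (M.org d) = g (M.org (M.rev d)) →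
      (M.org d ∈ M.E₁ ∧ M.org (M.rev d) ∈ M.E₁) ∨ (M.org d ∈ M.E₂ ∧ M.org (M.rev d) ∈ M.E₂))
    -- every boundary vertex has a neighbour that is not on the same boundary component
    (hE₁ : ∀ v ∈ M.E₁, ∃ d, M.org d = v ∧ M.org (M.rev d) ∉ M.E₁)
    (hE₂ : ∀ v ∈ M.E₂, ∃ d, M.org d = v ∧ M.org (M.rev d) ∉ M.E₂)
    {n : ℕ} (s : Fin (n + 1) → D) (hs : M.IsSlit g s) :
    (∀ C : Set (M.QSlit g (Set.range s)), IsLevelCurve (M.gStar c g (Set.range s)) C →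
      (∀ z ∈ C, z ∉ M.QE₁ g (Set.range s) → z ∉ M.QE₂ g (Set.range s) → IsNotEndpoint C z) ∧
      IsSimpleCurveJoining C (M.QE₁ g (Set.range s)) (M.QE₂ g (Set.range s))) ∧
    (∀ C C' : Set (M.QSlit g (Set.range s)), IsLevelCurve (M.gStar c g (Set.range s)) C →
      IsLevelCurve (M.gStar c g (Set.range s)) C' → C ≠ C' → Disjoint C C') := by
  have R : M.IsRegular c k g := ⟨hc, hk, hg, hne, hE₁, hE₂⟩
  have hB := R.isSideFunction_sideValue hs
  have hE := R.isClosedEmbedding_gStar hs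
  have hr := R.range_gExt_gStar hs
  have h₁ : M.QE₁ g (Set.range s) = {z | M.gExt g _ z = k} := Set.ext (R.mem_QE₁_iff hs hB)
  have h₂ : M.QE₂ g (Set.range s) = {z | M.gExt g _ z = 0} := Set.ext (R.mem_QE₂_iff hs hB)
  rw [h₁, h₂]
  refine ⟨?_, ?_⟩
  · rintro _ ⟨⟨w, hw⟩, t, rfl⟩
    -- Since the level curve is non-empty, its value lies in the range of `gStar`.
    have ht : t ∈ Set.Icc 0 (M.totalFlux c g) := hw ▸
      (show (M.gExt g _ w, M.gStar c g _ w) ∈ Set.Icc 0 k ×ˢ Set.Icc 0 (M.totalFlux c g) from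
        hr ▸ ⟨w, rfl⟩).2
    exact ⟨fun z _ hz hz' => isNotEndpoint_of_rectangle hk hE hr ht hz hz',
      isSimpleCurveJoining_of_rectangle hk hE hr ht⟩
  · rintro _ _ ⟨-, t, rfl⟩ ⟨-, t', rfl⟩ h
    refine Set.disjoint_left.2 fun z hz hz' => h ?_
    have : t = t' := hz.symm.trans hz'
    rw [this]
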